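/- Let $k$ be a field of characteristic zero and let $R=\bigoplus_{i\ge 0}R_i$ be a commutative Noetherian $\mathbb N$-graded Cohen–Macaulay ring with $R_0=k$; put $\mathfrak m=\bigoplus_{i>0}R_i$ and $d=\dim R$. Graded modules are finitely generated $\mathbb Z$-graded $R$-modules, with degree-preserving homomorphisms. A graded module $M$ is called graded Cohen–Macaulay (CM) if $\operatorname{Ext}^i_R(R/\mathfrak m,M)=0$ for all $i<d$ (in particular $0$ is CM). Write $M(j)$ for the shift $M(j)_n=M_{n+j}$, $h(M)=(\dim_k M_n)_{n\in\mathbb Z}$, and $[M,X]=\dim_k\operatorname{Hom}_R(M,X)$, where $\operatorname{Hom}_R(M,X)$ is the space of degree-preserving $R$-linear maps. For graded CM modules $M,N$ write $M\le_{hom}N$ if $[M,X]\le[N,X]$ for every graded CM module $X$. Let $M$ and $N$ be graded CM modules with $h(M)=h(N)$ and $M\le_{hom}N$. (1) Suppose that $R$ is a graded isolated singularity, that is, for every graded prime ideal $\mathfrak p\neq\mathfrak m$ the homogeneous localization $R_{(\mathfrak p)}$ (obtained by inverting the homogeneous elements outside $\mathfrak p$) is regular. Then for every graded CM module $X$ there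 is an integer $l_X$ such that $[M,X(l)]=[N,X(l)]$ and $[M,X(-l)]=[N,X(-l)]$ for all $l\ge l_X$. (2) Suppose that $R$ is of graded finite representation type, that is, up to isomorphism and shift there are only finitely many indecomposable graded CM modules. Then, up to isomorphism, there are only finitely many indecomposable graded CM modules $X$ with $[N,X]-[M,X]>0$. -/

import Mathlib

universe u v

/-- An object of `mod^ℤ(R)`: a finitely generated `ℤ`-graded module over the `ℕ`-graded
`k`-algebra `R = ⨁ 𝒜 i`, with homogeneous components `deg n` for `n : ℤ`. -/
structure GrMod {k : Type v} [Field k] {R : Type u} [CommRing R] [Algebra k R]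
    (𝒜 : ℕ → Submodule k R) where
  carrier : Type u
  [addCommGroup : AddCommGroup carrier]
  [moduleBase : Module k carrier]
  [module : Module R carrier]
  [isScalarTower : IsScalarTower k R carrier]
  [finite : Module.Finite R carrier]
  deg : ℤ → Submodule k carrier
  isInternal : DirectSum.IsInternal deg
  smul_mem : ∀ (i : ℕ) (n : ℤ) (a : R) (m : carrier),
    a ∈ 𝒜 i → m ∈ deg n → a • m ∈ deg (n + i)

namespace GrMod

variable {k : Type v} [Field k] {R : Type u} [CommRing R] [Algebra k R]
  {𝒜 : ℕ → Submodule k R}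

attribute [instance] addCommGroup moduleBase module isScalarTower finite

/-- The shift `M(j)`, with `M(j)_n = M_{n+j}`. -/
def shift (M : GrMod 𝒜) (j : ℤ) : GrMod 𝒜 where
  carrier := M.carrier
  deg n := M.deg (n + j)
  isInternal := by
    have h := (DirectSum.isInternal_submodule_iff_iSupIndep_and_iSup_eq_top _).1 M.isInternal
    refine (DirectSum.isInternal_submodule_iff_iSupIndep_and_iSup_eq_top _).2 ⟨?_, ?_⟩
    · exact h.1.comp (add_left_injective j)
    · exact ((Equiv.addRight j).iSup_comp (g := M.deg)).trans h.2
  smul_mem i n a m ha hm := by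
    have h := M.smul_mem i (n + j) a m ha hm
    rwa [add_right_comm] at h

/-- `Hom_R(M, X)` in `mod^ℤ(R)`: the `k`-space of `R`-linear maps that preserve degrees. -/
def hom (M X : GrMod 𝒜) : Submodule k (M.carrier →ₗ[R] X.carrier) where
  carrier := {f | ∀ (n : ℤ) (m : M.carrier), m ∈ M.deg n → f m ∈ X.deg n}
  zero_mem' n _ _ := (X.deg n).zero_mem
  add_mem' hf hg n m hm := (X.deg n).add_mem (hf n m hm) (hg n m hm)
  smul_mem' c _ hf n m hm := (X.deg n).smul_mem c (hf n m hm)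

/-- `[M, X] = dim_k Hom_R(M, X)`. -/
noncomputable def homDim (M X : GrMod 𝒜) : ℕ := Module.finrank k (hom M X)

/-- The Hilbert function `h(M) = (dim_k M_n)_{n ∈ ℤ}`. -/
noncomputable def hilb (M : GrMod 𝒜) : ℤ → ℕ := fun n => Module.finrank k (M.deg n)

/-- Isomorphism in `mod^ℤ(R)`. -/
def Iso (M N : GrMod 𝒜) : Prop :=
  ∃ e : M.carrier ≃ₗ[R] N.carrier, ∀ (n : ℤ) (m : M.carrier), m ∈ M.deg n ↔ e m ∈ N.deg n

/-- `A` is a graded submodule of `M`: it is generated by its homogeneous elements. -/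
def IsGradedSubmodule (M : GrMod 𝒜) (A : Submodule R M.carrier) : Prop :=
  A = Submodule.span R {x | x ∈ A ∧ ∃ n : ℤ, x ∈ M.deg n}

/-- `M` is indecomposable in `mod^ℤ(R)`: it is nonzero and is not the direct sum of two nonzero
graded submodules. -/
def Indecomposable (M : GrMod 𝒜) : Prop :=
  Nontrivial M.carrier ∧ ∀ A B : Submodule R M.carrier,
    M.IsGradedSubmodule A → M.IsGradedSubmodule B → IsCompl A B → A = ⊥ ∨ B = ⊥

end GrMod

section Ring

variable {k : Type v} [Field k] {R : Type u} [CommRing R] [Algebra k R]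
  (𝒜 : ℕ → Submodule k R) [GradedAlgebra 𝒜]

/-- The ideal `𝔪 = ⨁_{i > 0} R_i`. -/
def grMaxIdeal : Ideal R := (HomogeneousIdeal.irrelevant 𝒜).toIdeal

/-- The Cohen-Macaulay condition `Ext^i_R(R/𝔪, M) = 0` for all `i < dim R`.
As `R` is Noetherian and `R/𝔪` is finitely generated, for a graded module `M` the module
`Ext^i_R(R/𝔪, M)` is the underlying module of the graded `*Ext^i_R(R/𝔪, M)`. -/
def IsGradedCM (M : Type u) [AddCommGroup M] [Module R M] : Prop :=
  ∀ i : ℕ, ((i : ℕ∞) : WithBot ℕ∞) < ringKrullDim R →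
    Subsingleton (CategoryTheory.Abelian.Ext
      (ModuleCat.of R (R ⧸ grMaxIdeal 𝒜)) (ModuleCat.of R M) i)

/-- The homogeneous elements of `R` outside the prime ideal `p`. -/
def homogeneousCompl (p : Ideal R) [p.IsPrime] : Submonoid R :=
  SetLike.homogeneousSubmonoid 𝒜 ⊓ p.primeCompl

/-- `R` is a graded isolated singularity: the homogeneous localization `R_(p)`, which inverts the
homogeneous elements outside `p`, is a regular ring for every graded prime `p ≠ 𝔪`. -/
def IsGradedIsolatedSingularity : Prop :=
  ∀ (p : Ideal R) [p.IsPrime], p.IsHomogeneous 𝒜 → p ≠ grMaxIdeal 𝒜 →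
    IsRegularRing (Localization (homogeneousCompl 𝒜 p))

variable {𝒜}

/-- `M ∈ CM^ℤ(R)`. -/
def GrMod.IsCM (M : GrMod 𝒜) : Prop := IsGradedCM 𝒜 M.carrier

/-- The hom order on `CM^ℤ(R)`: `[M, X] ≤ [N, X]` for every `X ∈ CM^ℤ(R)`. -/
def GrMod.HomLE (M N : GrMod 𝒜) : Prop :=
  ∀ X : GrMod 𝒜, X.IsCM → M.homDim X ≤ N.homDim X

variable (𝒜) in
/-- `CM^ℤ(R)` is of graded finite representation type: up to isomorphism and shift there are only
finitely many indecomposable graded Cohen-Macaulay modules. -/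
def IsGradedFiniteRepType : Prop :=
  ∃ (r : ℕ) (Y : Fin r → GrMod 𝒜), ∀ X : GrMod 𝒜, X.IsCM → X.Indecomposable →
    ∃ (i : Fin r) (j : ℤ), X.Iso ((Y i).shift j)

end Ring

/-! Ext vanishing is first traded for homogeneous regular sequences: applied to `R ⊕ M ⊕ N ⊕ X`,
this gives one homogeneous system of parameters regular on all four modules. Let `S` be the
`k`-subalgebra that it generates. Then `R`, `M`, `N`, `X` are finite and free over `S` with
homogeneous bases. The degrees of a basis can be read off the Hilbert function, so `M` and `N` are
isomorphic as graded `S`-modules (`exists_equiv_of_hilb_eq`).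

Embed `X` into the coinduced module `W = Hom_S(R, X)`, with cokernel `Y`. The embedding splits over
`S`, hence `Y` is again Cohen–Macaulay. By adjunction `Hom_R(M, W(l))` is the space of `S`-linear
maps `M → X` of degree `l`, which only sees `M` as a graded `S`-module; hence `[M, W(l)] = [N,
W(l)]` for all `l` (`exists_coinduced_embedding`). If `Hom(L, W(l)) → Hom(L, Y(l))` is onto for `L =
M` and `L = N`, then `[M, X(l)] + [M, Y(l)] = [N, X(l)] + [N, Y(l)]`, and the hom order, applied to
both terms, forces `[M, X(l)] = [N, X(l)]`.

Surjectivity for large `|l|` follows once the cokernel of `Hom_R(L, W) → Hom_R(L, Y)` is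
finite-dimensional. It is a finitely generated graded module, so it is enough that for each
homogeneous `f : L → Y` and each homogeneous `r` of positive degree some `r ^ n • f` lifts to `W`
(`exists_forall_lift`). The two hypotheses on `R` enter only here.

For an isolated singularity, `L` is free at every graded prime other than `𝔪`, so a multiple `s •
id` with `s` outside that prime factors through a free module and `s • f` lifts. Freeness comes from
regularity of the local ring together with freeness over `S`: finite resolutions exist over a
regular local ring, and the `S`-splitting of each syzygy sequence lets freeness descend from syzygy
to module (`free_localizedModule_of_hasFreeSyzygy`).

For finite representation type, the pullbacks `E_n` of `W → Y` along `r ^ n • f` are extensions of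
`L` by `X`, so they are Cohen–Macaulay with boundedly many generators and fall into finitely many
isomorphism classes. Thus `E_n ≅ E_m` for some `n < m`. A Miyata-type dimension count on truncations
of `X` then shows that the extension `E_n` splits, that is, `r ^ n • f` lifts
(`exists_lift_of_pullback_equiv`). Part (2) follows by applying the asymptotic equality to each of
the finitely many indecomposables up to shift. -/

namespace InternalGrading

/-! ### Internal gradings and graded Hom spaces -/

variable {k : Type*} {V V' : Type*} [Field k] [AddCommGroup V] [Module k V]
  [AddCommGroup V'] [Module k V'] {p : ℤ → Submodule k V} {q : ℤ → Submodule k V'}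

/-- The decomposition of an internally graded space. -/
noncomputable def decomp (h : DirectSum.IsInternal p) : V ≃ₗ[k] DirectSum ℤ (fun n => p n) :=
  (LinearEquiv.ofBijective (DirectSum.coeLinearMap p) h).symm

theorem decomp_of_mem (h : DirectSum.IsInternal p) {n : ℤ} {x : V} (hx : x ∈ p n) :
    decomp h x = DirectSum.lof k ℤ (fun i => p i) n ⟨x, hx⟩ :=
  (LinearEquiv.symm_apply_eq (LinearEquiv.ofBijective (DirectSum.coeLinearMap p) h)).2
    (DirectSum.coeLinearMap_lof p n ⟨x, hx⟩).symm

/-- The projection of an internally graded space onto its component of degree `n`. -/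
noncomputable def comp (h : DirectSum.IsInternal p) (n : ℤ) : V →ₗ[k] V :=
  (p n).subtype ∘ₗ DirectSum.component k ℤ (fun i => p i) n ∘ₗ (decomp h).toLinearMap

variable (h : DirectSum.IsInternal p) (h' : DirectSum.IsInternal q)

theorem comp_mem (n : ℤ) (x : V) : comp h n x ∈ p n := by
  simp [comp]

theorem comp_of_mem {n : ℤ} {x : V} (hx : x ∈ p n) : comp h n x = x := by
  simp only [comp, LinearMap.comp_apply, LinearEquiv.coe_coe, decomp_of_mem h hx,
    DirectSum.component.lof_self, Submodule.subtype_apply]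

theorem comp_of_mem_ne {m n : ℤ} (hmn : m ≠ n) {x : V} (hx : x ∈ p m) : comp h n x = 0 := by
  simp only [comp, LinearMap.comp_apply, LinearEquiv.coe_coe, decomp_of_mem h hx,
    DirectSum.component.of, dif_neg hmn, map_zero]

include h in
theorem induction {P : V → Prop} (mem : ∀ n, ∀ x ∈ p n, P x) (zero : P 0)
    (add : ∀ x y, P x → P y → P (x + y)) (x : V) : P x := by
  have hx : x ∈ ⨆ n, p n := by rw [h.submodule_iSup_eq_top]; trivial
  exact Submodule.iSup_induction p (motive := P) hx mem zero add

theorem exists_finset_sum (x : V) :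
    ∃ s : Finset ℤ, x = ∑ n ∈ s, comp h n x ∧ ∀ n ∉ s, comp h n x = 0 := by
  classical
  have key : ∃ s : Finset ℤ, ∀ n ∉ s, comp h n x = 0 := by
    refine induction h (P := fun x => ∃ s : Finset ℤ, ∀ n ∉ s, comp h n x = 0) ?_ ?_ ?_ x
    · intro n x hx
      refine ⟨{n}, fun m hm => comp_of_mem_ne h (n := m) (m := n) ?_ hx⟩
      rintro rfl; simp at hm
    · exact ⟨∅, by simp⟩
    · rintro x y ⟨s, hs⟩ ⟨t, ht⟩
      refine ⟨s ∪ t, fun n hn => ?_⟩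
      simp only [Finset.mem_union, not_or] at hn
      rw [map_add, hs n hn.1, ht n hn.2, add_zero]
  obtain ⟨s, hs⟩ := key
  refine ⟨s, ?_, hs⟩
  have gen : ∀ t : Finset ℤ, (∀ n ∉ t, comp h n x = 0) → ∀ y, y = x → y = ∑ n ∈ t, comp h n y := by
    intro t ht y
    revert ht
    have : ∀ y : V, ∃ t₀ : Finset ℤ, ∀ t, t₀ ⊆ t → y = ∑ n ∈ t, comp h n y := by
      intro y
      refine induction h (P := fun y => ∃ t₀ : Finset ℤ, ∀ t, t₀ ⊆ t → y = ∑ n ∈ t, comp h n y)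
        ?_ ?_ ?_ y
      · intro n x hx
        refine ⟨{n}, fun t ht => ?_⟩
        rw [Finset.sum_eq_single n, comp_of_mem h hx]
        · intro m _ hm; exact comp_of_mem_ne h (Ne.symm hm) hx
        · intro hn; exact absurd (ht (Finset.mem_singleton_self n)) hn
      · exact ⟨∅, by simp⟩
      · rintro x y ⟨s, hs⟩ ⟨t, ht⟩
        refine ⟨s ∪ t, fun r hr => ?_⟩
        simp only [map_add, Finset.sum_add_distrib]
        rw [← hs r (Finset.subset_union_left.trans hr), ← ht r (Finset.subset_union_right.trans hr)]
    intro ht hy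
    subst hy
    obtain ⟨t₀, h₀⟩ := this y
    rw [Finset.sum_subset (Finset.subset_union_left (s₂ := t₀)) (fun n _ hn => ht n hn)]
    exact h₀ _ Finset.subset_union_right
  exact gen s hs x rfl

theorem ext {x y : V} (hxy : ∀ n, comp h n x = comp h n y) : x = y := by
  obtain ⟨s, hs, hs'⟩ := exists_finset_sum h (x - y)
  rw [← sub_eq_zero, hs]
  exact Finset.sum_eq_zero fun n _ => by rw [map_sub, hxy n, sub_self]

/-- A linear map that raises degrees by `l` commutes with the projections. -/
theorem comp_map {f : V →ₗ[k] V'} {l : ℤ} (hf : ∀ n, ∀ x ∈ p n, f x ∈ q (n + l)) (n : ℤ) (x : V) :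
    comp h' (n + l) (f x) = f (comp h n x) := by
  refine induction h (P := fun x => comp h' (n + l) (f x) = f (comp h n x)) ?_ ?_ ?_ x
  · intro m x hx
    by_cases hm : m = n
    · subst hm; rw [comp_of_mem h hx, comp_of_mem h' (hf _ _ hx)]
    · rw [comp_of_mem_ne h hm hx, comp_of_mem_ne h' (by omega : m + l ≠ n + l) (hf _ _ hx), map_zero]
  · simp
  · intro x y hx hy; simp only [map_add, hx, hy]

/-- A family of projections exhibits an internal grading. -/
theorem isInternal_of_proj {p : ℤ → Submodule k V} (π : ℤ → V → V)
    (hadd : ∀ n x y, π n (x + y) = π n x + π n y)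
    (h₁ : ∀ n, ∀ x ∈ p n, π n x = x) (h₂ : ∀ m n, m ≠ n → ∀ x ∈ p m, π n x = 0)
    (h₃ : ∀ x, x ∈ ⨆ n, p n) : DirectSum.IsInternal p := by
  refine (DirectSum.isInternal_submodule_iff_iSupIndep_and_iSup_eq_top _).2
    ⟨?_, eq_top_iff.2 fun x _ => h₃ x⟩
  intro n
  rw [Submodule.disjoint_def]
  intro x hx hx'
  rw [← h₁ n x hx]
  have h0 : π n 0 = 0 := by simpa using hadd n 0 0
  have hle : ⨆ j, ⨆ (_ : j ≠ n), p j = ⨆ j : {j // j ≠ n}, p j := iSup_subtype'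
  rw [hle] at hx'
  exact Submodule.iSup_induction (fun j : {j // j ≠ n} => p j) hx' (motive := fun x => π n x = 0)
    (fun j y hy => h₂ j n j.2 y hy) h0 (fun y z hy hz => by rw [hadd, hy, hz, add_zero])

include h in
/-- In a finite-dimensional graded space only finitely many components are nonzero. -/
theorem exists_bound [Module.Finite k V] : ∃ B : ℕ, ∀ n : ℤ, (B : ℤ) ≤ |n| → p n = ⊥ := by
  have hfin : {n : ℤ | p n ≠ ⊥}.Finite :=
    WellFoundedGT.finite_ne_bot_of_iSupIndep h.submodule_iSupIndep
  obtain ⟨B, hB⟩ := (hfin.image fun n => n.natAbs).bddAbove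
  refine ⟨B + 1, fun n hn => ?_⟩
  by_contra hne
  have : n.natAbs ≤ B :=
    hB (Set.mem_image_of_mem (fun n : ℤ => n.natAbs) (show n ∈ {n : ℤ | p n ≠ ⊥} from hne))
  rw [Int.abs_eq_natAbs] at hn
  omega

section GradedHom

variable {A : Type*} [CommRing A] [Algebra k A] [Module A V] [IsScalarTower k A V]
  [Module A V'] [IsScalarTower k A V']

variable (A p q) in
/-- The `A`-linear maps that raise degrees by `l`. -/
def homDeg (l : ℤ) : Submodule k (V →ₗ[A] V') where
  carrier := {f | ∀ n, ∀ x ∈ p n, f x ∈ q (n + l)}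
  zero_mem' n _ _ := (q (n + l)).zero_mem
  add_mem' hf hg n m hm := (q (n + l)).add_mem (hf n m hm) (hg n m hm)
  smul_mem' c _ hf n m hm := (q (n + l)).smul_mem c (hf n m hm)

/-- The component of degree `l` of a linear map. -/
noncomputable def mapComp (l : ℤ) (f : V →ₗ[k] V') : V →ₗ[k] V' :=
  DirectSum.toModule k ℤ V' (fun n => comp h' (n + l) ∘ₗ f ∘ₗ (p n).subtype) ∘ₗ
    (decomp h).toLinearMap

theorem mapComp_of_mem (l : ℤ) (f : V →ₗ[k] V') {n : ℤ} {x : V} (hx : x ∈ p n) :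
    mapComp h h' l f x = comp h' (n + l) (f x) := by
  simp only [mapComp, LinearMap.comp_apply, LinearEquiv.coe_coe, decomp_of_mem h hx,
    DirectSum.toModule_lof]
  rfl

variable (A p q) in
/-- The scalars in `A` that act homogeneously, of degree `e`, on both spaces. -/
def IsHomogeneousScalar (a : A) (e : ℤ) : Prop :=
  (∀ n, ∀ x ∈ p n, a • x ∈ p (n + e)) ∧ ∀ n, ∀ x ∈ q n, a • x ∈ q (n + e)

variable (hA : Submodule.span k {a : A | ∃ e, IsHomogeneousScalar p q A a e} = ⊤)

/-- The component of degree `l` of an `A`-linear map. -/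
noncomputable def homComp (l : ℤ) (f : V →ₗ[A] V') : V →ₗ[A] V' where
  toFun := mapComp h h' l (f.restrictScalars k)
  map_add' := map_add _
  map_smul' a x := by
    have ha : a ∈ Submodule.span k {a : A | ∃ e, IsHomogeneousScalar p q A a e} := by
      rw [hA]; trivial
    simp only [RingHom.id_apply]
    -- The identity is additive in `x` and `k`-linear in `a`, so it is enough to check homogeneous
    -- `x` and scalars acting homogeneously. Phrasing `hA` by action lets the same argument serve `A
    -- = R` and `A = S`.
    refine induction h (P := fun x => mapComp h h' l (f.restrictScalars k) (a • x) =
      a • mapComp h h' l (f.restrictScalars k) x) ?_ (by simp) ?_ x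
    · intro n x hx
      induction ha using Submodule.span_induction with
      | mem a ha =>
        obtain ⟨e, he, he'⟩ := ha
        rw [mapComp_of_mem h h' l _ hx, mapComp_of_mem h h' l _ (he n x hx)]
        have := comp_map h' h' (f := Module.toModuleEnd k (S := A) V' a) (l := e) he' (n + l) (f x)
        simp only [Module.toModuleEnd_apply, DistribSMul.toLinearMap_apply] at this
        rw [LinearMap.restrictScalars_apply, LinearMap.restrictScalars_apply, map_smul, ← this]
        congr 2; ring
      | zero => simp
      | add a b _ _ ha hb => rw [add_smul, add_smul, map_add, ha, hb]
      | smul c a _ ha => rw [smul_assoc, smul_assoc, map_smul, ha]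
    · intro x y hx hy; rw [smul_add, map_add, map_add, hx, hy, smul_add]

theorem homComp_of_mem (l : ℤ) (f : V →ₗ[A] V') {n : ℤ} {x : V} (hx : x ∈ p n) :
    homComp h h' hA l f x = comp h' (n + l) (f x) :=
  mapComp_of_mem h h' l (f.restrictScalars k) hx

theorem homComp_mem (l : ℤ) (f : V →ₗ[A] V') : homComp h h' hA l f ∈ homDeg p q A l := by
  intro n x hx
  rw [homComp_of_mem h h' hA l f hx]
  exact comp_mem h' _ _

omit [Module k V'] [Algebra k A] [IsScalarTower k A V] [IsScalarTower k A V'] in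
include h in
theorem linearMap_ext {f g : V →ₗ[A] V'} (hfg : ∀ n, ∀ x ∈ p n, f x = g x) : f = g := by
  ext x
  exact induction h (P := fun x => f x = g x) hfg (by simp)
    (fun x y hx hy => by rw [map_add, map_add, hx, hy]) x

include h h' hA in
/-- The graded `Hom` of a finite module. -/
theorem isInternal_homDeg [Module.Finite A V] : DirectSum.IsInternal (homDeg p q A) := by
  classical
  refine isInternal_of_proj (homComp h h' hA) ?_ ?_ ?_ ?_
  · intro n f g
    refine linearMap_ext h fun m x hx => ?_
    simp only [LinearMap.add_apply, homComp_of_mem h h' hA n _ hx, map_add]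
  · intro n f hf
    refine linearMap_ext h fun m x hx => ?_
    rw [homComp_of_mem h h' hA n _ hx, comp_of_mem h' (hf m x hx)]
  · intro l n hln f hf
    refine linearMap_ext h fun m x hx => ?_
    rw [homComp_of_mem h h' hA n _ hx, comp_of_mem_ne h' (by omega : m + l ≠ m + n) (hf m x hx)]
    rfl
  · intro f
    obtain ⟨s, hs⟩ := Module.Finite.fg_top (R := A) (M := V)
    choose t ht ht' using exists_finset_sum h
    choose r hr hr' using exists_finset_sum h'
    -- All differences between the degrees occurring in the images of the generators and the degrees
    -- of the generators' components; finite generation makes this set finite.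
    let L : Finset ℤ := s.biUnion fun x => (t x).biUnion fun n =>
      (r (f (comp h n x))).image fun m => m - n
    have hf : f = ∑ l ∈ L, homComp h h' hA l f := by
      have hgen : ∀ x ∈ s, ∀ n ∈ t x, f (comp h n x) = ∑ l ∈ L, homComp h h' hA l f (comp h n x) := by
        intro x hx n hn
        have h1 : ∀ l, homComp h h' hA l f (comp h n x) = comp h' (n + l) (f (comp h n x)) :=
          fun l => homComp_of_mem h h' hA l f (comp_mem h n x)
        simp only [h1]
        conv_lhs => rw [hr (f (comp h n x))]
        rw [← Finset.sum_image (s := L) (g := fun l => n + l)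
          (f := fun m => comp h' m (f (comp h n x))) (fun a _ b _ hab => by simpa using hab)]
        refine Finset.sum_subset ?_ (fun m _ hm => hr' _ m hm)
        intro m hm
        refine Finset.mem_image.2 ⟨m - n, ?_, by ring⟩
        simp only [L, Finset.mem_biUnion, Finset.mem_image]
        exact ⟨x, hx, n, hn, m, hm, rfl⟩
      refine LinearMap.ext_on hs fun x hx => ?_
      conv_lhs => rw [ht x]
      conv_rhs => rw [ht x]
      rw [map_sum, map_sum]
      refine Finset.sum_congr rfl fun n hn => ?_
      rw [hgen x hx n hn, LinearMap.sum_apply]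
    rw [hf]
    exact Submodule.sum_mem _ fun l _ =>
      Submodule.mem_iSup_of_mem l (homComp_mem h h' hA l f)

end GradedHom

end InternalGrading

/-! ### Graded modules: projections, submodules, quotients, truncations -/

section GrModAPI

open InternalGrading

variable {k : Type v} [Field k] {R : Type u} [CommRing R] [Algebra k R] {𝒜 : ℕ → Submodule k R}

namespace GrMod

/-- The projection of a graded module onto its component of degree `n`. -/
noncomputable def proj (M : GrMod 𝒜) (n : ℤ) : M.carrier →ₗ[k] M.carrier := comp M.isInternal n

theorem proj_mem (M : GrMod 𝒜) (n : ℤ) (x : M.carrier) : M.proj n x ∈ M.deg n :=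
  comp_mem M.isInternal n x

theorem proj_of_mem (M : GrMod 𝒜) {n : ℤ} {x : M.carrier} (hx : x ∈ M.deg n) : M.proj n x = x :=
  comp_of_mem M.isInternal hx

theorem proj_of_mem_ne (M : GrMod 𝒜) {m n : ℤ} (hmn : m ≠ n) {x : M.carrier} (hx : x ∈ M.deg m) :
    M.proj n x = 0 :=
  comp_of_mem_ne M.isInternal hmn hx

theorem ext_proj (M : GrMod 𝒜) {x y : M.carrier} (h : ∀ n, M.proj n x = M.proj n y) : x = y :=
  ext M.isInternal h

theorem homogeneous_induction (M : GrMod 𝒜) {P : M.carrier → Prop}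
    (mem : ∀ n, ∀ x ∈ M.deg n, P x) (zero : P 0) (add : ∀ x y, P x → P y → P (x + y))
    (x : M.carrier) : P x :=
  induction M.isInternal mem zero add x

theorem exists_sum_proj (M : GrMod 𝒜) (x : M.carrier) :
    ∃ s : Finset ℤ, x = ∑ n ∈ s, M.proj n x ∧ ∀ n ∉ s, M.proj n x = 0 :=
  exists_finset_sum M.isInternal x

theorem proj_smul (M : GrMod 𝒜) {i : ℕ} {a : R} (ha : a ∈ 𝒜 i) (n : ℤ) (x : M.carrier) :
    M.proj n (a • x) = a • M.proj (n - i) x := by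
  have := comp_map M.isInternal M.isInternal (f := Module.toModuleEnd k (S := R) M.carrier a)
    (l := i) (fun n x hx => M.smul_mem i n a x ha hx) (n - i) x
  simp only [Module.toModuleEnd_apply, DistribSMul.toLinearMap_apply, sub_add_cancel] at this
  exact this

theorem hom_proj {M N : GrMod 𝒜} {f : M.carrier →ₗ[R] N.carrier} (hf : f ∈ hom M N) (n : ℤ)
    (x : M.carrier) : N.proj n (f x) = f (M.proj n x) := by
  have := comp_map M.isInternal N.isInternal (f := f.restrictScalars k)
    (l := 0) (fun n x hx => by rw [add_zero]; exact hf n x hx) n x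
  rw [add_zero] at this
  exact this

/-- A submodule that is stable under the projections. -/
def Homog (M : GrMod 𝒜) (A : Submodule R M.carrier) : Prop := ∀ n, ∀ x ∈ A, M.proj n x ∈ A

theorem homog_ker {M N : GrMod 𝒜} {f : M.carrier →ₗ[R] N.carrier} (hf : f ∈ hom M N) :
    M.Homog (LinearMap.ker f) := by
  intro n x hx
  rw [LinearMap.mem_ker] at hx ⊢
  rw [← hom_proj hf, hx, map_zero]

theorem homog_range {M N : GrMod 𝒜} {f : M.carrier →ₗ[R] N.carrier} (hf : f ∈ hom M N) :
    N.Homog (LinearMap.range f) := by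
  rintro n _ ⟨x, rfl⟩
  exact ⟨M.proj n x, (hom_proj hf n x).symm⟩

/-- A homogeneous submodule as a graded module. -/
noncomputable def ofSub [IsNoetherianRing R] (M : GrMod 𝒜) (A : Submodule R M.carrier)
    (hA : M.Homog A) : GrMod 𝒜 where
  carrier := A
  deg n := (M.deg n).comap (A.subtype.restrictScalars k)
  isInternal := by
    refine isInternal_of_proj (fun n x => ⟨M.proj n x, hA n x x.2⟩) ?_ ?_ ?_ ?_
    · intro n x y; ext; simp
    · intro n x hx; ext; exact M.proj_of_mem hx
    · intro m n hmn x hx; ext; exact M.proj_of_mem_ne hmn hx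
    · intro x
      obtain ⟨s, hs, -⟩ := M.exists_sum_proj x
      have : x = ∑ n ∈ s, (⟨M.proj n x, hA n x x.2⟩ : A) := by
        ext; rw [AddSubmonoidClass.coe_finsetSum]; exact hs
      rw [this]
      exact Submodule.sum_mem _ fun n _ => Submodule.mem_iSup_of_mem n (M.proj_mem n x)
  smul_mem i n a m ha hm := M.smul_mem i n a m ha hm

/-- The quotient by a homogeneous submodule as a graded module. -/
noncomputable def ofQuot (M : GrMod 𝒜) (A : Submodule R M.carrier) (hA : M.Homog A) : GrMod 𝒜 where
  carrier := M.carrier ⧸ A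
  deg n := (M.deg n).map (A.mkQ.restrictScalars k)
  isInternal := by
    let π : ℤ → (M.carrier ⧸ A) → (M.carrier ⧸ A) := fun n =>
      QuotientAddGroup.map A.toAddSubgroup A.toAddSubgroup (M.proj n).toAddMonoidHom
        (fun x hx => hA n x hx)
    have hπ : ∀ n x, π n (A.mkQ x) = A.mkQ (M.proj n x) := fun n x => rfl
    refine isInternal_of_proj π ?_ ?_ ?_ ?_
    · intro n x y; exact map_add _ x y
    · rintro n _ ⟨x, hx, rfl⟩
      rw [LinearMap.restrictScalars_apply, hπ, M.proj_of_mem hx]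
    · rintro m n hmn _ ⟨x, hx, rfl⟩
      rw [LinearMap.restrictScalars_apply, hπ, M.proj_of_mem_ne hmn hx, map_zero]
    · intro x
      obtain ⟨x, rfl⟩ := A.mkQ_surjective x
      obtain ⟨s, hs, -⟩ := M.exists_sum_proj x
      rw [hs, map_sum]
      exact Submodule.sum_mem _ fun n _ => Submodule.mem_iSup_of_mem n ⟨_, M.proj_mem n x, rfl⟩
  smul_mem i n a m ha hm := by
    obtain ⟨x, hx, rfl⟩ := hm
    exact ⟨a • x, M.smul_mem i n a x ha hx, rfl⟩

theorem mkQ_mem_hom (M : GrMod 𝒜) (A : Submodule R M.carrier)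
    (hA : M.Homog A) : (A.mkQ : M.carrier →ₗ[R] (M.ofQuot A hA).carrier) ∈ hom M (M.ofQuot A hA) :=
  fun _ m hm => ⟨m, hm, rfl⟩

/-- The direct sum of two graded modules. -/
noncomputable def prod (M N : GrMod 𝒜) : GrMod 𝒜 where
  carrier := M.carrier × N.carrier
  deg n := (M.deg n).prod (N.deg n)
  isInternal := by
    refine isInternal_of_proj (fun n x => (M.proj n x.1, N.proj n x.2)) ?_ ?_ ?_ ?_
    · intro n x y; simp
    · rintro n ⟨x, y⟩ ⟨hx, hy⟩; exact Prod.ext (M.proj_of_mem hx) (N.proj_of_mem hy)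
    · rintro m n hmn ⟨x, y⟩ ⟨hx, hy⟩
      exact Prod.ext (M.proj_of_mem_ne hmn hx) (N.proj_of_mem_ne hmn hy)
    · rintro ⟨x, y⟩
      have hle₁ : ∀ n, Submodule.map (LinearMap.inl k M.carrier N.carrier) (M.deg n) ≤
          ⨆ n, (M.deg n).prod (N.deg n) := fun n => le_iSup_of_le n <| by
        rintro _ ⟨x, hx, rfl⟩; exact ⟨hx, (N.deg n).zero_mem⟩
      have hle₂ : ∀ n, Submodule.map (LinearMap.inr k M.carrier N.carrier) (N.deg n) ≤
          ⨆ n, (M.deg n).prod (N.deg n) := fun n => le_iSup_of_le n <| by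
        rintro _ ⟨x, hx, rfl⟩; exact ⟨(M.deg n).zero_mem, hx⟩
      have h₁ : ((x, 0) : M.carrier × N.carrier) ∈ ⨆ n, (M.deg n).prod (N.deg n) := by
        refine M.homogeneous_induction (P := fun x => ((x, 0) : M.carrier × N.carrier) ∈
          ⨆ n, (M.deg n).prod (N.deg n)) (fun n x hx => hle₁ n ⟨x, hx, rfl⟩) (Submodule.zero_mem _)
          (fun x y hx hy => ?_) x
        simpa using Submodule.add_mem _ hx hy
      have h₂ : ((0, y) : M.carrier × N.carrier) ∈ ⨆ n, (M.deg n).prod (N.deg n) := by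
        refine N.homogeneous_induction (P := fun x => ((0, x) : M.carrier × N.carrier) ∈
          ⨆ n, (M.deg n).prod (N.deg n)) (fun n x hx => hle₂ n ⟨x, hx, rfl⟩) (Submodule.zero_mem _)
          (fun x y hx hy => ?_) y
        simpa using Submodule.add_mem _ hx hy
      simpa using Submodule.add_mem _ h₁ h₂
  smul_mem i n a m ha hm := ⟨M.smul_mem i n a m.1 ha hm.1, N.smul_mem i n a m.2 ha hm.2⟩

section Graded

variable [GradedAlgebra 𝒜]

theorem proj_smul_induction (M : GrMod 𝒜) {A : Submodule R M.carrier} {x : M.carrier}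
    (hx : ∀ n, M.proj n x ∈ A) (r : R) (n : ℤ) : M.proj n (r • x) ∈ A := by
  induction r using DirectSum.Decomposition.inductionOn 𝒜 with
  | zero => simp
  | homogeneous a => rw [M.proj_smul a.2]; exact A.smul_mem _ (hx _)
  | add a b ha hb => rw [add_smul, map_add]; exact A.add_mem ha hb

theorem homog_span (M : GrMod 𝒜) {s : Set M.carrier} (hs : ∀ x ∈ s, ∃ n, x ∈ M.deg n) :
    M.Homog (Submodule.span R s) := by
  intro n x hx
  induction hx using Submodule.span_induction generalizing n with
  | mem x hx =>
    obtain ⟨m, hm⟩ := hs x hx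
    by_cases h : m = n
    · subst h; rw [M.proj_of_mem hm]; exact Submodule.subset_span hx
    · rw [M.proj_of_mem_ne h hm]; exact Submodule.zero_mem _
  | zero => simp
  | add x y _ _ hx hy => rw [map_add]; exact Submodule.add_mem _ (hx n) (hy n)
  | smul a x _ hx => exact M.proj_smul_induction hx a n

theorem homog_of_isGradedSubmodule {M : GrMod 𝒜} {A : Submodule R M.carrier}
    (hA : M.IsGradedSubmodule A) : M.Homog A := by
  rw [hA]
  exact M.homog_span fun x hx => hx.2

/-- The submodule of elements with components in degrees at least `b`. -/
noncomputable def ge (M : GrMod 𝒜) (b : ℤ) : Submodule R M.carrier where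
  carrier := {x | ∀ n < b, M.proj n x = 0}
  zero_mem' n _ := map_zero _
  add_mem' hx hy n hn := by rw [map_add, hx n hn, hy n hn, add_zero]
  smul_mem' r x hx n hn := by
    induction r using DirectSum.Decomposition.inductionOn 𝒜 with
    | zero => simp
    | homogeneous a => rw [M.proj_smul a.2, hx _ (by omega), smul_zero]
    | add a b ha hb => rw [add_smul, map_add, ha, hb, add_zero]

theorem deg_le_ge (M : GrMod 𝒜) {b n : ℤ} (hb : b ≤ n) {x : M.carrier} (hx : x ∈ M.deg n) :
    x ∈ M.ge b :=
  fun _ hm => M.proj_of_mem_ne (by omega) hx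

theorem homog_ge (M : GrMod 𝒜) (b : ℤ) : M.Homog (M.ge b) := by
  intro n x hx m hm
  by_cases h : n = m
  · subst h; rw [hx n hm, map_zero]
  · exact M.proj_of_mem_ne h (M.proj_mem n x)

omit [GradedAlgebra 𝒜] in
/-- A graded module is generated by finitely many homogeneous elements. -/
theorem exists_homogeneous_generators (M : GrMod 𝒜) :
    ∃ s : Finset M.carrier, Submodule.span R (s : Set M.carrier) = ⊤ ∧
      ∀ x ∈ s, ∃ n, x ∈ M.deg n := by
  classical
  obtain ⟨s, hs⟩ := Module.Finite.fg_top (R := R) (M := M.carrier)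
  choose t ht _ using M.exists_sum_proj
  refine ⟨s.biUnion fun x => (t x).image fun n => M.proj n x, ?_, ?_⟩
  · rw [eq_top_iff, ← hs, Submodule.span_le]
    intro x hx
    rw [ht x]
    refine Submodule.sum_mem _ fun n hn => Submodule.subset_span ?_
    simp only [Finset.mem_coe, Finset.mem_biUnion, Finset.mem_image]
    exact ⟨x, hx, n, hn, rfl⟩
  · intro x hx
    simp only [Finset.mem_biUnion, Finset.mem_image] at hx
    obtain ⟨y, -, n, -, rfl⟩ := hx
    exact ⟨n, M.proj_mem n y⟩

omit [GradedAlgebra 𝒜] in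
theorem exists_generators_bounded (M : GrMod 𝒜) :
    ∃ (s : Finset M.carrier) (B : ℕ), Submodule.span R (s : Set M.carrier) = ⊤ ∧
      ∀ x ∈ s, ∃ n : ℤ, -B ≤ n ∧ n ≤ B ∧ x ∈ M.deg n := by
  classical
  obtain ⟨s, hs, hd⟩ := M.exists_homogeneous_generators
  choose! d hd using hd
  refine ⟨s, s.sup fun x => (d x).natAbs, hs, fun x hx => ⟨d x, ?_, ?_, hd x hx⟩⟩
  all_goals
    have : (d x).natAbs ≤ s.sup fun x => (d x).natAbs := Finset.le_sup (f := fun x => (d x).natAbs) hx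
    omega

/-- The generators have bounded degrees and `R` has no negative degrees. -/
theorem exists_ge_eq_top (M : GrMod 𝒜) : ∃ b : ℤ, M.ge b = ⊤ := by
  obtain ⟨s, B, hs, hB⟩ := M.exists_generators_bounded
  refine ⟨-B, eq_top_iff.2 ?_⟩
  rw [← hs, Submodule.span_le]
  intro x hx
  obtain ⟨n, hn, -, h⟩ := hB x hx
  exact M.deg_le_ge hn h

theorem deg_eq_bot_of_ge_eq_top {M : GrMod 𝒜} {b : ℤ} (hb : M.ge b = ⊤) {n : ℤ} (hn : n < b) :
    M.deg n = ⊥ := by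
  refine eq_bot_iff.2 fun x hx => ?_
  have : x ∈ M.ge b := by rw [hb]; trivial
  rw [← M.proj_of_mem hx, this n hn]
  exact Submodule.zero_mem _

end Graded

end GrMod

/-! ### The irrelevant ideal -/

section Irrelevant

variable (𝒜) [GradedAlgebra 𝒜]

theorem mem_grMaxIdeal_of_mem {i : ℕ} (hi : 0 < i) {a : R} (ha : a ∈ 𝒜 i) : a ∈ grMaxIdeal 𝒜 :=
  HomogeneousIdeal.mem_irrelevant_of_mem 𝒜 hi ha

theorem exists_sum_of_mem_grMaxIdeal {a : R} (ha : a ∈ grMaxIdeal 𝒜) :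
    ∃ s : Finset ℕ, (∀ i ∈ s, 0 < i) ∧ a = ∑ i ∈ s, (DirectSum.decompose 𝒜 a i : R) := by
  classical
  refine ⟨(DirectSum.decompose 𝒜 a).support, fun i hi => ?_, (DirectSum.sum_support_decompose 𝒜 a).symm⟩
  rw [Nat.pos_iff_ne_zero]
  rintro rfl
  rw [DFinsupp.mem_support_iff] at hi
  exact hi (Subtype.ext ((HomogeneousIdeal.mem_irrelevant_iff 𝒜 a).1 ha))

theorem grMaxIdeal_eq_span :
    grMaxIdeal 𝒜 = Ideal.span {a : R | ∃ i, 0 < i ∧ a ∈ 𝒜 i} := by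
  refine le_antisymm (fun a ha => ?_) (Ideal.span_le.2 ?_)
  · obtain ⟨s, hs, h⟩ := exists_sum_of_mem_grMaxIdeal 𝒜 ha
    rw [h]
    exact Ideal.sum_mem _ fun i hi => Ideal.subset_span ⟨i, hs i hi, SetLike.coe_mem _⟩
  · rintro a ⟨i, hi, ha⟩
    exact mem_grMaxIdeal_of_mem 𝒜 hi ha

variable (hR0 : Function.Bijective (algebraMap k (𝒜 0)))

include hR0

theorem exists_sub_mem_grMaxIdeal (a : R) : ∃ c : k, a - algebraMap k R c ∈ grMaxIdeal 𝒜 := by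
  obtain ⟨c, hc⟩ := hR0.2 (DirectSum.decompose 𝒜 a 0)
  refine ⟨c, ?_⟩
  refine (HomogeneousIdeal.mem_irrelevant_iff 𝒜 _).2 ?_
  have h1 : (algebraMap k R c) ∈ 𝒜 0 := SetLike.algebraMap_mem_graded 𝒜 c
  have h2 : ((algebraMap k (𝒜 0) c : 𝒜 0) : R) = algebraMap k R c := rfl
  rw [map_sub, GradedRing.proj_apply, GradedRing.proj_apply, DirectSum.decompose_of_mem_same 𝒜 h1,
    ← hc, h2, sub_self]

theorem grMaxIdeal_ne_top : grMaxIdeal 𝒜 ≠ ⊤ := by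
  intro h
  have h1 : (1 : R) ∈ grMaxIdeal 𝒜 := by rw [h]; trivial
  have h2 := (HomogeneousIdeal.mem_irrelevant_iff 𝒜 _).1 h1
  rw [GradedRing.proj_apply, DirectSum.decompose_of_mem_same 𝒜 (SetLike.GradedOne.one_mem)] at h2
  have : (algebraMap k (𝒜 0) 1 : 𝒜 0) = algebraMap k (𝒜 0) 0 := by
    rw [map_one, map_zero]; exact Subtype.ext h2
  exact one_ne_zero (hR0.1 this)

theorem grMaxIdeal_isMaximal : (grMaxIdeal 𝒜).IsMaximal := by
  rw [Ideal.isMaximal_iff]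
  refine ⟨fun h => grMaxIdeal_ne_top 𝒜 hR0 ((Ideal.eq_top_iff_one _).2 h), fun J x hJ hx hxJ => ?_⟩
  obtain ⟨c, hc⟩ := exists_sub_mem_grMaxIdeal 𝒜 hR0 x
  have h1 : algebraMap k R c ∈ J := by
    have := J.sub_mem hxJ (hJ hc); rwa [sub_sub_cancel] at this
  have hc0 : c ≠ 0 := by
    rintro rfl; rw [map_zero, sub_zero] at hc; exact hx hc
  have := J.mul_mem_left (algebraMap k R c⁻¹) h1
  rwa [← map_mul, inv_mul_cancel₀ hc0, map_one] at this

/-- A proper homogeneous ideal is contained in `𝔪`. -/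
theorem le_grMaxIdeal_of_isHomogeneous {I : Ideal R} (hI : I.IsHomogeneous 𝒜) (hne : I ≠ ⊤) :
    I ≤ grMaxIdeal 𝒜 := by
  intro a ha
  refine (HomogeneousIdeal.mem_irrelevant_iff 𝒜 _).2 ?_
  have h0 := hI 0 ha
  obtain ⟨c, hc⟩ := hR0.2 (DirectSum.decompose 𝒜 a 0)
  rw [GradedRing.proj_apply, ← hc]
  rw [← hc] at h0
  have h2 : ((algebraMap k (𝒜 0) c : 𝒜 0) : R) = algebraMap k R c := rfl
  rw [h2] at h0 ⊢
  by_contra hc0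
  have hc0 : c ≠ 0 := by rintro rfl; exact hc0 (map_zero _)
  -- The degree-zero component of an element of `I` is a scalar in `I`; a nonzero one would be a
  -- unit.
  refine hne ((Ideal.eq_top_iff_one _).2 ?_)
  have := I.mul_mem_left (algebraMap k R c⁻¹) h0
  rwa [← map_mul, inv_mul_cancel₀ hc0, map_one] at this

omit [GradedAlgebra 𝒜] hR0 in
theorem map_mkQ_smul_top {C : Type*} [AddCommGroup C] [Module R C] (I : Ideal R)
    (A : Submodule R C) :
    (I • (⊤ : Submodule R C)).map A.mkQ = I • (⊤ : Submodule R (C ⧸ A)) := by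
  rw [Submodule.map_smul'', Submodule.map_top, Submodule.range_mkQ]

/-- A finite module that is killed by a power of `𝔪` is finite-dimensional. -/
theorem finite_of_pow_smul_eq_bot [IsNoetherianRing R] (K : ℕ) (C : Type*) [AddCommGroup C]
    [Module k C] [Module R C] [IsScalarTower k R C] [Module.Finite R C]
    (h : (grMaxIdeal 𝒜) ^ K • (⊤ : Submodule R C) = ⊥) : Module.Finite k C := by
  have base : ∀ (D : Type _) [AddCommGroup D] [Module k D] [Module R D] [IsScalarTower k R D]
      [Module.Finite R D], (grMaxIdeal 𝒜) • (⊤ : Submodule R D) = ⊥ → Module.Finite k D := by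
    intro D _ _ _ _ _ hD
    obtain ⟨s, hs⟩ := Module.Finite.fg_top (R := R) (M := D)
    refine ⟨⟨s, eq_top_iff.2 fun x _ => ?_⟩⟩
    have hx : x ∈ Submodule.span R (s : Set D) := by rw [hs]; trivial
    induction hx using Submodule.span_induction with
    | mem x hx => exact Submodule.subset_span hx
    | zero => exact Submodule.zero_mem _
    | add x y _ _ hx hy => exact Submodule.add_mem _ (hx trivial) (hy trivial)
    | smul a x _ hx =>
      obtain ⟨c, hc⟩ := exists_sub_mem_grMaxIdeal 𝒜 hR0 a
      have : (a - algebraMap k R c) • x ∈ (grMaxIdeal 𝒜) • (⊤ : Submodule R D) :=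
        Submodule.smul_mem_smul hc trivial
      rw [hD, Submodule.mem_bot, sub_smul, sub_eq_zero, algebraMap_smul] at this
      rw [this]
      exact Submodule.smul_mem _ _ (hx trivial)
  induction K generalizing C with
  | zero =>
    rw [pow_zero, Ideal.one_eq_top, Submodule.top_smul] at h
    have : Subsingleton C := by
      rw [← Submodule.subsingleton_iff R]; exact subsingleton_of_bot_eq_top h.symm
    infer_instance
  | succ K ih =>
    -- Dévissage: `𝔪 ^ K C` is killed by `𝔪`, and the quotient by it is killed by `𝔪 ^ K`.
    let A : Submodule R C := (grMaxIdeal 𝒜) ^ K • ⊤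
    have h1 : Module.Finite k A := by
      refine base A ?_
      refine (Submodule.map_injective_of_injective A.injective_subtype) ?_
      rw [Submodule.map_smul'', Submodule.map_top, Submodule.range_subtype, Submodule.map_bot,
        ← h, pow_succ', Submodule.mul_smul]
    have h2 : Module.Finite k (C ⧸ A) := by
      refine ih (C ⧸ A) ?_
      rw [← map_mkQ_smul_top]
      exact Submodule.mkQ_map_self A
    have : Module.Finite k (A.restrictScalars k) := h1
    have : Module.Finite k (C ⧸ A.restrictScalars k) := h2
    exact Module.Finite.of_submodule_quotient (A.restrictScalars k)

end Irrelevant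

/-! ### Graded Nakayama lemma and finiteness of components -/

namespace GrMod

variable [GradedAlgebra 𝒜]

theorem smul_ge_le (M : GrMod 𝒜) (b : ℤ) : grMaxIdeal 𝒜 • M.ge b ≤ M.ge (b + 1) := by
  rw [Submodule.smul_le]
  intro a ha x hx
  obtain ⟨s, hs, h⟩ := exists_sum_of_mem_grMaxIdeal 𝒜 ha
  rw [h, Finset.sum_smul]
  refine Submodule.sum_mem _ fun i hi n hn => ?_
  rw [M.proj_smul (SetLike.coe_mem _), hx _ (by have := hs i hi; omega), smul_zero]

theorem pow_smul_top_le (M : GrMod 𝒜) {b : ℤ} (hb : M.ge b = ⊤) (K : ℕ) :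
    (grMaxIdeal 𝒜) ^ K • (⊤ : Submodule R M.carrier) ≤ M.ge (b + K) := by
  induction K with
  | zero => simp [hb]
  | succ K ih =>
    rw [pow_succ', Submodule.mul_smul, Nat.cast_succ, ← add_assoc]
    exact (smul_mono_right _ ih).trans (M.smul_ge_le _)

/-- The graded Nakayama lemma. -/
theorem eq_top_of_sup_smul_eq_top (M : GrMod 𝒜) (A : Submodule R M.carrier) (hA : M.Homog A)
    (h : A ⊔ grMaxIdeal 𝒜 • (⊤ : Submodule R M.carrier) = ⊤) : A = ⊤ := by
  let Q := M.ofQuot A hA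
  have hQ : grMaxIdeal 𝒜 • (⊤ : Submodule R Q.carrier) = ⊤ := by
    have := congrArg (Submodule.map A.mkQ) h
    rw [Submodule.map_sup, Submodule.mkQ_map_self, bot_sup_eq, Submodule.map_smul'',
      Submodule.map_top, Submodule.range_mkQ] at this
    exact this
  obtain ⟨b, hb⟩ := Q.exists_ge_eq_top
  -- From `Q = 𝔪 Q` the lower bound on the degrees of `Q` can be raised indefinitely, so `Q = 0`.
  have key : ∀ K : ℕ, Q.ge (b + K) = ⊤ := by
    intro K
    induction K with
    | zero => simpa using hb
    | succ K ih =>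
      rw [eq_top_iff, ← hQ, ← ih, Nat.cast_succ, ← add_assoc]
      exact Q.smul_ge_le _
  have hz : ∀ x : Q.carrier, x = 0 := by
    intro x
    refine Q.ext_proj fun n => ?_
    rw [map_zero]
    have : x ∈ Q.ge (b + (n + 1 - b).toNat) := by rw [key]; trivial
    exact this n (by omega)
  refine eq_top_iff.2 fun x _ => ?_
  exact (Submodule.Quotient.mk_eq_zero A).1 (hz (A.mkQ x))

section FiniteDim

variable [IsNoetherianRing R] (hR0 : Function.Bijective (algebraMap k (𝒜 0)))

include hR0

/-- If `M` lives in degrees at least `b`, then `𝔪 ^ (j - b)` moves all of `M` into degrees at least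
`j`, so a power of `𝔪` kills the quotient. -/
theorem finite_quot_ge (M : GrMod 𝒜) (j : ℤ) : Module.Finite k (M.carrier ⧸ M.ge j) := by
  obtain ⟨b, hb⟩ := M.exists_ge_eq_top
  refine finite_of_pow_smul_eq_bot 𝒜 hR0 (j - b).toNat _ ?_
  rw [← map_mkQ_smul_top, eq_bot_iff]
  rintro _ ⟨x, hx, rfl⟩
  have h1 := M.pow_smul_top_le hb _ hx
  rw [Submodule.mem_bot, Submodule.mkQ_apply, Submodule.Quotient.mk_eq_zero]
  exact fun n hn => h1 n (by omega)

theorem finite_deg (M : GrMod 𝒜) (n : ℤ) : Module.Finite k (M.deg n) := by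
  have := M.finite_quot_ge hR0 (n + 1)
  let f : M.deg n →ₗ[k] M.carrier ⧸ M.ge (n + 1) :=
    (M.ge (n + 1)).mkQ.restrictScalars k ∘ₗ (M.deg n).subtype
  refine Module.Finite.of_injective f ?_
  rw [← LinearMap.ker_eq_bot, eq_bot_iff]
  rintro ⟨x, hx⟩ h
  have h1 : x ∈ M.ge (n + 1) := (Submodule.Quotient.mk_eq_zero _).1 h
  rw [Submodule.mem_bot]
  refine Subtype.ext ?_
  have h2 := h1 n (by omega)
  rwa [M.proj_of_mem hx] at h2

/-- A homomorphism is determined by its values on homogeneous generators, which lie in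
finite-dimensional components. Thus `homDim` is a genuine dimension. -/
theorem finite_hom (M N : GrMod 𝒜) : Module.Finite k (hom M N) := by
  obtain ⟨s, hs, hd⟩ := M.exists_homogeneous_generators
  choose! d hd using hd
  have := N.finite_deg hR0
  let f : hom M N →ₗ[k] (∀ x : s, N.deg (d x)) :=
    LinearMap.pi fun x =>
      { toFun := fun g => ⟨g.1 x, g.2 _ _ (hd x x.2)⟩
        map_add' := fun _ _ => rfl
        map_smul' := fun _ _ => rfl }
  refine Module.Finite.of_injective f fun g g' h => ?_
  refine Subtype.ext (LinearMap.ext_on hs fun x hx => ?_)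
  exact congrArg Subtype.val (congrFun h ⟨x, hx⟩)

end FiniteDim

end GrMod

end GrModAPI

/-! ### Regular local rings: domains and free syzygies -/

section RegularLocal

open IsLocalRing
open scoped TensorProduct
open scoped Pointwise

/-- Since `x` is not in the square of the maximal ideal, it has a unit coefficient on some member of
a minimal generating set. That generator becomes redundant modulo `x`, so `t` generators suffice,
while the dimension drops by at most one. -/
theorem IsRegularLocalRing.quotient_span_singleton {A : Type*} [CommRing A] [IsRegularLocalRing A]
    {t : ℕ} (hA : ringKrullDim A = (t + 1 : ℕ)) {x : A} (hx : x ∈ maximalIdeal A)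
    (hx2 : x ∉ maximalIdeal A ^ 2) :
    IsRegularLocalRing (A ⧸ Ideal.span {x}) ∧ ringKrullDim (A ⧸ Ideal.span {x}) = t := by
  classical
  have hne : Ideal.span {x} ≠ ⊤ := fun h => by
    have : (1 : A) ∈ maximalIdeal A := by
      have h1 : (1 : A) ∈ Ideal.span {x} := by rw [h]; trivial
      exact (Ideal.span_singleton_le_iff_mem _).2 hx h1
    exact (Ideal.ne_top_iff_one _).1 (maximalIdeal.isMaximal A).ne_top this
  have : Nontrivial (A ⧸ Ideal.span {x}) := Ideal.Quotient.nontrivial_iff.2 hne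
  have : IsLocalRing (A ⧸ Ideal.span {x}) :=
    IsLocalRing.of_surjective' (Ideal.Quotient.mk _) Ideal.Quotient.mk_surjective
  have hfg : (maximalIdeal A).FG := IsNoetherian.noetherian _
  have hrank : (maximalIdeal A).spanFinrank = t + 1 := by
    have h := IsRegularLocalRing.spanFinrank_maximalIdeal (R := A)
    rw [hA] at h
    exact_mod_cast h
  obtain ⟨s, hs, hspan⟩ := Submodule.FG.exists_span_finset_card_eq_spanFinrank hfg
  have hxs : x ∈ Submodule.span A (s : Set A) := by rw [hspan]; exact hx
  obtain ⟨f, hf, hfx⟩ := Submodule.mem_span_finset.1 hxs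
  obtain ⟨g, hg, hgu⟩ : ∃ g ∈ s, f g ∉ maximalIdeal A := by
    by_contra! hcon
    refine hx2 ?_
    rw [← hfx, pow_two]
    refine Ideal.sum_mem _ fun a ha => ?_
    refine Ideal.mul_mem_mul (hcon a ha) ?_
    rw [← hspan]; exact Submodule.subset_span ha
  have hunit : IsUnit (f g) := by
    by_contra h; exact hgu ((mem_maximalIdeal _).2 h)
  have hmax : maximalIdeal (A ⧸ Ideal.span {x}) =
      Submodule.span (A ⧸ Ideal.span {x})
        (((s.erase g).image (Ideal.Quotient.mk (Ideal.span {x}))) : Finset (A ⧸ Ideal.span {x})) := by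
    have h1 : maximalIdeal (A ⧸ Ideal.span {x}) =
        (maximalIdeal A).map (Ideal.Quotient.mk (Ideal.span {x})) := by
      refine le_antisymm ?_ ?_
      · intro y hy
        obtain ⟨y, rfl⟩ := Ideal.Quotient.mk_surjective y
        refine Ideal.mem_map_of_mem _ ?_
        rw [mem_maximalIdeal] at hy ⊢
        exact fun h => hy (h.map _)
      · refine IsLocalRing.le_maximalIdeal ?_
        intro h
        have h2 := congrArg (Ideal.comap (Ideal.Quotient.mk (Ideal.span {x}))) h
        rw [Ideal.comap_map_of_surjective _ Ideal.Quotient.mk_surjective, ← RingHom.ker_eq_comap_bot,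
          Ideal.mk_ker, Ideal.comap_top, sup_eq_left.2
          ((Ideal.span_singleton_le_iff_mem _).2 hx)] at h2
        exact (maximalIdeal.isMaximal A).ne_top h2
    refine le_antisymm ?_ ?_
    · rw [h1, ← hspan]
      change Ideal.map _ (Ideal.span _) ≤ _
      rw [Ideal.map_span, Ideal.span_le]
      rintro _ ⟨a, ha, rfl⟩
      by_cases hag : a = g
      · subst hag
        have h0 := (congrArg (Ideal.Quotient.mk (Ideal.span {x})) hfx).trans
          (Ideal.Quotient.eq_zero_iff_mem.2 (Ideal.mem_span_singleton_self x))
        rw [← Finset.add_sum_erase s _ ha, map_add, smul_eq_mul, map_mul] at h0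
        have h2 : (Ideal.Quotient.mk (Ideal.span {x})) (f a) * (Ideal.Quotient.mk (Ideal.span {x})) a ∈
            Submodule.span (A ⧸ Ideal.span {x})
              (((s.erase a).image (Ideal.Quotient.mk (Ideal.span {x}))) :
                Finset (A ⧸ Ideal.span {x})) := by
          rw [eq_neg_of_add_eq_zero_left h0, map_sum]
          refine Submodule.neg_mem _ (Submodule.sum_mem _ fun b hb => ?_)
          rw [smul_eq_mul, map_mul]
          exact Submodule.smul_mem _ _ (Submodule.subset_span (by
            rw [Finset.coe_image]; exact ⟨b, hb, rfl⟩))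
        obtain ⟨w, hw⟩ := (hunit.map (Ideal.Quotient.mk (Ideal.span {x}))).exists_left_inv
        have h3 := Submodule.smul_mem _ w h2
        rwa [smul_eq_mul, ← mul_assoc, hw, one_mul] at h3
      · refine Submodule.subset_span ?_
        rw [Finset.coe_image]
        exact ⟨a, by simpa [hag] using ha, rfl⟩
    · rw [h1, Submodule.span_le]
      intro y hy
      rw [Finset.coe_image] at hy
      obtain ⟨a, ha, rfl⟩ := hy
      refine Ideal.mem_map_of_mem _ ?_
      rw [← hspan]
      exact Submodule.subset_span (Finset.mem_of_mem_erase ha)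
  have hle : (maximalIdeal (A ⧸ Ideal.span {x})).spanFinrank ≤ t := by
    rw [hmax]
    refine (Submodule.spanFinrank_span_le_ncard_of_finite (Finset.finite_toSet _)).trans ?_
    rw [Set.ncard_coe_finset]
    refine Finset.card_image_le.trans ?_
    rw [Finset.card_erase_of_mem hg, hs, hrank]
    simp
  have hdim : (t : WithBot ℕ∞) ≤ ringKrullDim (A ⧸ Ideal.span {x}) := by
    have h1 := ringKrullDim_le_ringKrullDim_quotSMulTop_succ hx
    rw [← Submodule.ideal_span_singleton_smul, smul_eq_mul, Ideal.mul_top, hA, Nat.cast_succ] at h1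
    exact (ENat.WithBot.add_le_add_one_right_iff).1 h1
  have hreg := IsRegularLocalRing.of_spanFinrank_maximalIdeal_le (A ⧸ Ideal.span {x})
    (le_trans (by exact_mod_cast hle) hdim)
  refine ⟨hreg, le_antisymm ?_ hdim⟩
  rw [← hreg.spanFinrank_maximalIdeal]
  exact_mod_cast hle

theorem IsRegularLocalRing.isField_of_ringKrullDim_eq_zero {A : Type*} [CommRing A]
    [IsRegularLocalRing A] (hA : ringKrullDim A = (0 : ℕ)) : IsField A := by
  rw [isField_iff_maximalIdeal_eq]
  have h := IsRegularLocalRing.spanFinrank_maximalIdeal (R := A)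
  rw [hA] at h
  exact (Submodule.spanFinrank_eq_zero_iff_eq_bot (IsNoetherian.noetherian _)).1 (by exact_mod_cast h)

/-- Prime avoidance: the maximal ideal lies neither in its square (Nakayama would make it zero) nor
in a minimal prime (it has positive height). -/
theorem IsRegularLocalRing.exists_mem_notMem_sq {A : Type*} [CommRing A] [IsRegularLocalRing A]
    {t : ℕ} (hA : ringKrullDim A = (t + 1 : ℕ)) :
    ∃ x ∈ maximalIdeal A, x ∉ maximalIdeal A ^ 2 ∧ ∀ P ∈ minimalPrimes A, x ∉ P := by
  classical
  have hfin : (minimalPrimes A).Finite := Ideal.finite_minimalPrimes_of_isNoetherianRing A ⊥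
  by_contra! hcon
  have hsub : (maximalIdeal A : Set A) ⊆
      ⋃ i ∈ insert (maximalIdeal A ^ 2) (minimalPrimes A), ((id i : Ideal A) : Set A) := by
    intro x hx
    simp only [Set.mem_iUnion, Set.mem_insert_iff, exists_prop, id]
    by_cases h2 : x ∈ maximalIdeal A ^ 2
    · exact ⟨_, Or.inl rfl, h2⟩
    · obtain ⟨P, hP, hxP⟩ := hcon x hx h2
      exact ⟨P, Or.inr hP, hxP⟩
  -- Avoidance tolerates two ideals that need not be prime; both slots are given to the square.
  obtain ⟨I, hI, hle⟩ := (Ideal.subset_union_prime_finite (hfin.insert _) (f := id)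
    (maximalIdeal A ^ 2) (maximalIdeal A ^ 2) (fun i hi h1 _ => by
      rcases hi with rfl | hi
      · exact absurd rfl h1
      · exact hi.1.1)).1 hsub
  rcases hI with rfl | hI
  · have hbot : maximalIdeal A = ⊥ := by
      refine Submodule.eq_bot_of_le_smul_of_le_jacobson_bot (maximalIdeal A) _
        (IsNoetherian.noetherian _) ?_ (maximalIdeal_le_jacobson _)
      simpa [pow_two] using hle
    have h := IsRegularLocalRing.spanFinrank_maximalIdeal (R := A)
    rw [hA, hbot, Submodule.spanFinrank_bot] at h
    exact absurd (by exact_mod_cast h : 0 = t + 1) (by omega)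
  · have := hI.1.1
    have hI' : I = maximalIdeal A := le_antisymm (IsLocalRing.le_maximalIdeal this.ne_top) hle
    subst hI'
    have h0 : (maximalIdeal A).height = 0 := Ideal.height_eq_zero_iff.2 hI
    have h1 := IsLocalRing.maximalIdeal_height_eq_ringKrullDim (R := A)
    rw [hA, h0] at h1
    exact absurd (by exact_mod_cast h1 : 0 = t + 1) (by omega)

/-- By induction `(x)` is prime for a suitable `x`. A minimal prime `P ⊆ (x)` that avoids `x`
satisfies `P = xP`, so Nakayama gives `P = 0`. -/
theorem IsRegularLocalRing.isDomain_of_ringKrullDim_eq (t : ℕ) :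
    ∀ (A : Type u) [CommRing A] [IsRegularLocalRing A], ringKrullDim A = t → IsDomain A := by
  induction t with
  | zero =>
    intro A _ _ hA
    exact (IsRegularLocalRing.isField_of_ringKrullDim_eq_zero hA).isDomain
  | succ t ih =>
    intro A _ _ hA
    obtain ⟨x, hx, hx2, hxP⟩ := IsRegularLocalRing.exists_mem_notMem_sq hA
    obtain ⟨hreg, hdim⟩ := IsRegularLocalRing.quotient_span_singleton hA hx hx2
    have hdom : IsDomain (A ⧸ Ideal.span {x}) := ih _ hdim
    have hprime : (Ideal.span {x}).IsPrime := (Ideal.Quotient.isDomain_iff_prime _).1 hdom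
    obtain ⟨P, hP, hPx⟩ := Ideal.exists_minimalPrimes_le (bot_le : ⊥ ≤ Ideal.span {x})
    have hPprime := hP.1.1
    have hbot : P = ⊥ := by
      refine Submodule.eq_bot_of_le_smul_of_le_jacobson_bot (maximalIdeal A) _
        (IsNoetherian.noetherian _) ?_ (maximalIdeal_le_jacobson _)
      intro y hy
      obtain ⟨a, rfl⟩ := Ideal.mem_span_singleton'.1 (hPx hy)
      rw [mul_comm]
      exact Submodule.smul_mem_smul hx ((hPprime.mem_or_mem hy).resolve_right (hxP P hP))
    rw [hbot] at hPprime
    exact IsDomain.of_bot_isPrime A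

/-- The `n`-th syzygy of `L` is free, for every choice of a free resolution. -/
def HasFreeSyzygy (A : Type u) [CommRing A] :
    ℕ → ∀ (L : Type u) [AddCommGroup L] [Module A L], Prop
  | 0, L, _, _ => Module.Free A L
  | n + 1, L, _, _ => ∀ (K F : Type u) [AddCommGroup K] [AddCommGroup F] [Module A K] [Module A F]
      (i : K →ₗ[A] F) (g : F →ₗ[A] L), Module.Free A F → Module.Finite A F →
      Function.Injective i → Function.Exact i g → Function.Surjective g → HasFreeSyzygy A n K

theorem isSMulRegular_of_injective_of_free {A K F : Type*} [CommRing A] [IsDomain A]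
    [AddCommGroup K] [AddCommGroup F] [Module A K] [Module A F] [Module.Free A F]
    (i : K →ₗ[A] F) (hi : Function.Injective i) {z : A} (hz : z ≠ 0) : IsSMulRegular K z := by
  intro x y hxy
  refine hi ?_
  have h : z • i x = z • i y := by
    rw [← map_smul, ← map_smul]; exact congrArg i hxy
  exact smul_right_injective F hz h

/-- A syzygy sequence of `L` stays exact modulo `z` because `z` is regular on `L`, and `z` is again
regular on the syzygy, a submodule of a free module over a domain. At the end, freeness modulo a
regular element of the maximal ideal lifts. -/
theorem hasFreeSyzygy_of_quotSMulTop {A : Type u} [CommRing A] [IsDomain A] [IsLocalRing A]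
    [IsNoetherianRing A] {z : A} (hz : z ∈ IsLocalRing.maximalIdeal A) (hz0 : z ≠ 0) (n : ℕ) :
    ∀ (L : Type u) [AddCommGroup L] [Module A L] [Module.Finite A L], IsSMulRegular L z →
      HasFreeSyzygy (A ⧸ Ideal.span {z}) n (QuotSMulTop z L) → HasFreeSyzygy A n L := by
  induction n with
  | zero =>
    intro L _ _ _ hreg h
    have : Module.FinitePresentation A L := Module.finitePresentation_of_finite A L
    exact (Module.free_quotSMulTop_iff_free A L (IsLocalRing.maximalIdeal_le_jacobson _ hz) hreg).1 h
  | succ n ih =>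
    intro L _ _ _ hreg h K F _ _ _ _ i g hF hFfin hi hig hg
    have hKfin : Module.Finite A K := Module.Finite.of_injective i hi
    have hsurj : Function.Surjective (algebraMap A (A ⧸ Ideal.span {z})) :=
      Ideal.Quotient.mk_surjective
    have hfin : Module.Finite (A ⧸ Ideal.span {z}) (QuotSMulTop z F) :=
      Module.Finite.of_restrictScalars_finite A _ _
    refine ih K (isSMulRegular_of_injective_of_free i hi hz0)
      (h _ _ ((QuotSMulTop.map z i).extendScalarsOfSurjective hsurj)
      ((QuotSMulTop.map z g).extendScalarsOfSurjective hsurj) inferInstance hfin ?_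
      (QuotSMulTop.map_exact z hig hg) (QuotSMulTop.map_surjective z hg))
    rw [injective_iff_map_eq_zero]
    intro x hx
    obtain ⟨x, rfl⟩ := Submodule.mkQ_surjective _ x
    have hx' : i x ∈ z • (⊤ : Submodule A F) := (Submodule.Quotient.mk_eq_zero _).1 hx
    obtain ⟨f, -, hf⟩ := (Submodule.mem_smul_pointwise_iff_exists _ _ _).1 hx'
    have h1 : g f = 0 := by
      refine hreg ?_
      change z • g f = z • 0
      rw [← map_smul, hf, hig.apply_apply_eq_zero, smul_zero]
    obtain ⟨x', rfl⟩ := (hig f).1 h1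
    rw [← map_smul] at hf
    refine (Submodule.Quotient.mk_eq_zero _).2 ?_
    rw [← hi hf]
    exact Submodule.smul_mem_pointwise_smul _ _ _ trivial

/-- Finitely generated modules over a regular local ring of dimension `t` have free `t`-th
syzygies. -/
theorem IsRegularLocalRing.hasFreeSyzygy (t : ℕ) :
    ∀ (A : Type u) [CommRing A] [IsRegularLocalRing A], ringKrullDim A = t →
      ∀ (L : Type u) [AddCommGroup L] [Module A L] [Module.Finite A L], HasFreeSyzygy A t L := by
  induction t with
  | zero =>
    intro A _ _ hA L _ _ _
    have hF := IsRegularLocalRing.isField_of_ringKrullDim_eq_zero hA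
    let := hF.toField
    exact Module.Free.of_divisionRing A L
  | succ t ih =>
    intro A _ _ hA L _ _ _ K F _ _ _ _ i g hF hFfin hi hig hg
    have := IsRegularLocalRing.isDomain_of_ringKrullDim_eq _ A hA
    obtain ⟨z, hz, hz2, -⟩ := IsRegularLocalRing.exists_mem_notMem_sq hA
    have hz0 : z ≠ 0 := by rintro rfl; exact hz2 (Submodule.zero_mem _)
    obtain ⟨hreg, hdim⟩ := IsRegularLocalRing.quotient_span_singleton hA hz hz2
    have hKfin : Module.Finite A K := Module.Finite.of_injective i hi
    have hfin : Module.Finite (A ⧸ Ideal.span {z}) (QuotSMulTop z K) :=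
      Module.Finite.of_restrictScalars_finite A _ _
    -- Nothing makes `z` regular on `L`, but it is regular on the first syzygy `K`, and `A ⧸ (z)` is
    -- regular of dimension `t`. This accounts for the one extra syzygy.
    exact hasFreeSyzygy_of_quotSMulTop hz hz0 t K (isSMulRegular_of_injective_of_free i hi hz0)
      (ih _ hdim _)

/-- A quotient of free modules is free as soon as the inclusion stays injective modulo a suitable
ideal. -/
theorem free_of_exact_of_forall_mem_smul_top {A K F L : Type*} [CommRing A] [IsLocalRing A]
    [AddCommGroup K] [AddCommGroup F] [AddCommGroup L] [Module A K] [Module A F] [Module A L]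
    [Module.Finite A K] [Module.Finite A F] [Module.Free A F] [Module.Free A K]
    (i : K →ₗ[A] F) (g : F →ₗ[A] L) (hig : Function.Exact i g) (hg : Function.Surjective g)
    (J : Ideal A) {a : A} (ha : a ∉ J) (haJ : ∀ b ∈ maximalIdeal A, a * b ∈ J)
    (hJ : ∀ x, i x ∈ J • (⊤ : Submodule A F) → x ∈ J • (⊤ : Submodule A K)) :
    Module.Free A L := by
  -- If `i x` lies in `𝔪F`, then `i (a • x)` lies in `JF`, hence `a • x` in `JK`. In a basis of `K`
  -- every coordinate `c` of `x` has `a * c ∈ J`; since `a ∉ J`, no `c` is a unit.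
  have key : ∀ x, i x ∈ maximalIdeal A • (⊤ : Submodule A F) →
      x ∈ maximalIdeal A • (⊤ : Submodule A K) := by
    intro x hx
    have h1 : i (a • x) ∈ J • (⊤ : Submodule A F) := by
      rw [map_smul]
      refine Submodule.smul_induction_on hx (fun b hb f _ => ?_) (fun y z hy hz => ?_)
      · rw [smul_smul]; exact Submodule.smul_mem_smul (haJ b hb) trivial
      · rw [smul_add]; exact Submodule.add_mem _ hy hz
    have h2 := hJ _ h1
    let β := Module.Free.chooseBasis A K
    have hcoord : ∀ y ∈ J • (⊤ : Submodule A K), ∀ j, β.repr y j ∈ J := by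
      intro y hy j
      refine Submodule.smul_induction_on hy (fun b hb f _ => ?_) (fun y z hy hz => ?_)
      · rw [map_smul, Finsupp.smul_apply, smul_eq_mul]; exact J.mul_mem_right _ hb
      · rw [map_add, Finsupp.add_apply]; exact J.add_mem hy hz
    have h3 : ∀ j, β.repr x j ∈ maximalIdeal A := by
      intro j
      rw [mem_maximalIdeal]
      intro hu
      obtain ⟨w, hw⟩ := hu.exists_right_inv
      have h4 := J.mul_mem_right w (hcoord _ h2 j)
      rw [map_smul, Finsupp.smul_apply, smul_eq_mul, mul_assoc, hw, mul_one] at h4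
      exact ha h4
    rw [← β.linearCombination_repr x, Finsupp.linearCombination_apply]
    exact Submodule.sum_mem _ fun j _ => Submodule.smul_mem_smul (h3 j) trivial
  refine Module.free_of_lTensor_residueField_injective i g hg hig ?_
  rw [injective_iff_map_eq_zero]
  intro y hy
  obtain ⟨x, rfl⟩ := TensorProduct.mk_surjective A K (ResidueField A) Ideal.Quotient.mk_surjective y
  rw [TensorProduct.mk_apply, LinearMap.lTensor_tmul] at hy
  have h1 := (congrArg (TensorProduct.quotTensorEquivQuotSMul F (maximalIdeal A)) hy).trans
    (LinearEquiv.map_zero _)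
  have h2 : TensorProduct.quotTensorEquivQuotSMul F (maximalIdeal A) (1 ⊗ₜ i x) =
      Submodule.Quotient.mk (i x) := by
    have := TensorProduct.quotTensorEquivQuotSMul_mk_tmul (I := maximalIdeal A) 1 (i x)
    rwa [map_one, one_smul] at this
  have h3 := key x ((Submodule.Quotient.mk_eq_zero _).1 (h2.symm.trans h1))
  refine (TensorProduct.quotTensorEquivQuotSMul K (maximalIdeal A)).injective ?_
  have := TensorProduct.quotTensorEquivQuotSMul_mk_tmul (I := maximalIdeal A) 1 x
  rw [map_one, one_smul] at this
  exact this.trans (((Submodule.Quotient.mk_eq_zero _).2 h3).trans (LinearEquiv.map_zero _).symm)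

end RegularLocal

/-! ### Descent of freeness along a split syzygy sequence -/

section RegularLocal

open IsLocalRing

/-- A Noetherian local ring modulo an ideal that is primary to the maximal ideal has a nonzero
socle. -/
theorem exists_notMem_forall_mul_mem {A : Type*} [CommRing A] [IsLocalRing A] [IsNoetherianRing A]
    {J : Ideal A} (hJ : J.radical = maximalIdeal A) :
    ∃ a ∉ J, ∀ b ∈ maximalIdeal A, a * b ∈ J := by
  classical
  have hpow : ∃ n, maximalIdeal A ^ n ≤ J :=
    Ideal.exists_pow_le_of_le_radical_of_fg hJ.ge (IsNoetherian.noetherian _)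
  have hJne : J ≠ ⊤ := by
    rintro rfl
    rw [Ideal.radical_top] at hJ
    exact (maximalIdeal.isMaximal A).ne_top hJ.symm
  have hn := Nat.find_spec hpow
  obtain ⟨n, hn'⟩ : ∃ n, Nat.find hpow = n + 1 := by
    refine Nat.exists_eq_succ_of_ne_zero fun h => hJne ?_
    rw [h, pow_zero, Ideal.one_eq_top, top_le_iff] at hn
    exact hn
  -- Here `n + 1` is the least exponent whose power of the maximal ideal lies in `J`; any element of
  -- the `n`-th power outside `J` is a socle element.
  obtain ⟨a, ha, haJ⟩ := SetLike.not_le_iff_exists.1 (Nat.find_min hpow (m := n) (by omega))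
  refine ⟨a, haJ, fun b hb => hn ?_⟩
  rw [hn', pow_succ]
  exact Ideal.mul_mem_mul ha hb

theorem exists_mk_of_mem_map_smul_top {R : Type*} [CommRing R] (T : Submonoid R) (J : Ideal R)
    {F : Type*} [AddCommGroup F] [Module R F] (y : LocalizedModule T F)
    (hy : y ∈ J.map (algebraMap R (Localization T)) •
      (⊤ : Submodule (Localization T) (LocalizedModule T F))) :
    ∃ f ∈ J • (⊤ : Submodule R F), ∃ t : T, y = LocalizedModule.mk f t := by
  refine Submodule.smul_induction_on hy (fun b hb w _ => ?_) ?_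
  · obtain ⟨⟨j, s⟩, hjs⟩ := (IsLocalization.mem_map_algebraMap_iff T (Localization T)).1 hb
    have hb' : b = Localization.mk (j : R) s := by
      rw [Localization.mk_eq_mk', IsLocalization.eq_mk'_iff_mul_eq]; exact hjs
    induction w using LocalizedModule.induction_on with
    | h f t =>
      refine ⟨(j : R) • f, Submodule.smul_mem_smul j.2 trivial, s * t, ?_⟩
      rw [hb', LocalizedModule.mk_smul_mk]
  · rintro _ _ ⟨f, hf, s, rfl⟩ ⟨f', hf', s', rfl⟩
    refine ⟨s' • f + s • f', ?_, s * s', LocalizedModule.mk_add_mk⟩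
    exact Submodule.add_mem _ (Submodule.smul_mem _ _ hf) (Submodule.smul_mem _ _ hf')

theorem mk_mem_map_smul_top {R : Type*} [CommRing R] (T : Submonoid R) (J : Ideal R)
    {F : Type*} [AddCommGroup F] [Module R F] {f : F} (hf : f ∈ J • (⊤ : Submodule R F)) (t : T) :
    LocalizedModule.mk f t ∈ J.map (algebraMap R (Localization T)) •
      (⊤ : Submodule (Localization T) (LocalizedModule T F)) := by
  have h1 : LocalizedModule.mk f 1 ∈ J.map (algebraMap R (Localization T)) •
      (⊤ : Submodule (Localization T) (LocalizedModule T F)) := by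
    refine Submodule.smul_induction_on hf (fun b hb f _ => ?_) (fun f f' hf hf' => ?_)
    · have : LocalizedModule.mk (b • f) (1 : T) =
          algebraMap R (Localization T) b • LocalizedModule.mk f 1 := by
        rw [algebraMap_smul, LocalizedModule.smul'_mk]
      rw [this]
      exact Submodule.smul_mem_smul (Ideal.mem_map_of_mem _ hb) trivial
    · have : LocalizedModule.mk (f + f') (1 : T) =
          LocalizedModule.mk f 1 + LocalizedModule.mk f' 1 := by
        rw [LocalizedModule.mk_add_mk]; simp
      rw [this]; exact Submodule.add_mem _ hf hf'
  have h2 : LocalizedModule.mk f t = Localization.mk 1 t • LocalizedModule.mk f 1 := by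
    rw [LocalizedModule.mk_smul_mk, one_smul, mul_one]
  rw [h2]
  exact Submodule.smul_mem _ _ h1

section Descent

variable {S R : Type u} [CommRing S] [CommRing R] [Algebra S R] [IsNoetherianRing R]

omit [IsNoetherianRing R] in
/-- An `S`-split inclusion of `R`-modules stays injective modulo an ideal that is extended
from `S`. -/
theorem mem_map_smul_top_of_split {K F : Type*} [AddCommGroup K] [AddCommGroup F] [Module R K]
    [Module R F] [Module S K] [Module S F] [IsScalarTower S R K] [IsScalarTower S R F]
    (i : K →ₗ[R] F) (ρ : F →ₗ[S] K) (hρ : ∀ x, ρ (i x) = x) (q : Ideal S) (x : K)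
    (hx : i x ∈ q.map (algebraMap S R) • (⊤ : Submodule R F)) :
    x ∈ q.map (algebraMap S R) • (⊤ : Submodule R K) := by
  rw [← hρ x]
  have key : ∀ r ∈ q.map (algebraMap S R), ∀ f : F,
      ρ (r • f) ∈ q.map (algebraMap S R) • (⊤ : Submodule R K) := by
    intro r hr
    refine Submodule.span_induction (p := fun r _ => ∀ f : F,
      ρ (r • f) ∈ q.map (algebraMap S R) • (⊤ : Submodule R K)) ?_ ?_ ?_ ?_ hr
    · rintro _ ⟨s, hs, rfl⟩ f
      have h := Submodule.smul_mem_smul (Ideal.mem_map_of_mem (algebraMap S R) hs)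
        (Submodule.mem_top (R := R) (x := ρ f))
      rw [algebraMap_smul] at h
      rwa [algebraMap_smul, map_smul]
    · intro f; simp
    · intro r r' _ _ h h' f
      rw [add_smul, map_add]; exact Submodule.add_mem _ (h f) (h' f)
    · intro c r _ h f
      rw [smul_eq_mul, mul_comm, mul_smul]; exact h _
  refine Submodule.smul_induction_on hx (fun r hr f _ => key r hr f) (fun f f' h h' => ?_)
  rw [map_add]; exact Submodule.add_mem _ h h'

variable [Module.Projective S R] (p : Ideal R) [p.IsPrime]

/-- As `L` is `S`-projective, the first syzygy `K → R^m` splits over `S`. So `K` is again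
`S`-projective and, by induction, free at `p`. The splitting also keeps the inclusion injective
modulo the ideal extended from `p ∩ S`. By minimality of `p` this ideal is primary to the maximal
ideal of the local ring, so the quotient by it has a socle element; that turns injectivity modulo
the ideal into injectivity over the residue field, and `L` is free at `p`. -/
theorem free_localizedModule_of_hasFreeSyzygy
    (hp : p ∈ ((p.comap (algebraMap S R)).map (algebraMap S R)).minimalPrimes) (n : ℕ) :
    ∀ (L : Type u) [AddCommGroup L] [Module R L] [Module S L] [IsScalarTower S R L]
      [Module.Finite R L] [Module.Projective S L],
      HasFreeSyzygy (Localization.AtPrime p) n (LocalizedModule p.primeCompl L) →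
      Module.Free (Localization.AtPrime p) (LocalizedModule p.primeCompl L) := by
  induction n with
  | zero => intro L _ _ _ _ _ _ h; exact h
  | succ n ih =>
    intro L _ _ _ _ _ _ h
    obtain ⟨m, g, hg⟩ := Module.Finite.exists_fin' R L
    let K := LinearMap.ker g
    let i : K →ₗ[R] (Fin m → R) := K.subtype
    have hi : Function.Injective i := K.injective_subtype
    have hig : Function.Exact i g := LinearMap.exact_subtype_ker_map g
    obtain ⟨σ, hσ⟩ := Module.projective_lifting_property (g.restrictScalars S)
      (LinearMap.id : L →ₗ[S] L) hg
    have hσ' : ∀ x, g (σ x) = x := fun x => LinearMap.congr_fun hσ x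
    -- The projection along the `S`-linear section `σ`; it is only `S`-linear, which is enough for
    -- ideals extended from `S`.
    let ρ : (Fin m → R) →ₗ[S] K :=
      { toFun := fun f => ⟨f - σ (g f), by
          rw [LinearMap.mem_ker, map_sub, hσ', sub_self]⟩
        map_add' := fun f f' => by ext1; simp; ring
        map_smul' := fun c f => by
          ext1
          have : g (c • f) = c • g f := (g.restrictScalars S).map_smul c f
          simp [this, smul_sub] }
    have hρ : ∀ x, ρ (i x) = x := by
      intro x
      ext1
      change (x : Fin m → R) - σ (g x) = x
      rw [LinearMap.mem_ker.1 x.2, map_zero, sub_zero]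
    have hprojF : Module.Projective S (Fin m → R) :=
      Module.Projective.of_equiv' (DFinsupp.linearEquivFunOnFintype (R := S) (M := fun _ : Fin m => R))
    have hprojK : Module.Projective S K :=
      Module.Projective.of_split (i.restrictScalars S) ρ (LinearMap.ext hρ)
    have hFfree : Module.Free (Localization.AtPrime p) (LocalizedModule p.primeCompl (Fin m → R)) :=
      Module.free_of_isLocalizedModule p.primeCompl
        (LocalizedModule.mkLinearMap p.primeCompl (Fin m → R))
    have hi' := LocalizedModule.map_injective p.primeCompl i hi
    have hg' := LocalizedModule.map_surjective p.primeCompl g hg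
    have hig' : Function.Exact (LocalizedModule.map p.primeCompl i)
        (LocalizedModule.map p.primeCompl g) := LocalizedModule.map_exact p.primeCompl i g hig
    have hKfree := ih K (h _ _ _ _ hFfree inferInstance hi' hig' hg')
    have hrad := IsLocalization.AtPrime.radical_map_of_mem_minimalPrimes
      (Localization.AtPrime p) p _ hp
    rw [Localization.AtPrime.map_eq_maximalIdeal] at hrad
    have : IsNoetherianRing (Localization.AtPrime p) :=
      IsLocalization.isNoetherianRing p.primeCompl _ inferInstance
    obtain ⟨a, ha, haJ⟩ := exists_notMem_forall_mul_mem hrad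
    let i' : LocalizedModule p.primeCompl K →ₗ[Localization.AtPrime p]
      LocalizedModule p.primeCompl (Fin m → R) := LocalizedModule.map p.primeCompl i
    refine free_of_exact_of_forall_mem_smul_top (A := Localization.AtPrime p)
      (K := LocalizedModule p.primeCompl K) (F := LocalizedModule p.primeCompl (Fin m → R))
      (L := LocalizedModule p.primeCompl L) i' (LocalizedModule.map p.primeCompl g)
      hig' hg' _ ha haJ fun y hy => ?_
    obtain ⟨f, hf, t, hft⟩ := exists_mk_of_mem_map_smul_top _ _ _ hy
    induction y using LocalizedModule.induction_on with
    | h x s =>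
      have hft : LocalizedModule.map p.primeCompl i (LocalizedModule.mk x s) = _ := hft
      rw [LocalizedModule.map_mk, LocalizedModule.mk_eq] at hft
      obtain ⟨w, hw⟩ := hft
      -- Clearing denominators brings the membership down to `R`, where the splitting `ρ` is
      -- available.
      have h1 : i ((w * t : p.primeCompl) • x) ∈
          ((p.comap (algebraMap S R)).map (algebraMap S R)) • (⊤ : Submodule R (Fin m → R)) := by
        have : i ((w * t : p.primeCompl) • x) = w • s • f := by
          rw [← hw, mul_smul]; rfl
        rw [this]
        exact Submodule.smul_mem _ _ (Submodule.smul_mem _ _ hf)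
      have h2 := mem_map_smul_top_of_split i ρ hρ _ _ h1
      have h3 : LocalizedModule.mk x s = LocalizedModule.mk ((w * t) • x) (w * t * s) :=
        (LocalizedModule.mk_cancel_common_left (w * t) s x).symm
      rw [h3]
      exact mk_mem_map_smul_top _ _ h2 _

/-- Modules that are projective over a subring `S` over which `R` is finite and projective are
locally free at the regular points of `R`. -/
theorem free_localizedModule_of_isRegularLocalRing [Algebra.IsIntegral S R]
    [IsRegularLocalRing (Localization.AtPrime p)]
    (L : Type u) [AddCommGroup L] [Module R L] [Module S L] [IsScalarTower S R L]
    [Module.Finite R L] [Module.Projective S L] :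
    Module.Free (Localization.AtPrime p) (LocalizedModule p.primeCompl L) := by
  have hp : p ∈ ((p.comap (algebraMap S R)).map (algebraMap S R)).minimalPrimes := by
    -- Incomparability: in an integral extension a prime strictly below `p` contracts strictly below
    -- `p ∩ S`, so it cannot contain the extended ideal.
    refine ⟨⟨inferInstance, Ideal.map_comap_le⟩, fun q ⟨hq, hle⟩ hqp => ?_⟩
    by_contra hpq
    have hlt : q < p := lt_of_le_not_ge hqp hpq
    have := Ideal.IsIntegral.comap_lt_comap (R := S) hlt
    exact absurd (Ideal.le_comap_of_map_le hle) (not_le_of_gt this)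
  obtain ⟨t, ht⟩ : ∃ t : ℕ, ringKrullDim (Localization.AtPrime p) = t := by
    rw [← IsRegularLocalRing.spanFinrank_maximalIdeal]; exact ⟨_, rfl⟩
  exact free_localizedModule_of_hasFreeSyzygy (S := S) p hp t L
    (IsRegularLocalRing.hasFreeSyzygy t _ ht _)

end Descent

/-- If `L` is free at `p`, then a multiple of its identity by an element outside `p` factors
through a free module. -/
theorem exists_notMem_factor {R : Type u} [CommRing R] [IsNoetherianRing R] (p : Ideal R) [p.IsPrime]
    (L : Type u) [AddCommGroup L] [Module R L] [Module.Finite R L]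
    [Module.Free (Localization.AtPrime p) (LocalizedModule p.primeCompl L)] :
    ∃ s ∉ p, ∃ (m : ℕ) (j : L →ₗ[R] (Fin m → R)) (g : (Fin m → R) →ₗ[R] L), ∀ x, g (j x) = s • x := by
  obtain ⟨m, g, hg⟩ := Module.Finite.exists_fin' R L
  have hfp : Module.FinitePresentation R L := Module.finitePresentation_of_finite R L
  have hg' := LocalizedModule.map_surjective p.primeCompl g hg
  obtain ⟨σ, hσ⟩ := Module.projective_lifting_property (LocalizedModule.map p.primeCompl g)
    LinearMap.id hg'
  obtain ⟨h, s, hs⟩ := Module.FinitePresentation.exists_lift_of_isLocalizedModule p.primeCompl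
    (LocalizedModule.mkLinearMap p.primeCompl (Fin m → R))
    (σ.restrictScalars R ∘ₗ LocalizedModule.mkLinearMap p.primeCompl L)
  have key : ∀ x, ∃ w : p.primeCompl, w • g (h x) = w • s • x := by
    intro x
    have h1 := LinearMap.congr_fun hs x
    have h2 := congrArg (LocalizedModule.map p.primeCompl g) h1
    have h3 : LocalizedModule.map p.primeCompl g (σ (LocalizedModule.mk x 1)) =
        LocalizedModule.mk x 1 := LinearMap.congr_fun hσ _
    have h4 : LocalizedModule.mk (g (h x)) (1 : p.primeCompl) = LocalizedModule.mk (s • x) 1 := by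
      rw [← LocalizedModule.map_mk, ← LocalizedModule.mkLinearMap_apply]
      change LocalizedModule.map p.primeCompl g _ = _ at h2
      refine h2.trans ?_
      change LocalizedModule.map p.primeCompl g ((s : R) • σ (LocalizedModule.mk x 1)) = _
      rw [← algebraMap_smul (Localization.AtPrime p) (s : R) (σ _), map_smul, h3, algebraMap_smul,
        LocalizedModule.smul'_mk]
      rfl
    obtain ⟨w, hw⟩ := LocalizedModule.mk_eq.1 h4
    simp only [one_smul] at hw
    exact ⟨w, hw⟩
  choose w hw using key
  obtain ⟨t, ht⟩ := Module.Finite.fg_top (R := R) (M := L)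
  -- The identity `g (h x) = s • x` holds after multiplication by some `w x`; the product over a
  -- finite generating set works for all `x` at once.
  let W : p.primeCompl := ∏ x ∈ t, w x
  refine ⟨(W * s : p.primeCompl), (W * s).2, m, h, (W : R) • g, fun x => ?_⟩
  have : ((W : R) • g) ∘ₗ h = ((W * s : p.primeCompl) : R) • LinearMap.id := by
    refine LinearMap.ext_on ht fun x hx => ?_
    obtain ⟨c, hc⟩ := Finset.dvd_prod_of_mem w hx
    have h1 : (W : R) = c * w x := by
      rw [← Submonoid.coe_mul, mul_comm, ← hc]
    have h2 := hw x
    change (W : R) • g (h x) = ((W * s : p.primeCompl) : R) • x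
    rw [Submonoid.coe_mul, h1, mul_smul, mul_smul, mul_smul]
    exact congrArg (fun z => (c : R) • z) h2
  exact LinearMap.congr_fun this x

end RegularLocal

/-! ### Homogeneous prime avoidance -/

section Avoidance

variable {k : Type v} [Field k] {R : Type u} [CommRing R] [Algebra k R]
  (𝒜 : ℕ → Submodule k R) [GradedAlgebra 𝒜]

theorem exists_pos_degree_notMem (P : Ideal R) (hP : ¬ grMaxIdeal 𝒜 ≤ P) :
    ∃ i, 0 < i ∧ ∃ a ∈ 𝒜 i, a ∉ P := by
  by_contra! h
  refine hP ?_
  rw [grMaxIdeal_eq_span, Ideal.span_le]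
  rintro a ⟨i, hi, ha⟩
  exact h i hi a ha

theorem exists_pos_degree_mul {a b : R} (ha : ∃ i, 0 < i ∧ a ∈ 𝒜 i) (hb : ∃ i, 0 < i ∧ b ∈ 𝒜 i) :
    ∃ i, 0 < i ∧ a * b ∈ 𝒜 i := by
  obtain ⟨i, hi, ha⟩ := ha
  obtain ⟨j, hj, hb⟩ := hb
  exact ⟨i + j, by omega, SetLike.mul_mem_graded ha hb⟩

/-- Homogeneous prime avoidance for the irrelevant ideal. -/
theorem exists_pos_degree_forall_notMem (s : Finset (Ideal R)) (hs : ∀ P ∈ s, P.IsPrime)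
    (hm : ∀ P ∈ s, ¬ grMaxIdeal 𝒜 ≤ P) : ∃ i, 0 < i ∧ ∃ a ∈ 𝒜 i, ∀ P ∈ s, a ∉ P := by
  classical
  induction s using Finset.strongInduction with
  | H s ih =>
    rcases s.eq_empty_or_nonempty with rfl | ⟨P₀, hP₀⟩
    · exact ⟨1, one_pos, 0, Submodule.zero_mem _, by simp⟩
    have ih' := fun P hP => ih (s.erase P) (Finset.erase_ssubset hP)
      (fun Q hQ => hs Q (Finset.mem_of_mem_erase hQ)) (fun Q hQ => hm Q (Finset.mem_of_mem_erase hQ))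
    -- The primes need not be homogeneous, so they are compared only through their homogeneous
    -- elements of positive degree. If those of `P` lie in `P'`, avoiding `P'` already avoids `P`.
    by_cases hcomp : ∃ P ∈ s, ∃ P' ∈ s, P ≠ P' ∧ ∀ i, 0 < i → ∀ a ∈ 𝒜 i, a ∈ P → a ∈ P'
    · obtain ⟨P, hP, P', hP', hne, hle⟩ := hcomp
      obtain ⟨i, hi, a, ha, hav⟩ := ih' P hP
      refine ⟨i, hi, a, ha, fun Q hQ => ?_⟩
      by_cases hQP : Q = P
      · subst hQP
        exact fun h => hav P' (Finset.mem_erase.2 ⟨hne.symm, hP'⟩) (hle i hi a ha h)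
      · exact hav Q (Finset.mem_erase.2 ⟨hQP, hQ⟩)
    · push Not at hcomp
      obtain ⟨i, hi, u, hu, huv⟩ := ih' P₀ hP₀
      by_cases huP : u ∈ P₀
      · have hprime := hs P₀ hP₀
        have key : ∀ t ⊆ s.erase P₀, ∃ w, (∃ i, 0 < i ∧ w ∈ 𝒜 i) ∧ w ∉ P₀ ∧ ∀ P ∈ t, w ∈ P := by
          intro t ht
          induction t using Finset.induction_on with
          | empty =>
            obtain ⟨i, hi, a, ha, haP⟩ := exists_pos_degree_notMem 𝒜 P₀ (hm P₀ hP₀)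
            exact ⟨a, ⟨i, hi, ha⟩, haP, by simp⟩
          | insert P t _ iht =>
            obtain ⟨w, hw, hwP, hwt⟩ := iht ((Finset.subset_insert _ _).trans ht)
            have hPs := Finset.mem_erase.1 (ht (Finset.mem_insert_self P t))
            obtain ⟨i, hi, c, hc, hcP, hcP₀⟩ := hcomp P hPs.2 P₀ hP₀ hPs.1
            refine ⟨w * c, exists_pos_degree_mul 𝒜 hw ⟨i, hi, hc⟩,
              fun h => (hprime.mem_or_mem h).elim hwP hcP₀, fun Q hQ => ?_⟩
            rcases Finset.mem_insert.1 hQ with rfl | hQ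
            · exact Ideal.mul_mem_left _ _ hcP
            · exact Ideal.mul_mem_right _ _ (hwt Q hQ)
        obtain ⟨w, ⟨j, hj, hw⟩, hwP, hwt⟩ := key _ subset_rfl
        -- Here `u` lies in `P₀` and avoids the other primes, whereas `w` avoids `P₀` and lies in
        -- the others. The powers equalize the degrees so that the sum is homogeneous.
        have h1 : u ^ j ∈ 𝒜 (j * i) := by
          have := SetLike.pow_mem_graded j hu; rwa [smul_eq_mul] at this
        have h2 : w ^ i ∈ 𝒜 (j * i) := by
          have := SetLike.pow_mem_graded i hw; rwa [smul_eq_mul, mul_comm] at this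
        refine ⟨j * i, Nat.mul_pos hj hi, u ^ j + w ^ i, Submodule.add_mem _ h1 h2, fun P hP h => ?_⟩
        by_cases hPP : P = P₀
        · subst hPP
          have h3 := (Ideal.add_mem_iff_right P (P.pow_mem_of_mem huP j hj)).1 h
          exact hwP (hprime.mem_of_pow_mem _ h3)
        · have hPe := Finset.mem_erase.2 ⟨hPP, hP⟩
          have h3 := (Ideal.add_mem_iff_left P (P.pow_mem_of_mem (hwt P hPe) i hi)).1 h
          exact huv P hPe ((hs P hP).mem_of_pow_mem _ h3)
      · refine ⟨i, hi, u, hu, fun P hP => ?_⟩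
        by_cases hPP : P = P₀
        · subst hPP; exact huP
        · exact huv P (Finset.mem_erase.2 ⟨hPP, hP⟩)

end Avoidance

/-! ### Depth: Ext vanishing and homogeneous regular sequences -/

section Depth

open CategoryTheory CategoryTheory.Abelian RingTheory.Sequence
open scoped Pointwise

variable {k : Type v} [Field k] {R : Type u} [CommRing R] [Algebra k R]
  (𝒜 : ℕ → Submodule k R) [GradedAlgebra 𝒜]

/-- The vanishing of `Ext^i(R/𝔪, M)` for `i < n`. -/
def ExtVanish (n : ℕ) (M : Type u) [AddCommGroup M] [Module R M] : Prop :=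
  ∀ i < n, Subsingleton (Ext (ModuleCat.of R (R ⧸ grMaxIdeal 𝒜)) (ModuleCat.of R M) i)

variable {𝒜}

theorem subsingleton_ext_of_exact {M₁ M₂ M₃ : Type u} [AddCommGroup M₁] [AddCommGroup M₂]
    [AddCommGroup M₃] [Module R M₁] [Module R M₂] [Module R M₃] (f : M₁ →ₗ[R] M₂) (g : M₂ →ₗ[R] M₃)
    (hf : Function.Injective f) (hfg : Function.Exact f g) (hg : Function.Surjective g)
    (T : ModuleCat.{u} R) (i : ℕ) (h₁ : Subsingleton (Ext T (ModuleCat.of R M₁) i))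
    (h₃ : Subsingleton (Ext T (ModuleCat.of R M₃) i)) :
    Subsingleton (Ext T (ModuleCat.of R M₂) i) := by
  have hS : (ModuleCat.shortComplexOfCompEqZero f g hfg.linearMap_comp_eq_zero).ShortExact :=
    ModuleCat.shortComplex_shortExact _ hfg hf hg
  refine subsingleton_of_forall_eq 0 fun x => ?_
  obtain ⟨y, rfl⟩ := Ext.covariant_sequence_exact₂ T hS x (Subsingleton.elim (α := Ext T (ModuleCat.of R M₃) i) _ _)
  rw [Subsingleton.elim (α := Ext T (ModuleCat.of R M₁) i) y 0, Ext.zero_comp]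

theorem subsingleton_ext_of_retract {M N : Type u} [AddCommGroup M] [AddCommGroup N]
    [Module R M] [Module R N] (f : M →ₗ[R] N) (g : N →ₗ[R] M) (hgf : ∀ x, g (f x) = x)
    (T : ModuleCat.{u} R) (i : ℕ) (h : Subsingleton (Ext T (ModuleCat.of R N) i)) :
    Subsingleton (Ext T (ModuleCat.of R M) i) := by
  refine subsingleton_of_forall_eq 0 fun x => ?_
  have hid : ModuleCat.ofHom f ≫ ModuleCat.ofHom g = 𝟙 (ModuleCat.of R M) := by
    ext x; exact hgf x
  have h1 : (x.comp (Ext.mk₀ (ModuleCat.ofHom f)) (add_zero i)).comp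
      (Ext.mk₀ (ModuleCat.ofHom g)) (add_zero i) = x := by
    rw [Ext.comp_assoc_of_third_deg_zero, Ext.mk₀_comp_mk₀, hid, Ext.comp_mk₀_id]
  rw [← h1, Subsingleton.elim (x.comp (Ext.mk₀ (ModuleCat.ofHom f)) (add_zero i)) 0, Ext.zero_comp]

theorem isGradedCM_of_exact {M₁ M₂ M₃ : Type u} [AddCommGroup M₁] [AddCommGroup M₂]
    [AddCommGroup M₃] [Module R M₁] [Module R M₂] [Module R M₃] (f : M₁ →ₗ[R] M₂) (g : M₂ →ₗ[R] M₃)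
    (hf : Function.Injective f) (hfg : Function.Exact f g) (hg : Function.Surjective g)
    (h₁ : IsGradedCM 𝒜 M₁) (h₃ : IsGradedCM 𝒜 M₃) : IsGradedCM 𝒜 M₂ :=
  fun i hi => subsingleton_ext_of_exact f g hf hfg hg _ i (h₁ i hi) (h₃ i hi)

theorem isGradedCM_of_retract {M N : Type u} [AddCommGroup M] [AddCommGroup N]
    [Module R M] [Module R N] (f : M →ₗ[R] N) (g : N →ₗ[R] M) (hgf : ∀ x, g (f x) = x)
    (h : IsGradedCM 𝒜 N) : IsGradedCM 𝒜 M :=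
  fun i hi => subsingleton_ext_of_retract f g hgf _ i (h i hi)

theorem isGradedCM_prod {M N : Type u} [AddCommGroup M] [AddCommGroup N]
    [Module R M] [Module R N] (hM : IsGradedCM 𝒜 M) (hN : IsGradedCM 𝒜 N) :
    IsGradedCM 𝒜 (M × N) :=
  isGradedCM_of_exact (LinearMap.inl R M N) (LinearMap.snd R M N) LinearMap.inl_injective
    Function.Exact.inl_snd LinearMap.snd_surjective hM hN

theorem isWeaklyRegular_of_retract {A : Type*} [CommRing A] (rs : List A) :
    ∀ {M N : Type u} [AddCommGroup M] [AddCommGroup N] [Module A M] [Module A N]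
      (f : M →ₗ[A] N) (g : N →ₗ[A] M), (∀ x, g (f x) = x) → IsWeaklyRegular N rs →
      IsWeaklyRegular M rs := by
  induction rs with
  | nil => intros; exact IsWeaklyRegular.nil A _
  | cons r rs ih =>
    intro M N _ _ _ _ f g hgf h
    rw [isWeaklyRegular_cons_iff] at h ⊢
    refine ⟨fun x y hxy => ?_, ih (QuotSMulTop.map r f) (QuotSMulTop.map r g) (fun x => ?_) h.2⟩
    · have h1 : r • f x = r • f y := by
        rw [← map_smul, ← map_smul]; exact congrArg f hxy
      rw [← hgf x, ← hgf y, h.1 h1]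
    · obtain ⟨x, rfl⟩ := Submodule.mkQ_surjective _ x
      exact congrArg (Submodule.mkQ _) (hgf x)

section Noetherian

variable [IsNoetherianRing R]

/-- A graded module without `𝔪`-torsion has a homogeneous regular element of positive degree. -/
theorem exists_homogeneous_isSMulRegular (M : GrMod 𝒜) (hM : ExtVanish 𝒜 1 M.carrier) :
    ∃ i, 0 < i ∧ ∃ a ∈ 𝒜 i, IsSMulRegular M.carrier a := by
  classical
  have h0 : Subsingleton ((R ⧸ grMaxIdeal 𝒜) →ₗ[R] M.carrier) := by
    have h1 := hM 0 one_pos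
    have h2 : Subsingleton (ModuleCat.of R (R ⧸ grMaxIdeal 𝒜) ⟶ ModuleCat.of R M.carrier) :=
      Ext.addEquiv₀.subsingleton_congr.mp h1
    exact ⟨fun f g => congrArg ModuleCat.Hom.hom (Subsingleton.elim (ModuleCat.ofHom f) (ModuleCat.ofHom g))⟩
  have hfin := associatedPrimes.finite R M.carrier
  -- An associated prime containing `𝔪`, the annihilator of some `x`, would give a nonzero map `R ⧸
  -- 𝔪 → M`, contradicting `Ext^0 = 0`. So avoidance applies to the associated primes.
  obtain ⟨i, hi, a, ha, hav⟩ := exists_pos_degree_forall_notMem 𝒜 hfin.toFinset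
    (fun P hP => (hfin.mem_toFinset.1 hP).isPrime) (fun P hP hle => by
      obtain ⟨hprime, x, hx⟩ := (isAssociatedPrime_iff).1 ((AssociatedPrimes.mem_iff).1 (hfin.mem_toFinset.1 hP))
      have hker : grMaxIdeal 𝒜 ≤ LinearMap.ker (LinearMap.toSpanSingleton R M.carrier x) := by
        intro a ha
        have := hle ha
        rw [hx] at this
        simpa using this
      have h1 : (grMaxIdeal 𝒜).liftQ (LinearMap.toSpanSingleton R M.carrier x) hker = 0 :=
        Subsingleton.elim _ _
      have h2 : x = 0 := by
        have : LinearMap.toSpanSingleton R M.carrier x 1 = 0 :=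
          LinearMap.congr_fun h1 (Submodule.Quotient.mk 1)
        simpa using this
      refine hprime.ne_top ?_
      rw [hx, h2]; simp)
  refine ⟨i, hi, a, ha, ?_⟩
  rw [isSMulRegular_iff_right_eq_zero_of_smul]
  intro x hx
  by_contra hne
  have h1 : a ∈ ⋃ p ∈ associatedPrimes R M.carrier, (p : Set R) := by
    rw [biUnion_associatedPrimes_eq_zero_divisors]; exact ⟨x, hne, hx⟩
  simp only [Set.mem_iUnion, exists_prop] at h1
  obtain ⟨P, hP, haP⟩ := h1
  exact hav P (hfin.mem_toFinset.2 hP) haP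

omit [IsNoetherianRing R] in
-- The long exact Ext sequence of multiplication by `a`: `Ext^i` of the quotient sits between
-- `Ext^i` and `Ext^(i+1)` of `M`.
theorem extVanish_quotSMulTop {n : ℕ} {M : Type u} [AddCommGroup M] [Module R M]
    (hM : ExtVanish 𝒜 (n + 1) M) {a : R} (ha : IsSMulRegular M a) :
    ExtVanish 𝒜 n (QuotSMulTop a M) := by
  intro i hi
  have zero1 := AddCommGrpCat.isZero_of_iff_subsingleton.mpr (hM i (by omega))
  have zero2 := AddCommGrpCat.isZero_of_iff_subsingleton.mpr (hM (i + 1) (by omega))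
  have ha' : IsSMulRegular (ModuleCat.of R M) a := ha
  exact AddCommGrpCat.subsingleton_of_isZero <| ShortComplex.Exact.isZero_of_both_zeros
    ((Ext.covariant_sequence_exact₃' _ ha'.smulShortComplex_shortExact) i (i + 1) rfl)
    (zero1.eq_zero_of_src _) (zero2.eq_zero_of_tgt _)

omit [IsNoetherianRing R] [GradedAlgebra 𝒜] in
theorem GrMod.homog_smul_top (M : GrMod 𝒜) {i : ℕ} {a : R} (ha : a ∈ 𝒜 i) :
    M.Homog (a • (⊤ : Submodule R M.carrier)) := by
  intro n x hx
  obtain ⟨y, -, rfl⟩ := (Submodule.mem_smul_pointwise_iff_exists _ _ _).1 hx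
  rw [M.proj_smul ha]
  exact Submodule.smul_mem_pointwise_smul _ _ _ trivial

/-- Depth at least `n` gives a homogeneous weakly regular sequence of length `n`. -/
theorem exists_homogeneous_isWeaklyRegular (n : ℕ) :
    ∀ M : GrMod 𝒜, ExtVanish 𝒜 n M.carrier → ∃ rs : List R, rs.length = n ∧
      (∀ r ∈ rs, ∃ i, 0 < i ∧ r ∈ 𝒜 i) ∧ IsWeaklyRegular M.carrier rs := by
  induction n with
  | zero => intro M _; exact ⟨[], rfl, by simp, IsWeaklyRegular.nil R _⟩
  | succ n ih =>
    intro M hM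
    obtain ⟨i, hi, a, ha, hreg⟩ := exists_homogeneous_isSMulRegular M (fun j hj => hM j (by omega))
    obtain ⟨rs, hlen, hrs, hw⟩ := ih (M.ofQuot _ (M.homog_smul_top ha)) (extVanish_quotSMulTop hM hreg)
    refine ⟨a :: rs, by simp [hlen], ?_, (isWeaklyRegular_cons_iff _ _ _).2 ⟨hreg, hw⟩⟩
    intro r hr
    rcases List.mem_cons.1 hr with rfl | hr
    · exact ⟨i, hi, ha⟩
    · exact hrs r hr

/-- A weakly regular sequence in `𝔪` of length `n` bounds the depth from below. -/
theorem extVanish_of_isWeaklyRegular (M : GrMod 𝒜) (rs : List R) (hrs : ∀ r ∈ rs, r ∈ grMaxIdeal 𝒜)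
    (h : IsWeaklyRegular M.carrier rs) : ExtVanish 𝒜 rs.length M.carrier := by
  by_cases hM : Subsingleton M.carrier
  · intro i _
    refine subsingleton_of_forall_eq 0 fun x => ?_
    have h0 : 𝟙 (ModuleCat.of R M.carrier) = 0 := by ext x; exact Subsingleton.elim _ _
    rw [← Ext.comp_mk₀_id x, h0, Ext.mk₀_zero, Ext.comp_zero]
  · have hlt : grMaxIdeal 𝒜 • (⊤ : Submodule R M.carrier) < ⊤ := by
      rw [lt_top_iff_ne_top]
      intro htop
      refine hM ?_
      have hbot : (⊥ : Submodule R M.carrier) = ⊤ :=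
        M.eq_top_of_sup_smul_eq_top ⊥ (fun n x hx => by
          rw [(Submodule.mem_bot R).1 hx, map_zero]; exact Submodule.zero_mem _) (by rw [htop]; simp)
      rw [← Submodule.subsingleton_iff R]
      exact subsingleton_of_bot_eq_top hbot
    have hreg : IsRegular M.carrier rs := by
      refine ⟨h, fun htop => hlt.ne ?_⟩
      refine eq_top_iff.2 (htop.le.trans ?_)
      exact Submodule.smul_mono_left (Ideal.span_le.2 fun r hr => hrs r hr)
    exact ModuleCat.subsingleton_ext_of_exists_isRegular (grMaxIdeal 𝒜)
      (ModuleCat.of R (R ⧸ grMaxIdeal 𝒜))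
      (by rw [Module.support_eq_zeroLocus, Ideal.annihilator_quotient])
      (ModuleCat.of R M.carrier) hlt rs hrs hreg

end Noetherian

end Depth

/-! ### Dimension and homogeneous systems of parameters -/

section

open RingTheory.Sequence
open scoped Pointwise

section Dimension

/-- Each nonzerodivisor lowers the dimension by at least one. -/
theorem ringKrullDim_quotient_ofList_add_length_le (n : ℕ) : ∀ {A : Type u} [CommRing A] (rs : List A),
    rs.length = n → IsWeaklyRegular A rs → ringKrullDim (A ⧸ Ideal.ofList rs) + n ≤ ringKrullDim A := by
  induction n with
  | zero =>
    intro A _ rs hlen _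
    rw [Nat.cast_zero, add_zero]
    exact ringKrullDim_quotient_le _
  | succ n ih =>
    intro A _ rs hlen h
    obtain ⟨r, rs, rfl⟩ := List.exists_cons_of_length_eq_add_one hlen
    rw [isWeaklyRegular_cons_iff] at h
    have e : QuotSMulTop r A ≃ₗ[A] A ⧸ Ideal.span {r} :=
      Submodule.quotEquivOfEq _ _ (by
        rw [← Submodule.ideal_span_singleton_smul, smul_eq_mul, Ideal.mul_top])
    have h1 : IsWeaklyRegular (A ⧸ Ideal.span {r}) (rs.map (algebraMap A (A ⧸ Ideal.span {r}))) :=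
      (isWeaklyRegular_map_algebraMap_iff _ _ _).2 ((e.isWeaklyRegular_congr rs).1 h.2)
    have h2 := ih _ (by simpa using hlen) h1
    have e2 : A ⧸ Ideal.ofList (r :: rs) ≃+*
        (A ⧸ Ideal.span {r}) ⧸ Ideal.ofList (rs.map (algebraMap A (A ⧸ Ideal.span {r}))) :=
      (Ideal.quotEquivOfEq (Ideal.ofList_cons r rs)).trans
        ((DoubleQuot.quotQuotEquivQuotSup _ _).symm.trans
          (Ideal.quotEquivOfEq (Ideal.map_ofList (Ideal.Quotient.mk (Ideal.span {r})) rs)))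
    rw [ringKrullDim_eq_of_ringEquiv e2]
    have h3 := ringKrullDim_quotient_succ_le_of_nonZeroDivisor (r := r)
      (mem_nonZeroDivisors_iff_right.2 fun x hx =>
        h.1.right_eq_zero_of_smul (by rwa [smul_eq_mul, mul_comm]))
    refine le_trans ?_ h3
    rw [Nat.cast_succ, ← add_assoc]
    gcongr
end Dimension

section GradedDimension

variable {k : Type v} [Field k] {R : Type u} [CommRing R] [Algebra k R]
  (𝒜 : ℕ → Submodule k R) [GradedAlgebra 𝒜]

/-- The ring as a graded module over itself. -/
noncomputable def GrMod.self : GrMod 𝒜 where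
  carrier := R
  deg n := if 0 ≤ n then 𝒜 n.toNat else ⊥
  isInternal := by
    classical
    refine InternalGrading.isInternal_of_proj
      (fun n x => if 0 ≤ n then (DirectSum.decompose 𝒜 x n.toNat : R) else 0) ?_ ?_ ?_ ?_
    · intro n x y
      split_ifs
      · rw [DirectSum.decompose_add]; rfl
      · simp
    · intro n x hx
      split_ifs at hx ⊢
      · exact DirectSum.decompose_of_mem_same 𝒜 hx
      · exact ((Submodule.mem_bot k).1 hx).symm
    · intro m n hmn x hx
      split_ifs at hx ⊢
      · exact DirectSum.decompose_of_mem_ne 𝒜 hx (by omega)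
      · rw [(Submodule.mem_bot k).1 hx, DirectSum.decompose_zero]; rfl
      all_goals rfl
    · intro x
      rw [← DirectSum.sum_support_decompose 𝒜 x]
      refine Submodule.sum_mem _ fun i _ => Submodule.mem_iSup_of_mem (i : ℤ) ?_
      simp
  smul_mem i n a m ha hm := by
    split_ifs at hm ⊢
    · have := SetLike.mul_mem_graded ha hm
      rwa [show i + n.toNat = (n + i).toNat by omega] at this
    · rw [(Submodule.mem_bot k).1 hm, smul_zero]; exact Submodule.zero_mem _
    · omega
    · rw [(Submodule.mem_bot k).1 hm, smul_zero]; exact Submodule.zero_mem _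

variable [IsNoetherianRing R]

variable {𝒜}

/-- A Noetherian ring may have infinite dimension, so finiteness needs an argument. For each `n ≤
dim R` the Ext condition gives a regular sequence of length `n` in `𝔪`. It stays regular in the
localization at `𝔪`, a Noetherian local ring of finite dimension, which bounds `n`. -/
theorem exists_ringKrullDim_eq (hR0 : Function.Bijective (algebraMap k (𝒜 0)))
    (hR : IsGradedCM 𝒜 R) : ∃ d : ℕ, ringKrullDim R = d := by
  have hmax := grMaxIdeal_isMaximal 𝒜 hR0
  have : Nontrivial R := ⟨⟨0, 1, fun h => grMaxIdeal_ne_top 𝒜 hR0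
    ((Ideal.eq_top_iff_one _).2 (h ▸ Ideal.zero_mem _))⟩⟩
  have key : ∀ n : ℕ, ((n : ℕ∞) : WithBot ℕ∞) ≤ ringKrullDim R →
      ((n : ℕ∞) : WithBot ℕ∞) ≤ ringKrullDim (Localization.AtPrime (grMaxIdeal 𝒜)) := by
    intro n hn
    obtain ⟨rs, hlen, hrs, hw⟩ := exists_homogeneous_isWeaklyRegular n (GrMod.self 𝒜)
      (fun i hi => hR i (lt_of_lt_of_le (by exact_mod_cast hi) hn))
    have hreg : IsRegular (Localization.AtPrime (grMaxIdeal 𝒜))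
        (rs.map (algebraMap R (Localization.AtPrime (grMaxIdeal 𝒜)))) :=
      IsWeaklyRegular.isRegular_of_isLocalization_of_mem _ (grMaxIdeal 𝒜) hw (fun r hr => by
        obtain ⟨i, hi, h⟩ := hrs r hr
        exact mem_grMaxIdeal_of_mem 𝒜 hi h)
    have h1 := ringKrullDim_quotient_ofList_add_length_le _ _ rfl hreg.toIsWeaklyRegular
    have : Nontrivial (Localization.AtPrime (grMaxIdeal 𝒜) ⧸
      Ideal.ofList (rs.map (algebraMap R (Localization.AtPrime (grMaxIdeal 𝒜))))) := by
      refine Ideal.Quotient.nontrivial_iff.2 fun h => hreg.top_ne_smul ?_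
      rw [h]; simp
    refine le_trans ?_ h1
    rw [List.length_map, hlen]
    exact le_add_of_nonneg_left ringKrullDim_nonneg_of_nontrivial
  have hfin : ringKrullDim (Localization.AtPrime (grMaxIdeal 𝒜)) < ⊤ := ringKrullDim_lt_top
  have hbot : ∀ (A : Type u) [CommRing A] [Nontrivial A], ∃ e : ℕ∞, ringKrullDim A = e := fun A _ _ =>
    ⟨_, (WithBot.coe_unbot _ (fun h => by
      have := ringKrullDim_nonneg_of_nontrivial (R := A)
      simp [h] at this)).symm⟩
  obtain ⟨e, he⟩ := hbot R
  rw [he]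
  induction e using ENat.recTopCoe with
  | coe n => exact ⟨n, rfl⟩
  | top =>
    exfalso
    obtain ⟨e', he'⟩ := hbot (Localization.AtPrime (grMaxIdeal 𝒜))
    rw [he'] at key hfin
    have h2 : e' < ⊤ := WithBot.coe_lt_coe.1 hfin
    obtain ⟨m, rfl⟩ := ENat.ne_top_iff_exists.1 h2.ne
    have h3 := key (m + 1) (by rw [he]; exact_mod_cast le_top)
    have : m + 1 ≤ m := by exact_mod_cast h3
    omega

omit [IsNoetherianRing R] in
theorem isGradedCM_iff_extVanish {d : ℕ} (hd : ringKrullDim R = d) (M : Type u) [AddCommGroup M]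
    [Module R M] : IsGradedCM 𝒜 M ↔ ExtVanish 𝒜 d M := by
  refine forall_congr' fun i => ?_
  rw [hd]
  have : ((i : ℕ∞) : WithBot ℕ∞) < ((d : ℕ) : WithBot ℕ∞) ↔ i < d := by exact_mod_cast Iff.rfl
  rw [this]

omit [IsNoetherianRing R] in
-- The quotient by a regular sequence of length `dim R` has dimension at most zero, so every prime
-- above the sequence is maximal. The homogeneous core of such a prime is prime and still contains
-- the sequence; being maximal and homogeneous, it equals `𝔪`.
theorem grMaxIdeal_le_radical_ofList (hR0 : Function.Bijective (algebraMap k (𝒜 0)))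
    {d : ℕ} (hd : ringKrullDim R = d) (rs : List R) (hlen : rs.length = d)
    (hrs : ∀ r ∈ rs, ∃ i, 0 < i ∧ r ∈ 𝒜 i) (hw : IsWeaklyRegular R rs) :
    grMaxIdeal 𝒜 ≤ (Ideal.ofList rs).radical := by
  have hhom : (Ideal.ofList rs).IsHomogeneous 𝒜 :=
    Ideal.homogeneous_span 𝒜 _ fun r hr => by
      obtain ⟨i, -, h⟩ := hrs r hr
      exact ⟨i, h⟩
  have hdim : ringKrullDim (R ⧸ Ideal.ofList rs) ≤ 0 := by
    have h1 := ringKrullDim_quotient_ofList_add_length_le d rs hlen hw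
    rw [hd] at h1
    by_contra h2
    push Not at h2
    obtain ⟨e, he⟩ : ∃ e : ℕ∞, ringKrullDim (R ⧸ Ideal.ofList rs) = e :=
      ⟨_, (WithBot.coe_unbot _ (fun h => by simp [h] at h2)).symm⟩
    rw [he] at h1 h2
    have h3 : 0 < e := by exact_mod_cast h2
    have h4 : e + d ≤ d := by exact_mod_cast h1
    have h5 : (1 : ℕ∞) + d ≤ d := le_trans (by gcongr; exact Order.one_le_iff_pos.2 h3) h4
    have : 1 + d ≤ d := by exact_mod_cast h5
    omega
  have hzero : Ring.KrullDimLE 0 (R ⧸ Ideal.ofList rs) := by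
    rw [Ring.KrullDimLE, Order.krullDimLE_iff]; exact_mod_cast hdim
  rw [Ideal.radical_eq_sInf]
  refine le_sInf fun p ⟨hp, hprime⟩ => ?_
  have hcore := Ideal.IsPrime.homogeneousCore (𝒜 := 𝒜) hprime
  have hle : Ideal.ofList rs ≤ (p.homogeneousCore 𝒜).toIdeal := by
    have := Ideal.homogeneousCore_mono 𝒜 hp
    rw [← hhom.toIdeal_homogeneousCore_eq_self]
    exact this
  have h1 : (p.homogeneousCore 𝒜).toIdeal.IsMaximal := by
    have h2 : ((p.homogeneousCore 𝒜).toIdeal.map (Ideal.Quotient.mk (Ideal.ofList rs))).IsPrime :=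
      Ideal.map_isPrime_of_surjective Ideal.Quotient.mk_surjective (by rwa [Ideal.mk_ker])
    have h3 := h2.isMaximal'
    have h4 := Ideal.comap_isMaximal_of_surjective (Ideal.Quotient.mk (Ideal.ofList rs))
      Ideal.Quotient.mk_surjective (K := (p.homogeneousCore 𝒜).toIdeal.map (Ideal.Quotient.mk (Ideal.ofList rs)))
    rwa [Ideal.comap_map_of_surjective _ Ideal.Quotient.mk_surjective, ← RingHom.ker_eq_comap_bot,
      Ideal.mk_ker, sup_eq_left.2 hle] at h4
  have h5 := le_grMaxIdeal_of_isHomogeneous 𝒜 hR0 (p.homogeneousCore 𝒜).isHomogeneous h1.ne_top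
  rw [← h1.eq_of_le (grMaxIdeal_ne_top 𝒜 hR0) h5]
  exact Ideal.toIdeal_homogeneousCore_le 𝒜 p

theorem finite_quotient_ofList_smul (hR0 : Function.Bijective (algebraMap k (𝒜 0))) (rs : List R)
    (h : grMaxIdeal 𝒜 ≤ (Ideal.ofList rs).radical) (M : Type*) [AddCommGroup M] [Module k M]
    [Module R M] [IsScalarTower k R M] [Module.Finite R M] :
    Module.Finite k (M ⧸ Ideal.ofList rs • (⊤ : Submodule R M)) := by
  obtain ⟨K, hK⟩ := Ideal.exists_pow_le_of_le_radical_of_fg h (IsNoetherian.noetherian _)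
  refine finite_of_pow_smul_eq_bot 𝒜 hR0 K _ ?_
  rw [← map_mkQ_smul_top, eq_bot_iff, Submodule.map_le_iff_le_comap, Submodule.comap_bot,
    Submodule.ker_mkQ]
  exact Submodule.smul_mono_left hK

omit [IsNoetherianRing R] in
/-- Weak regularity on a direct sum passes to the summands. -/
theorem isWeaklyRegular_prod_iff {M N : Type u} [AddCommGroup M] [AddCommGroup N] [Module R M]
    [Module R N] (rs : List R) (h : IsWeaklyRegular (M × N) rs) :
    IsWeaklyRegular M rs ∧ IsWeaklyRegular N rs :=
  ⟨isWeaklyRegular_of_retract rs (LinearMap.inl R M N) (LinearMap.fst R M N) (fun _ => rfl) h,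
    isWeaklyRegular_of_retract rs (LinearMap.inr R M N) (LinearMap.snd R M N) (fun _ => rfl) h⟩

end GradedDimension

end

/-! ### Homogeneous bases over the subalgebra generated by parameters -/

section

open RingTheory.Sequence
open scoped Pointwise

section Powers

variable {k : Type*} {V Q β : Type*} [Field k] [AddCommGroup V] [Module k V]
  [AddCommGroup Q] [Module k Q] (ρ : V →ₗ[k] V) (q : V →ₗ[k] Q)

/-- In a relation among the `ρ ^ n (w b)`, passing to `Q` kills the terms with `n > 0`, so the
constant coefficients vanish. Injectivity then cancels one `ρ`, and the argument repeats. -/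
theorem linearIndependent_pow_of_exact (hρ : Function.Injective ρ) (hq : Function.Exact ρ q)
    (w : β → V) (hw : LinearIndependent k (q ∘ w)) :
    LinearIndependent k (fun p : ℕ × β => (ρ ^ p.1) (w p.2)) := by
  have key : ∀ (N : ℕ) (f : ℕ → β →₀ k),
      ∑ n ∈ Finset.range N, (ρ ^ n) (Finsupp.linearCombination k w (f n)) = 0 →
      ∀ n < N, f n = 0 := by
    intro N
    induction N with
    | zero => intro f _ n hn; omega
    | succ N ih =>
      intro f hf
      rw [Finset.sum_range_succ'] at hf
      have h1 : ∑ n ∈ Finset.range N, (ρ ^ (n + 1)) (Finsupp.linearCombination k w (f (n + 1))) =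
          ρ (∑ n ∈ Finset.range N, (ρ ^ n) (Finsupp.linearCombination k w (f (n + 1)))) := by
        rw [map_sum]
        exact Finset.sum_congr rfl fun n _ => by rw [pow_succ']; rfl
      rw [h1, pow_zero] at hf
      have h0 : f 0 = 0 := by
        have h2 := congrArg q hf
        rw [map_add, hq.apply_apply_eq_zero, zero_add, map_zero] at h2
        refine (linearIndependent_iff.1 hw) (f 0) ?_
        rw [← h2]
        exact (Finsupp.apply_linearCombination k q w (f 0)).symm
      rw [h0] at hf
      have h3 := ih (fun n => f (n + 1)) (hρ (by rw [map_zero, ← hf]; simp))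
      rintro (_ | n) hn
      · exact h0
      · exact h3 n (by omega)
  rw [linearIndependent_iff]
  intro l hl
  have h1 : ∑ n ∈ Finset.range (l.curry.support.sup id + 1),
      (ρ ^ n) (Finsupp.linearCombination k w (l.curry n)) = 0 := by
    rw [← hl, Finsupp.linearCombination_apply, ← Finsupp.sum_curry_index l
      (fun n b c => c • (ρ ^ n) (w b))]
    rw [Finsupp.sum]
    refine (Finset.sum_subset ?_ ?_).symm.trans (Finset.sum_congr rfl fun n _ => ?_)
    · intro n hn
      exact Finset.mem_range.2 (Nat.lt_succ_of_le (Finset.le_sup (f := id) hn))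
    · intro n _ hn
      rw [Finsupp.notMem_support_iff.1 hn, map_zero, map_zero]
    · rw [Finsupp.linearCombination_apply, Finsupp.sum, Finsupp.sum, map_sum]
      simp
  have h2 : l.curry = 0 := by
    ext n : 1
    by_cases hn : n ∈ l.curry.support
    · exact key _ _ h1 n (Nat.lt_succ_of_le (Finset.le_sup (f := id) hn))
    · exact Finsupp.notMem_support_iff.1 hn
  ext ⟨n, b⟩
  rw [← Finsupp.curry_apply, h2]; rfl

end Powers

section AdjoinSpan

variable {k : Type*} {R κ : Type*} [Field k] [CommRing R] [Algebra k R]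

theorem span_range_pow_mul_eq_adjoin (r : R) (s : Set R) (g : κ → R)
    (hg : Submodule.span k (Set.range g) = (Algebra.adjoin k s).toSubmodule) :
    Submodule.span k (Set.range fun p : ℕ × κ => r ^ p.1 * g p.2) =
      (Algebra.adjoin k (insert r s)).toSubmodule := by
  rw [Set.insert_eq, Algebra.adjoin_union_coe_submodule, ← hg, Algebra.adjoin_eq_span,
    Submodule.span_mul_span]
  congr 1
  ext x
  simp only [Set.mem_range, Prod.exists, Set.mem_mul, SetLike.mem_coe,
    Submonoid.mem_closure_singleton]
  constructor
  · rintro ⟨n, a, rfl⟩; exact ⟨r ^ n, ⟨n, rfl⟩, g a, ⟨a, rfl⟩, rfl⟩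
  · rintro ⟨_, ⟨n, rfl⟩, _, ⟨a, rfl⟩, rfl⟩; exact ⟨n, a, rfl⟩

end AdjoinSpan

section GradedBasis

variable {k : Type v} [Field k] {R : Type u} [CommRing R] [Algebra k R]
  {𝒜 : ℕ → Submodule k R}

namespace GrMod

theorem proj_mem_span_of_homogeneous (M : GrMod 𝒜) {s : Set M.carrier} (hs : ∀ x ∈ s, ∃ n, x ∈ M.deg n)
    {x : M.carrier} (hx : x ∈ Submodule.span k s) (n : ℤ) : M.proj n x ∈ Submodule.span k s := by
  induction hx using Submodule.span_induction with
  | mem x hx =>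
    obtain ⟨m, hm⟩ := hs x hx
    by_cases h : m = n
    · subst h; rw [M.proj_of_mem hm]; exact Submodule.subset_span hx
    · rw [M.proj_of_mem_ne h hm]; exact Submodule.zero_mem _
  | zero => rw [map_zero]; exact Submodule.zero_mem _
  | add x y _ _ hx hy => rw [map_add]; exact Submodule.add_mem _ hx hy
  | smul c x _ hx => rw [map_smul]; exact Submodule.smul_mem _ _ hx

variable [GradedAlgebra 𝒜]

/-- A homogeneous `x` is a combination of the `w b` plus `r` times an element of degree smaller by
`e > 0`. The recursion ends because degrees are bounded below. -/
theorem span_pow_smul_eq_top (M : GrMod 𝒜) {e : ℕ} (he : 0 < e) {r : R} (hr : r ∈ 𝒜 e)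
    {β : Type*} (w : β → M.carrier) (hw : ∀ b, ∃ n, w b ∈ M.deg n)
    (hspan : Submodule.span k (Set.range w) ⊔
      (r • (⊤ : Submodule R M.carrier)).restrictScalars k = ⊤) :
    Submodule.span k (Set.range fun p : ℕ × β => r ^ p.1 • w p.2) = ⊤ := by
  set V := Submodule.span k (Set.range fun p : ℕ × β => r ^ p.1 • w p.2)
  have h0 : Submodule.span k (Set.range w) ≤ V := Submodule.span_mono (by
    rintro _ ⟨b, rfl⟩; exact ⟨(0, b), by simp⟩)
  have hrV : ∀ x ∈ V, r • x ∈ V := by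
    intro x hx
    have : V ≤ V.comap ((LinearMap.lsmul R M.carrier r).restrictScalars k) := by
      rw [Submodule.span_le]
      rintro _ ⟨⟨n, b⟩, rfl⟩
      refine Submodule.subset_span ⟨(n + 1, b), ?_⟩
      simp only [pow_succ', mul_smul]; rfl
    exact this hx
  obtain ⟨b, hb⟩ := M.exists_ge_eq_top
  have key : ∀ m : ℕ, ∀ n : ℤ, n < b + m → ∀ x ∈ M.deg n, x ∈ V := by
    intro m
    induction m with
    | zero =>
      intro n hn x hx
      rw [deg_eq_bot_of_ge_eq_top hb (by simpa using hn), Submodule.mem_bot] at hx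
      rw [hx]; exact Submodule.zero_mem _
    | succ m ih =>
      intro n hn x hx
      have hx' : x ∈ Submodule.span k (Set.range w) ⊔
        (r • (⊤ : Submodule R M.carrier)).restrictScalars k := by rw [hspan]; trivial
      obtain ⟨s, hs, y, hy, hxy⟩ := Submodule.mem_sup.1 hx'
      obtain ⟨z, -, rfl⟩ := (Submodule.mem_smul_pointwise_iff_exists _ _ _).1 hy
      rw [← M.proj_of_mem hx, ← hxy, map_add, M.proj_smul hr]
      refine V.add_mem (h0 (M.proj_mem_span_of_homogeneous ?_ hs n)) (hrV _ ?_)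
      · rintro _ ⟨b, rfl⟩; exact hw b
      · exact ih (n - e) (by push_cast at hn; omega) _ (M.proj_mem _ _)
  rw [eq_top_iff]
  intro x _
  refine M.homogeneous_induction (P := (· ∈ V)) (fun n x hx => ?_) V.zero_mem
    (fun x y => V.add_mem) x
  exact key (n - b + 1).toNat n (by omega) x hx

variable [IsNoetherianRing R] (hR0 : Function.Bijective (algebraMap k (𝒜 0)))

include hR0 in
-- Multiplication by `r` identifies the component of degree `n - e` with the kernel of the quotient
-- map in degree `n`. So the Hilbert function of `M` determines that of `M / rM`.
theorem hilb_ofQuot_add (M : GrMod 𝒜) {e : ℕ} {r : R} (hr : r ∈ 𝒜 e)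
    (hreg : IsSMulRegular M.carrier r) (n : ℤ) :
    (M.ofQuot _ (M.homog_smul_top hr)).hilb n + M.hilb (n - e) = M.hilb n := by
  have := M.finite_deg hR0
  let F : M.deg n →ₗ[k] M.carrier ⧸ (r • (⊤ : Submodule R M.carrier)) :=
    ((r • (⊤ : Submodule R M.carrier)).mkQ.restrictScalars k).domRestrict (M.deg n)
  have hF : LinearMap.range F = (M.ofQuot _ (M.homog_smul_top hr)).deg n := by
    rw [LinearMap.range_domRestrict]; rfl
  let G : M.deg (n - e) →ₗ[k] LinearMap.ker F :=
    LinearMap.codRestrict _ (LinearMap.codRestrict (M.deg n)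
      (((LinearMap.lsmul R M.carrier r).restrictScalars k).domRestrict (M.deg (n - e)))
      (fun x => by
        have := M.smul_mem e (n - e) r x hr x.2
        rwa [sub_add_cancel] at this))
      (fun x => by
        rw [LinearMap.mem_ker]
        refine (Submodule.Quotient.mk_eq_zero _).2 ?_
        exact Submodule.smul_mem_pointwise_smul _ _ _ trivial)
  have hG : Function.Bijective G := by
    constructor
    · intro x y hxy
      have h1 : r • (x : M.carrier) = r • (y : M.carrier) :=
        congrArg (fun z : LinearMap.ker F => ((z : M.deg n) : M.carrier)) hxy
      exact Subtype.ext (hreg h1)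
    · rintro ⟨⟨x, hx⟩, hx'⟩
      have h1 : x ∈ r • (⊤ : Submodule R M.carrier) := (Submodule.Quotient.mk_eq_zero _).1 hx'
      obtain ⟨y, -, hy⟩ := (Submodule.mem_smul_pointwise_iff_exists _ _ _).1 h1
      refine ⟨⟨M.proj (n - e) y, M.proj_mem _ _⟩, Subtype.ext (Subtype.ext ?_)⟩
      change r • M.proj (n - e) y = x
      rw [← M.proj_smul hr, hy, M.proj_of_mem hx]
  have h1 := LinearMap.finrank_range_add_finrank_ker F
  rw [hF, ← (LinearEquiv.ofBijective G hG).finrank_eq] at h1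
  exact h1

omit [IsNoetherianRing R] in
-- Any homogeneous lift of the basis of `L / rL` works: regularity of `r` gives independence of the
-- multiples by powers of `r`, and boundedness of degrees gives generation.
theorem exists_lift_basis {e : ℕ} (he : 0 < e) {r : R} (hr : r ∈ 𝒜 e) {κ ι : Type*} (g : κ → R)
    (hg : ∀ a, ∃ e, g a ∈ 𝒜 e) (d : ι → ℤ) (L : GrMod 𝒜) (hreg : IsSMulRegular L.carrier r)
    (v : ι → (L.ofQuot _ (L.homog_smul_top hr)).carrier)
    (hv : ∀ i, v i ∈ (L.ofQuot _ (L.homog_smul_top hr)).deg (d i))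
    (hvl : LinearIndependent k (fun p : κ × ι => g p.1 • v p.2))
    (hvs : Submodule.span k (Set.range fun p : κ × ι => g p.1 • v p.2) = ⊤) :
    ∃ v' : ι → L.carrier, (∀ i, v' i ∈ L.deg (d i)) ∧
      LinearIndependent k (fun p : (ℕ × κ) × ι => (r ^ p.1.1 * g p.1.2) • v' p.2) ∧
      Submodule.span k (Set.range fun p : (ℕ × κ) × ι => (r ^ p.1.1 * g p.1.2) • v' p.2) = ⊤ := by
  choose v' hv' hvv' using hv
  let q : L.carrier →ₗ[k] L.carrier ⧸ (r • (⊤ : Submodule R L.carrier)) :=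
    (r • (⊤ : Submodule R L.carrier)).mkQ.restrictScalars k
  let w : κ × ι → L.carrier := fun p => g p.1 • v' p.2
  have hker : LinearMap.ker q = (r • (⊤ : Submodule R L.carrier)).restrictScalars k := by
    ext x
    exact Submodule.Quotient.mk_eq_zero _
  have hcomp : q ∘ w = (fun p : κ × ι => g p.1 • v p.2) := by
    funext p
    exact ((r • (⊤ : Submodule R L.carrier)).mkQ.map_smul (g p.1) (v' p.2)).trans
      (congrArg (g p.1 • ·) (hvv' p.2))
  have hfun : (fun p : (ℕ × κ) × ι => (r ^ p.1.1 * g p.1.2) • v' p.2) =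
      (fun p : ℕ × (κ × ι) => r ^ p.1 • w p.2) ∘ (Equiv.prodAssoc ℕ κ ι) := by
    funext p
    exact mul_smul _ _ _
  refine ⟨v', hv', ?_, ?_⟩
  · rw [hfun]
    refine LinearIndependent.comp ?_ _ (Equiv.injective _)
    have hexact : Function.Exact ((LinearMap.lsmul R L.carrier r).restrictScalars k) q := by
      intro x
      change x ∈ LinearMap.ker q ↔ _
      rw [hker, Submodule.restrictScalars_mem, Submodule.mem_smul_pointwise_iff_exists]
      simp
    have h1 := linearIndependent_pow_of_exact
      ((LinearMap.lsmul R L.carrier r).restrictScalars k) q hreg hexact w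
      (by rw [hcomp]; exact hvl)
    have hpow : ∀ (n : ℕ) (x : L.carrier),
        ((LinearMap.lsmul R L.carrier r).restrictScalars k ^ n) x = r ^ n • x := by
      intro n x
      induction n with
      | zero => simp
      | succ n ih => rw [pow_succ', Module.End.mul_apply, ih, pow_succ', mul_smul]; rfl
    simpa only [hpow] using h1
  · rw [hfun, (Equiv.surjective _).range_comp]
    refine L.span_pow_smul_eq_top he hr w ?_ ?_
    · rintro ⟨a, i⟩
      obtain ⟨m, hm⟩ := hg a
      exact ⟨_, L.smul_mem m _ _ _ hm (hv' i)⟩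
    · rw [← hker, ← Submodule.comap_map_eq, Submodule.map_span, ← Set.range_comp, hcomp]
      exact (congrArg (Submodule.comap q) hvs).trans (Submodule.comap_top q)

include hR0 in
/-- Two graded modules with the same Hilbert function on which a homogeneous sequence is weakly
regular have `k`-bases of the same shape over the subalgebra generated by the sequence. -/
theorem exists_basis_pair (rs : List R) (hrs : ∀ r ∈ rs, ∃ i, 0 < i ∧ r ∈ 𝒜 i) :
    ∃ (κ : Type) (g : κ → R), (∀ a, ∃ e, g a ∈ 𝒜 e) ∧
      Submodule.span k (Set.range g) = (Algebra.adjoin k {x | x ∈ rs}).toSubmodule ∧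
      ∀ M N : GrMod 𝒜, M.hilb = N.hilb → IsWeaklyRegular M.carrier rs → IsWeaklyRegular N.carrier rs →
        Module.Finite k (M.carrier ⧸ Ideal.ofList rs • (⊤ : Submodule R M.carrier)) →
        Module.Finite k (N.carrier ⧸ Ideal.ofList rs • (⊤ : Submodule R N.carrier)) →
        ∃ (ι : Type) (_ : Finite ι) (d : ι → ℤ) (v : ι → M.carrier) (w : ι → N.carrier),
          (∀ i, v i ∈ M.deg (d i)) ∧ (∀ i, w i ∈ N.deg (d i)) ∧
          LinearIndependent k (fun p : κ × ι => g p.1 • v p.2) ∧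
          LinearIndependent k (fun p : κ × ι => g p.1 • w p.2) ∧
          Submodule.span k (Set.range fun p : κ × ι => g p.1 • v p.2) = ⊤ ∧
          Submodule.span k (Set.range fun p : κ × ι => g p.1 • w p.2) = ⊤ := by
  -- The family `g` stands for the monomials in the sequence and is fixed before `M` and `N`, so
  -- both modules use the same one. It only has to span: independence is asked of the products,
  -- since the sequence is not assumed regular on `R`.
  classical
  induction rs with
  | nil =>
    refine ⟨Unit, fun _ => 1, fun _ => ⟨0, SetLike.GradedOne.one_mem⟩, ?_, ?_⟩
    · simp [Algebra.toSubmodule_bot, Submodule.one_eq_span]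
    intro M N hh _ _ hfM hfN
    have e : ∀ L : GrMod 𝒜, (L.carrier ⧸ Ideal.ofList ([] : List R) • (⊤ : Submodule R L.carrier)) ≃ₗ[k]
        L.carrier := fun L =>
      (Submodule.quotEquivOfEqBot _ (by simp)).restrictScalars k
    have := Module.Finite.equiv (e M)
    have := M.finite_deg hR0
    have := N.finite_deg hR0
    -- With no parameters left both modules are finite-dimensional, and equality of Hilbert
    -- functions lets homogeneous bases be indexed by the same set with the same degrees.
    let b : ∀ n, Module.Basis (Fin (M.hilb n)) k (M.deg n) := fun n => Module.finBasis k (M.deg n)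
    let c : ∀ n, Module.Basis (Fin (M.hilb n)) k (N.deg n) := fun n =>
      (Module.finBasis k (N.deg n)).reindex (finCongr (congrFun hh n).symm)
    let B := M.isInternal.collectedBasis b
    let C := N.isInternal.collectedBasis c
    have hinj : Function.Injective (Prod.snd : Unit × (Σ n, Fin (M.hilb n)) → _) := by
      rintro ⟨⟨⟩, x⟩ ⟨⟨⟩, y⟩ h; exact Prod.ext rfl h
    have hsurj : Function.Surjective (Prod.snd : Unit × (Σ n, Fin (M.hilb n)) → _) := fun x => ⟨((), x), rfl⟩
    refine ⟨Σ n, Fin (M.hilb n), Module.Finite.finite_basis B, fun x => x.1, B, C,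
      M.isInternal.collectedBasis_mem b, N.isInternal.collectedBasis_mem c, ?_, ?_, ?_, ?_⟩
    · simp only [one_smul]; exact B.linearIndependent.comp _ hinj
    · simp only [one_smul]; exact C.linearIndependent.comp _ hinj
    · simp only [one_smul]
      rw [show (fun p : Unit × (Σ n, Fin (M.hilb n)) => B p.2) = B ∘ Prod.snd from rfl,
        hsurj.range_comp, B.span_eq]
    · simp only [one_smul]
      rw [show (fun p : Unit × (Σ n, Fin (M.hilb n)) => C p.2) = C ∘ Prod.snd from rfl,
        hsurj.range_comp, C.span_eq]
  | cons r rs ih =>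
    obtain ⟨κ, g, hg, hspan, H⟩ := ih (fun x hx => hrs x (List.mem_cons_of_mem r hx))
    obtain ⟨e, he, hr⟩ := hrs r (List.mem_cons_self)
    refine ⟨ℕ × κ, fun p => r ^ p.1 * g p.2, ?_, ?_, ?_⟩
    · rintro ⟨n, a⟩
      obtain ⟨m, hm⟩ := hg a
      exact ⟨_, SetLike.mul_mem_graded (SetLike.pow_mem_graded n hr) hm⟩
    · rw [span_range_pow_mul_eq_adjoin r _ g hspan]
      congr 2
      ext x; simp
    intro M N hh hM hN hfM hfN
    rw [isWeaklyRegular_cons_iff] at hM hN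
    have hquot : (M.ofQuot _ (M.homog_smul_top hr)).hilb = (N.ofQuot _ (N.homog_smul_top hr)).hilb := by
      funext n
      have h1 := M.hilb_ofQuot_add hR0 hr hM.1 n
      have h2 := N.hilb_ofQuot_add hR0 hr hN.1 n
      rw [hh] at h1
      omega
    have hfin : ∀ L : GrMod 𝒜,
        Module.Finite k (L.carrier ⧸ Ideal.ofList (r :: rs) • (⊤ : Submodule R L.carrier)) →
        Module.Finite k ((L.ofQuot _ (L.homog_smul_top hr)).carrier ⧸
          Ideal.ofList rs • (⊤ : Submodule R (L.ofQuot _ (L.homog_smul_top hr)).carrier)) :=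
      fun L hL => Module.Finite.equiv
        ((Submodule.quotOfListConsSMulTopEquivQuotSMulTopInner L.carrier r rs).restrictScalars k)
    obtain ⟨ι, hι, d, v, w, hv, hw, hvl, hwl, hvs, hws⟩ :=
      H _ _ hquot hM.2 hN.2 (hfin M hfM) (hfin N hfN)
    obtain ⟨v', hv', hvl', hvs'⟩ := exists_lift_basis he hr g hg d M hM.1 v hv hvl hvs
    obtain ⟨w', hw', hwl', hws'⟩ := exists_lift_basis he hr g hg d N hN.1 w hw hwl hws
    exact ⟨ι, hι, d, v', w', hv', hw', hvl', hwl', hvs', hws'⟩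

end GrMod

end GradedBasis

end

/-! ### Scalar restriction and the coinduced module -/

section

open RingTheory.Sequence InternalGrading
open scoped Pointwise TensorProduct

section ScalarRestriction

variable {k : Type v} [Field k] {R : Type u} [CommRing R] [Algebra k R] (S : Subalgebra k R)
  {M : Type*} [AddCommGroup M] [Module k M] [Module R M] [IsScalarTower k R M]
  {κ ι : Type*} (g : κ → R) (hg : Submodule.span k (Set.range g) = S.toSubmodule) (v : ι → M)

include hg

theorem span_subalgebra_eq_top
    (h : Submodule.span k (Set.range fun p : κ × ι => g p.1 • v p.2) = ⊤) :
    Submodule.span S (Set.range v) = ⊤ := by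
  have hgS : ∀ a, g a ∈ S := fun a =>
    hg.le (Submodule.subset_span ⟨a, rfl⟩)
  rw [eq_top_iff]
  intro x _
  have hx : x ∈ Submodule.span k (Set.range fun p : κ × ι => g p.1 • v p.2) := by rw [h]; trivial
  induction hx using Submodule.span_induction with
  | mem x hx =>
    obtain ⟨⟨a, i⟩, rfl⟩ := hx
    exact Submodule.smul_mem _ (⟨g a, hgS a⟩ : S) (Submodule.subset_span ⟨i, rfl⟩)
  | zero => exact Submodule.zero_mem _
  | add x y _ _ hx hy => exact Submodule.add_mem _ (hx trivial) (hy trivial)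
  | smul c x _ hx =>
    have := Submodule.smul_mem _ (algebraMap k S c) (hx trivial)
    rwa [algebraMap_smul] at this

/-- Expanding the coefficients in the spanning family `g` turns an `S`-relation into a `k`-relation
among the products. -/
theorem linearIndependent_subalgebra
    (h : LinearIndependent k (fun p : κ × ι => g p.1 • v p.2)) : LinearIndependent S v := by
  classical
  rw [linearIndependent_iff']
  intro s c hc i hi
  have hF : ∀ i, ∃ F : κ →₀ k, Finsupp.linearCombination k g F = c i := fun i =>
    (Finsupp.mem_span_range_iff_exists_finsupp).1 (hg.ge (c i).2)
  choose F hF using hF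
  let T : κ × ι →₀ k := ∑ i ∈ s, (F i).mapDomain (fun a => (a, i))
  have hT : Finsupp.linearCombination k (fun p : κ × ι => g p.1 • v p.2) T = 0 := by
    rw [map_sum, ← hc]
    refine Finset.sum_congr rfl fun i _ => ?_
    rw [Finsupp.linearCombination_mapDomain]
    change _ = (c i : R) • v i
    rw [← hF i, Finsupp.linearCombination_apply, Finsupp.linearCombination_apply, Finsupp.sum,
      Finsupp.sum, Finset.sum_smul]
    refine Finset.sum_congr rfl fun a _ => ?_
    simp
  have hT0 := linearIndependent_iff.1 h T hT
  have hFi : F i = 0 := by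
    ext a
    have h1 := DFunLike.congr_fun hT0 (a, i)
    simp only [T, Finsupp.finsetSum_apply] at h1
    rw [Finset.sum_eq_single i] at h1
    · rwa [Finsupp.mapDomain_apply (fun x y hxy => (Prod.mk.inj hxy).1)] at h1
    · intro j _ hj
      refine Finsupp.mapDomain_of_notMem_range _ _ ?_
      rintro ⟨b, hb⟩
      exact hj (Prod.mk.inj hb).2
    · exact fun h => absurd hi h
  have : (c i : R) = 0 := by rw [← hF i, hFi, map_zero]
  exact Subtype.ext this

end ScalarRestriction

section Coinduced

variable {k : Type v} [Field k] {R : Type u} [CommRing R] [Algebra k R]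

/-- The coinduced module `Hom_S(R, X)`, on which `R` acts through the first argument. -/
def Coind (S : Subalgebra k R) (X : Type u) [AddCommGroup X] [Module R X] : Type u := R →ₗ[S] X

namespace Coind

variable (S : Subalgebra k R) (X : Type u) [AddCommGroup X] [Module k X] [Module R X]
  [IsScalarTower k R X]

instance : AddCommGroup (Coind S X) := inferInstanceAs (AddCommGroup (R →ₗ[S] X))

instance : Module k (Coind S X) := inferInstanceAs (Module k (R →ₗ[S] X))

variable {S X} in
/-- The value of an element of the coinduced module. -/
def app (f : Coind S X) : R →ₗ[S] X := f

variable {S X} in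
omit [Module k X] [IsScalarTower k R X] in
theorem ext_app {f g : Coind S X} (h : ∀ r, f.app r = g.app r) : f = g := LinearMap.ext h

instance : Module R (Coind S X) where
  smul r f := (f.app ∘ₗ LinearMap.mulLeft S r : R →ₗ[S] X)
  one_smul f := ext_app fun x => congrArg f.app (one_mul x)
  mul_smul r s f := ext_app fun x => congrArg f.app (by
    change r * s * x = s * (r * x); ring)
  smul_zero r := rfl
  smul_add r f g := rfl
  add_smul r s f := ext_app fun x => (congrArg f.app (add_mul r s x)).trans (map_add f.app _ _)
  zero_smul f := ext_app fun x => (congrArg f.app (zero_mul x)).trans (map_zero f.app)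

variable {S X}

omit [Module k X] [IsScalarTower k R X] in
theorem smul_app (r : R) (f : Coind S X) (x : R) : (r • f).app x = f.app (r * x) := rfl

omit [Module k X] [IsScalarTower k R X] in
theorem add_app (f g : Coind S X) (x : R) : (f + g).app x = f.app x + g.app x := rfl

theorem ksmul_app (c : k) (f : Coind S X) (x : R) : (c • f).app x = c • f.app x := rfl

theorem app_ksmul (f : Coind S X) (c : k) (x : R) : f.app (c • x) = c • f.app x := by
  rw [← algebraMap_smul S c x, map_smul, algebraMap_smul]

instance : IsScalarTower k R (Coind S X) where
  smul_assoc c r f := ext_app fun x => by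
    rw [smul_app, ksmul_app, smul_app, smul_mul_assoc, app_ksmul]

variable (S X)

/-- The evaluation of an element of the coinduced module on a basis. -/
noncomputable def evalBasis {ι : Type*} (b : Module.Basis ι S R) : Coind S X ≃ₗ[S] (ι → X) :=
  LinearEquiv.ofBijective
    { toFun := fun f i => f.app (b i)
      map_add' := fun _ _ => rfl
      map_smul' := fun s f => by
        funext i
        exact (congrArg f.app (Subalgebra.smul_def s (b i)).symm).trans (f.app.map_smul s (b i)) }
    ⟨fun f g h => b.ext fun i => congrFun h i, fun y => ⟨b.constr S y, by
      funext i; exact b.constr_basis S y i⟩⟩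

omit [Module k X] [IsScalarTower k R X] in
theorem finite {ι : Type*} [Finite ι] (b : Module.Basis ι S R) [Module.Finite S X] :
    Module.Finite R (Coind S X) := by
  have := Module.Finite.equiv (evalBasis S X b).symm
  exact Module.Finite.of_restrictScalars_finite S R _

/-- The embedding of a module into its coinduced module. -/
def embed : X →ₗ[R] Coind S X where
  toFun x := (LinearMap.toSpanSingleton R X x).restrictScalars S
  map_add' x y := ext_app fun r => smul_add r x y
  map_smul' a x := ext_app fun r => by
    change r • a • x = (a * r) • x
    rw [smul_smul, mul_comm]

omit [Module k X] [IsScalarTower k R X] in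
theorem embed_app (x : X) (r : R) : (embed S X x).app r = r • x := rfl

omit [Module k X] [IsScalarTower k R X] in
theorem embed_injective : Function.Injective (embed S X) := fun x y h => by
  have := congrArg (fun f => f.app 1) h
  simpa [embed_app] using this

/-- The `S`-linear section of the projection onto the cokernel of the embedding. -/
noncomputable def cokernelSection : (Coind S X ⧸ LinearMap.range (embed S X)) →ₗ[S] Coind S X where
  -- Evaluation at `1` is an `S`-linear retraction of the embedding; subtracting it from the
  -- identity kills the image and descends to the cokernel.
  toFun := QuotientAddGroup.lift (LinearMap.range (embed S X)).toAddSubgroup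
    { toFun := fun f => f - embed S X (f.app 1)
      map_zero' := by
        change (0 : Coind S X) - embed S X 0 = 0
        rw [map_zero, sub_zero]
      map_add' := fun f g => by
        rw [add_app, map_add]; abel }
    (by
      rintro _ ⟨x, rfl⟩
      change embed S X x - embed S X ((embed S X x).app 1) = 0
      rw [embed_app, one_smul, sub_self])
  map_add' := map_add _
  map_smul' s f := by
    obtain ⟨f, rfl⟩ := Submodule.mkQ_surjective _ f
    change (s : R) • f - embed S X (((s : R) • f).app 1) = (s : R) • (f - embed S X (f.app 1))
    have h : ((s : R) • f).app 1 = (s : R) • f.app 1 := f.app.map_smul s 1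
    rw [h, map_smul, smul_sub]

omit [Module k X] [IsScalarTower k R X] in
theorem mkQ_cokernelSection (y : Coind S X ⧸ LinearMap.range (embed S X)) :
    (LinearMap.range (embed S X)).mkQ (cokernelSection S X y) = y := by
  obtain ⟨f, rfl⟩ := Submodule.mkQ_surjective _ y
  change (LinearMap.range (embed S X)).mkQ (f - embed S X (f.app 1)) = _
  rw [map_sub, sub_eq_self]
  exact (Submodule.Quotient.mk_eq_zero _).2 ⟨_, rfl⟩

theorem isWeaklyRegular_pi {A : Type u} [CommRing A] {ι : Type u} [Finite ι] {N : Type u}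
    [AddCommGroup N] [Module A N] (rs : List A) (h : IsWeaklyRegular N rs) :
    IsWeaklyRegular (ι → N) rs := by
  classical
  have := Fintype.ofFinite ι
  exact ((TensorProduct.piScalarRight A A N ι).isWeaklyRegular_congr rs).1
    (h.isWeaklyRegular_rTensor (M₂ := ι → A))

omit [Module k X] [IsScalarTower k R X] in
-- The sequence lies in `S`, so regularity may be tested over `S`. There the cokernel is a direct
-- summand of the coinduced module, which is a finite power of `X`.
theorem isWeaklyRegular_quotient {ι : Type} [Finite ι] (b : Module.Basis ι S R) (rs : List R)
    (hrs : ∀ r ∈ rs, r ∈ S) (h : IsWeaklyRegular X rs) :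
    IsWeaklyRegular (Coind S X ⧸ LinearMap.range (embed S X)) rs := by
  obtain ⟨rs, rfl⟩ : ∃ rs' : List S, rs'.map (algebraMap S R) = rs :=
    ⟨rs.attach.map fun r : {x // x ∈ rs} => ⟨r.1, hrs r.1 r.2⟩, by
      rw [List.map_map]
      exact (List.map_congr_left fun _ _ => rfl).trans rs.attach_map_subtype_val⟩
  rw [isWeaklyRegular_map_algebraMap_iff] at h ⊢
  have h1 : IsWeaklyRegular (Coind S X) rs :=
    ((evalBasis S X (b.reindex Equiv.ulift.symm)).isWeaklyRegular_congr rs).2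
      (isWeaklyRegular_pi (ι := ULift.{u} ι) rs h)
  exact isWeaklyRegular_of_retract rs (cokernelSection S X)
    ((LinearMap.range (embed S X)).mkQ.restrictScalars S) (mkQ_cokernelSection S X) h1

end Coind

end Coinduced

end

/-! ### The graded coinduced module and Noether normalization -/

section

open RingTheory.Sequence InternalGrading
open scoped Pointwise

section HomogeneousSubalgebra

variable {k : Type v} [Field k] {R : Type u} [CommRing R] [Algebra k R]
  {𝒜 : ℕ → Submodule k R} [GradedAlgebra 𝒜]

theorem GrMod.smul_mem_self {X : GrMod 𝒜} {m n : ℤ} {r : R} (hr : r ∈ (GrMod.self 𝒜).deg m)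
    {x : X.carrier} (hx : x ∈ X.deg n) : r • x ∈ X.deg (m + n) := by
  change r ∈ (if 0 ≤ m then 𝒜 m.toNat else ⊥ : Submodule k R) at hr
  split_ifs at hr with hm
  · have := X.smul_mem _ _ _ _ hr hx
    rwa [Int.toNat_of_nonneg hm, add_comm] at this
  · rw [(Submodule.mem_bot k).1 hr, zero_smul]; exact Submodule.zero_mem _

theorem GrMod.mem_self {i : ℕ} {r : R} (hr : r ∈ 𝒜 i) : r ∈ (GrMod.self 𝒜).deg i := by
  change r ∈ (if 0 ≤ (i : ℤ) then 𝒜 (i : ℤ).toNat else ⊥ : Submodule k R)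
  simpa using hr

variable (𝒜) in
/-- A subalgebra that is spanned by homogeneous elements. -/
def IsHomogeneousSubalgebra (S : Subalgebra k R) : Prop :=
  Submodule.span k {a : R | a ∈ S ∧ ∃ e, a ∈ 𝒜 e} = S.toSubmodule

omit [GradedAlgebra 𝒜] in
theorem span_isHomogeneousScalar_eq_top {S : Subalgebra k R} (hS : IsHomogeneousSubalgebra 𝒜 S)
    (M N : GrMod 𝒜) :
    Submodule.span k {a : S | ∃ e, IsHomogeneousScalar M.deg N.deg S a e} = ⊤ := by
  rw [eq_top_iff]
  rintro ⟨a, ha⟩ -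
  have h1 : a ∈ Submodule.span k {a : R | a ∈ S ∧ ∃ e, a ∈ 𝒜 e} := hS.ge ha
  induction h1 using Submodule.span_induction with
  | mem a h =>
    obtain ⟨haS, e, he⟩ := h
    exact Submodule.subset_span ⟨e, fun n x hx => M.smul_mem e n a x he hx,
      fun n x hx => N.smul_mem e n a x he hx⟩
  | zero => exact Submodule.zero_mem _
  | add x y hx hy ihx ihy =>
    exact Submodule.add_mem _ (ihx (hS.le hx)) (ihy (hS.le hy))
  | smul c x hx ih => exact Submodule.smul_mem _ c (ih (hS.le hx))

theorem span_isHomogeneousScalar_self_eq_top (M N : GrMod 𝒜) :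
    Submodule.span k {a : R | ∃ e, IsHomogeneousScalar M.deg N.deg R a e} = ⊤ := by
  classical
  rw [eq_top_iff]
  intro a _
  rw [← DirectSum.sum_support_decompose 𝒜 a]
  refine Submodule.sum_mem _ fun i _ => Submodule.subset_span ⟨i, ?_, ?_⟩
  · exact fun n x hx => M.smul_mem i n _ x (SetLike.coe_mem _) hx
  · exact fun n x hx => N.smul_mem i n _ x (SetLike.coe_mem _) hx

omit [GradedAlgebra 𝒜] in
theorem isHomogeneousSubalgebra_of_span {κ : Type*} {g : κ → R} (hg : ∀ a, ∃ e, g a ∈ 𝒜 e)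
    {S : Subalgebra k R} (hspan : Submodule.span k (Set.range g) = S.toSubmodule) :
    IsHomogeneousSubalgebra 𝒜 S := by
  refine le_antisymm (Submodule.span_le.2 fun a ha => ha.1) ?_
  rw [← hspan]
  refine Submodule.span_mono ?_
  rintro _ ⟨a, rfl⟩
  exact ⟨hspan.le (Submodule.subset_span ⟨a, rfl⟩), hg a⟩

namespace GrMod

/-- The coinduced module with its grading. -/
noncomputable def coind {S : Subalgebra k R} (hS : IsHomogeneousSubalgebra 𝒜 S)
    (hSR : Module.Finite S R) (X : GrMod 𝒜) (hfin : Module.Finite R (Coind S X.carrier)) :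
    GrMod 𝒜 where
  carrier := Coind S X.carrier
  addCommGroup := inferInstance
  moduleBase := inferInstance
  module := inferInstance
  isScalarTower := Coind.instIsScalarTower
  finite := hfin
  deg := homDeg (GrMod.self 𝒜).deg X.deg S
  isInternal :=
    letI : Module.Finite S (GrMod.self 𝒜).carrier := hSR
    isInternal_homDeg (GrMod.self 𝒜).isInternal X.isInternal
      (span_isHomogeneousScalar_eq_top hS (GrMod.self 𝒜) X)
  smul_mem i n r f hr hf := by
    intro m x hx
    change R at x
    change Coind.app f (r * x) ∈ _
    have h1 : r * x ∈ (GrMod.self 𝒜).deg (m + i) := by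
      have := GrMod.smul_mem_self (X := GrMod.self 𝒜) (GrMod.mem_self hr) hx
      rwa [add_comm]
    have := hf _ _ h1
    rwa [show m + (n + i) = m + i + n by ring]

section Coind

variable {S : Subalgebra k R} (hS : IsHomogeneousSubalgebra 𝒜 S)
    (hSR : Module.Finite S R) (X : GrMod 𝒜) (hfin : Module.Finite R (Coind S X.carrier))

theorem embed_mem_hom :
    (Coind.embed S X.carrier : X.carrier →ₗ[R] (coind hS hSR X hfin).carrier) ∈
      hom X (coind hS hSR X hfin) :=
  fun _ _ hx _ _ hr => smul_mem_self (R := R) hr hx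

/-- Graded homomorphisms into the coinduced module are graded `S`-linear maps. -/
noncomputable def homCoindEquiv (M : GrMod 𝒜) (l : ℤ) :
    hom M ((coind hS hSR X hfin).shift l) ≃ₗ[k] homDeg M.deg X.deg S l where
  toFun f := ⟨{ toFun := fun m => Coind.app (f.1 m) 1
                map_add' := fun x y => congrArg (fun z => Coind.app z 1) (f.1.map_add x y)
                map_smul' := fun s x => by
                  refine (congrArg (fun z => Coind.app z 1) (f.1.map_smul (s : R) x)).trans ?_
                  exact (Coind.app (f.1 x)).map_smul s 1 }, fun n x hx => by
    have h1 : (1 : R) ∈ (GrMod.self 𝒜).deg ((0 : ℕ) : ℤ) := mem_self SetLike.GradedOne.one_mem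
    have := f.2 n x hx _ _ h1
    rwa [Nat.cast_zero, zero_add] at this⟩
  map_add' _ _ := rfl
  map_smul' _ _ := rfl
  invFun h := ⟨{ toFun := fun m => (h.1 ∘ₗ (LinearMap.toSpanSingleton R M.carrier m).restrictScalars S :
                    R →ₗ[S] X.carrier)
                 map_add' := fun x y => Coind.ext_app fun r =>
                    (congrArg h.1 (smul_add r x y)).trans (map_add h.1 _ _)
                 map_smul' := fun a x => Coind.ext_app fun r => congrArg h.1 (by
                    change r • a • x = (a * r) • x
                    rw [smul_smul, mul_comm]) }, fun n x hx m r hr => by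
    have := h.2 _ _ (smul_mem_self (R := R) hr hx)
    rwa [add_assoc] at this⟩
  left_inv f := Subtype.ext <| LinearMap.ext fun m => Coind.ext_app fun r => by
    change Coind.app (f.1 (r • m)) 1 = Coind.app (f.1 m) r
    rw [map_smul]
    exact congrArg (Coind.app (f.1 m)) (mul_one r)
  right_inv h := Subtype.ext <| LinearMap.ext fun m => congrArg h.1 (one_smul R m)

/-- By `homCoindEquiv` both sides count graded `S`-linear maps into `X`, and these depend only on
the graded `S`-module structure of the source. -/
theorem homDim_shift_coind_eq {M N : GrMod 𝒜} (φ : M.carrier ≃ₗ[S] N.carrier)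
    (hφ : ∀ n x, x ∈ M.deg n ↔ φ x ∈ N.deg n) (l : ℤ) :
    M.homDim ((coind hS hSR X hfin).shift l) = N.homDim ((coind hS hSR X hfin).shift l) := by
  let e : homDeg M.deg X.deg S l ≃ₗ[k] homDeg N.deg X.deg S l :=
    { toFun := fun h => ⟨h.1 ∘ₗ φ.symm.toLinearMap, fun n x hx => h.2 n _ (by
        rw [hφ]; simpa using hx)⟩
      map_add' := fun _ _ => rfl
      map_smul' := fun _ _ => rfl
      invFun := fun h => ⟨h.1 ∘ₗ φ.toLinearMap, fun n x hx => h.2 n _ ((hφ n x).1 hx)⟩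
      left_inv := fun h => Subtype.ext <| LinearMap.ext fun x => congrArg h.1 (φ.symm_apply_apply x)
      right_inv := fun h => Subtype.ext <| LinearMap.ext fun x => congrArg h.1 (φ.apply_symm_apply x) }
  exact ((homCoindEquiv hS hSR X hfin M l).trans
    (e.trans (homCoindEquiv hS hSR X hfin N l).symm)).finrank_eq

end Coind

end GrMod

end HomogeneousSubalgebra

section NoetherNormalization

variable {k : Type v} [Field k] {R : Type u} [CommRing R] [IsNoetherianRing R] [Algebra k R]
  {𝒜 : ℕ → Submodule k R} [GradedAlgebra 𝒜] (hR0 : Function.Bijective (algebraMap k (𝒜 0)))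

include hR0

namespace GrMod

/-- A common homogeneous system of parameters that is regular on a given Cohen-Macaulay module and
on the ring. -/
theorem exists_parameters (hR : IsGradedCM 𝒜 R) (Z : GrMod 𝒜) (hZ : Z.IsCM) :
    ∃ rs : List R, (∀ r ∈ rs, ∃ i, 0 < i ∧ r ∈ 𝒜 i) ∧ IsWeaklyRegular R rs ∧
      IsWeaklyRegular Z.carrier rs ∧ grMaxIdeal 𝒜 ≤ (Ideal.ofList rs).radical ∧
      ∀ Y : GrMod 𝒜, IsWeaklyRegular Y.carrier rs → Y.IsCM := by
  obtain ⟨d, hd⟩ := exists_ringKrullDim_eq hR0 hR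
  -- Applied to the direct sum `R ⊕ Z`, so that one sequence is regular on both.
  obtain ⟨rs, hlen, hrs, hw⟩ := exists_homogeneous_isWeaklyRegular d ((GrMod.self 𝒜).prod Z)
    ((isGradedCM_iff_extVanish hd _).1 (isGradedCM_prod hR hZ))
  obtain ⟨h1, h2⟩ := isWeaklyRegular_prod_iff (M := R) (N := Z.carrier) rs hw
  refine ⟨rs, hrs, h1, h2, grMaxIdeal_le_radical_ofList hR0 hd rs hlen hrs h1, fun Y hY => ?_⟩
  refine (isGradedCM_iff_extVanish hd _).2 ?_
  rw [← hlen]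
  exact extVanish_of_isWeaklyRegular Y rs (fun r hr => by
    obtain ⟨i, hi, h⟩ := hrs r hr
    exact mem_grMaxIdeal_of_mem 𝒜 hi h) hY

variable {rs : List R} (hrs : ∀ r ∈ rs, ∃ i, 0 < i ∧ r ∈ 𝒜 i)
  (hrad : grMaxIdeal 𝒜 ≤ (Ideal.ofList rs).radical)

include hrs hrad

theorem exists_basis_adjoin (M : GrMod 𝒜) (hM : IsWeaklyRegular M.carrier rs) :
    ∃ (ι : Type) (_ : Finite ι),
      Nonempty (Module.Basis ι (Algebra.adjoin k {x | x ∈ rs}) M.carrier) := by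
  obtain ⟨κ, g, hg, hspan, H⟩ := exists_basis_pair hR0 rs hrs
  have hf := finite_quotient_ofList_smul hR0 rs hrad M.carrier
  obtain ⟨ι, hι, d, v, w, hv, hw, hvl, hwl, hvs, hws⟩ := H M M rfl hM hM hf hf
  exact ⟨ι, hι, ⟨Module.Basis.mk (linearIndependent_subalgebra _ g hspan v hvl)
    (span_subalgebra_eq_top _ g hspan v hvs).ge⟩⟩

omit hrad in
theorem isHomogeneousSubalgebra_adjoin :
    IsHomogeneousSubalgebra 𝒜 (Algebra.adjoin k {x | x ∈ rs}) := by
  obtain ⟨κ, g, hg, hspan, H⟩ := exists_basis_pair hR0 rs hrs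
  exact isHomogeneousSubalgebra_of_span hg hspan

/-- Over the subalgebra both modules are free with homogeneous bases of the same degrees, and
matching the bases preserves the grading. -/
theorem exists_equiv_of_hilb_eq (M N : GrMod 𝒜) (hh : M.hilb = N.hilb)
    (hM : IsWeaklyRegular M.carrier rs) (hN : IsWeaklyRegular N.carrier rs) :
    ∃ φ : M.carrier ≃ₗ[Algebra.adjoin k {x | x ∈ rs}] N.carrier,
      ∀ n x, x ∈ M.deg n ↔ φ x ∈ N.deg n := by
  obtain ⟨κ, g, hg, hspan, H⟩ := exists_basis_pair hR0 rs hrs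
  obtain ⟨ι, hι, d, v, w, hv, hw, hvl, hwl, hvs, hws⟩ := H M N hh hM hN
    (finite_quotient_ofList_smul hR0 rs hrad M.carrier)
    (finite_quotient_ofList_smul hR0 rs hrad N.carrier)
  have hgS : ∀ a, g a ∈ Algebra.adjoin k {x | x ∈ rs} := fun a =>
    hspan.le (Submodule.subset_span ⟨a, rfl⟩)
  let b := Module.Basis.mk (linearIndependent_subalgebra _ g hspan v hvl)
    (span_subalgebra_eq_top _ g hspan v hvs).ge
  let c := Module.Basis.mk (linearIndependent_subalgebra _ g hspan w hwl)
    (span_subalgebra_eq_top _ g hspan w hws).ge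
  let φ := b.equiv c (Equiv.refl ι)
  have hφ : ∀ i, φ (v i) = w i := fun i => by
    have h1 : b i = v i := Module.Basis.mk_apply _ _ i
    have h2 : c i = w i := Module.Basis.mk_apply _ _ i
    rw [← h1, ← h2]
    exact b.equiv_apply i c (Equiv.refl ι)
  have hproj : ∀ n x, φ (M.proj n x) = N.proj n (φ x) := by
    intro n x
    have hx : x ∈ Submodule.span k (Set.range fun p : κ × ι => g p.1 • v p.2) := by rw [hvs]; trivial
    have hφk : ∀ (c : k) (x : M.carrier), φ (c • x) = c • φ x := fun c x => by
      rw [← algebraMap_smul (Algebra.adjoin k {x | x ∈ rs}) c x, map_smul, algebraMap_smul]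
    induction hx using Submodule.span_induction with
    | mem x hx =>
      obtain ⟨⟨a, i⟩, rfl⟩ := hx
      obtain ⟨e, he⟩ := hg a
      have h1 : φ (g a • v i) = g a • w i := by
        rw [← hφ]; exact φ.map_smul (⟨g a, hgS a⟩ : Algebra.adjoin k {x | x ∈ rs}) (v i)
      have h2 := M.smul_mem e _ _ _ he (hv i)
      have h3 := N.smul_mem e _ _ _ he (hw i)
      by_cases hn : d i + e = n
      · subst hn
        simp only [M.proj_of_mem h2, h1, N.proj_of_mem h3]
      · simp only [M.proj_of_mem_ne hn h2, h1, N.proj_of_mem_ne hn h3, map_zero]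
    | zero => simp
    | add x y _ _ hx hy => simp only [map_add, hx, hy]
    | smul c x _ hx => rw [map_smul, hφk, hφk, map_smul, hx]
  refine ⟨φ, fun n x => ⟨fun hx => ?_, fun hx => ?_⟩⟩
  · rw [← M.proj_of_mem hx, hproj]; exact N.proj_mem _ _
  · have h1 := hproj n x
    rw [N.proj_of_mem hx] at h1
    rw [← φ.injective h1]; exact M.proj_mem _ _

omit hrs hrad in
/-- A Cohen-Macaulay module embeds, with Cohen-Macaulay cokernel, into a graded module that does not
distinguish Cohen-Macaulay modules with the same Hilbert function. -/
theorem exists_coinduced_embedding (hR : IsGradedCM 𝒜 R) (M N X : GrMod 𝒜) (hM : M.IsCM)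
    (hN : N.IsCM) (hX : X.IsCM) (hh : M.hilb = N.hilb) :
    ∃ (W Y : GrMod 𝒜) (j : X.carrier →ₗ[R] W.carrier) (q : W.carrier →ₗ[R] Y.carrier),
      j ∈ hom X W ∧ q ∈ hom W Y ∧ Function.Injective j ∧ Function.Exact j q ∧
      Function.Surjective q ∧ Y.IsCM ∧ ∀ l, M.homDim (W.shift l) = N.homDim (W.shift l) := by
  obtain ⟨rs, hrs, hRr, hZ, hrad, hCM⟩ := exists_parameters hR0 hR ((M.prod N).prod X)
    (isGradedCM_prod (isGradedCM_prod hM hN) hX)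
  obtain ⟨hMN, hXr⟩ := isWeaklyRegular_prod_iff (M := M.carrier × N.carrier) (N := X.carrier) rs hZ
  obtain ⟨hMr, hNr⟩ := isWeaklyRegular_prod_iff (M := M.carrier) (N := N.carrier) rs hMN
  obtain ⟨φ, hφ⟩ := exists_equiv_of_hilb_eq hR0 hrs hrad M N hh hMr hNr
  have hS := isHomogeneousSubalgebra_adjoin hR0 hrs
  obtain ⟨ι, hι, ⟨b⟩⟩ := exists_basis_adjoin hR0 hrs hrad (GrMod.self 𝒜) hRr
  obtain ⟨ι', hι', ⟨b'⟩⟩ := exists_basis_adjoin hR0 hrs hrad X hXr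
  have hSR : Module.Finite (Algebra.adjoin k {x | x ∈ rs}) R := Module.Finite.of_basis b
  have hSX : Module.Finite (Algebra.adjoin k {x | x ∈ rs}) X.carrier := Module.Finite.of_basis b'
  have hfin := Coind.finite (Algebra.adjoin k {x | x ∈ rs}) X.carrier b
  let W := coind hS hSR X hfin
  let Y := W.ofQuot _ (homog_range (embed_mem_hom hS hSR X hfin))
  refine ⟨W, Y, Coind.embed _ X.carrier, Submodule.mkQ _, embed_mem_hom hS hSR X hfin,
    W.mkQ_mem_hom _ _, Coind.embed_injective _ _, ?_, Submodule.mkQ_surjective _, hCM Y ?_,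
    homDim_shift_coind_eq hS hSR X hfin φ hφ⟩
  · exact LinearMap.exact_map_mkQ_range _
  · exact Coind.isWeaklyRegular_quotient _ X.carrier b rs
      (fun r hr => Algebra.subset_adjoin hr) hXr

end GrMod

end NoetherNormalization

end

/-! ### Graded internal Hom and the asymptotic equality -/

section

open InternalGrading

section InternalHom

variable {k : Type v} [Field k] {R : Type u} [CommRing R] [IsNoetherianRing R] [Algebra k R]
  {𝒜 : ℕ → Submodule k R} [GradedAlgebra 𝒜]

namespace GrMod

/-- The graded module of all homomorphisms. -/
noncomputable def ihom (M Y : GrMod 𝒜) : GrMod 𝒜 where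
  carrier := M.carrier →ₗ[R] Y.carrier
  deg := homDeg M.deg Y.deg R
  isInternal := isInternal_homDeg M.isInternal Y.isInternal (span_isHomogeneousScalar_self_eq_top M Y)
  smul_mem i n a f ha hf m x hx := by
    have := Y.smul_mem i _ a _ ha (hf m x hx)
    rwa [add_assoc] at this

variable {M W Y : GrMod 𝒜}

theorem compRight_mem_hom {q : W.carrier →ₗ[R] Y.carrier} (hq : q ∈ hom W Y) :
    (q.compRight R : (M.ihom W).carrier →ₗ[R] (M.ihom Y).carrier) ∈ hom (M.ihom W) (M.ihom Y) :=
  fun _ _ hf m x hx => hq _ _ (hf m x hx)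

variable (hR0 : Function.Bijective (algebraMap k (𝒜 0)))

include hR0

/-- If every homomorphism to `Y` lifts to `W` up to powers of homogeneous elements of `𝔪`, then all
homomorphisms of large degree lift. -/
theorem exists_forall_lift {q : W.carrier →ₗ[R] Y.carrier} (hq : q ∈ hom W Y)
    (H : ∀ e, ∀ f ∈ (M.ihom Y).deg e, ∀ i, 0 < i → ∀ r ∈ 𝒜 i,
      ∃ (n : ℕ) (h : M.carrier →ₗ[R] W.carrier), q ∘ₗ h = r ^ n • f) :
    ∃ B : ℕ, ∀ l : ℤ, (B : ℤ) ≤ |l| → ∀ f ∈ (M.ihom Y).deg l,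
      ∃ h ∈ (M.ihom W).deg l, q ∘ₗ h = f := by
  classical
  let L : Submodule R (M.ihom Y).carrier :=
    LinearMap.range (q.compRight R : (M.ihom W).carrier →ₗ[R] (M.ihom Y).carrier)
  have hL : (M.ihom Y).Homog L := homog_range (compRight_mem_hom hq)
  have hup : ∀ (r : R) (f : (M.ihom Y).carrier) (n m : ℕ), n ≤ m → r ^ n • f ∈ L → r ^ m • f ∈ L := by
    intro r f n m hnm h
    rw [← Nat.sub_add_cancel hnm, pow_add, mul_smul]
    exact L.smul_mem _ h
  have hall : ∀ i, 0 < i → ∀ r ∈ 𝒜 i, ∀ f : (M.ihom Y).carrier, ∃ n : ℕ, r ^ n • f ∈ L := by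
    intro i hi r hr f
    refine (M.ihom Y).homogeneous_induction (P := fun f => ∃ n : ℕ, r ^ n • f ∈ L) ?_ ?_ ?_ f
    · intro e f hf
      obtain ⟨n, h, hh⟩ := H e f hf i hi r hr
      exact ⟨n, h, hh⟩
    · exact ⟨0, by simp⟩
    · rintro f g ⟨n, hn⟩ ⟨m, hm⟩
      refine ⟨max n m, ?_⟩
      rw [smul_add]
      exact L.add_mem (hup r f n _ (le_max_left _ _) hn) (hup r g m _ (le_max_right _ _) hm)
  let C := (M.ihom Y).ofQuot L hL
  have hrad : grMaxIdeal 𝒜 ≤ (Module.annihilator R C.carrier).radical := by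
    rw [grMaxIdeal_eq_span, Ideal.span_le]
    rintro r ⟨i, hi, hr⟩
    obtain ⟨s, hs⟩ := Module.Finite.fg_top (R := R) (M := (M.ihom Y).carrier)
    choose n hn using hall i hi r hr
    refine ⟨s.sup n, ?_⟩
    rw [Module.mem_annihilator]
    intro c
    obtain ⟨f, rfl⟩ := L.mkQ_surjective c
    refine (L.mkQ.map_smul _ f).symm.trans ((Submodule.Quotient.mk_eq_zero L).2 ?_)
    have hf : f ∈ Submodule.span R (s : Set (M.ihom Y).carrier) := by rw [hs]; trivial
    induction hf using Submodule.span_induction with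
    | mem f hf => exact hup r f _ _ (Finset.le_sup hf) (hn f)
    | zero => rw [smul_zero]; exact L.zero_mem
    | add x y _ _ hx hy => rw [smul_add]; exact L.add_mem hx hy
    | smul a x _ hx => rw [smul_comm]; exact L.smul_mem _ hx
  -- A power of `𝔪` kills the cokernel `C`, so `C` is finite-dimensional and vanishes in all degrees
  -- of large absolute value.
  obtain ⟨K, hK⟩ := Ideal.exists_pow_le_of_le_radical_of_fg hrad (IsNoetherian.noetherian _)
  have hfin : Module.Finite k C.carrier := by
    refine finite_of_pow_smul_eq_bot 𝒜 hR0 K C.carrier ?_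
    rw [eq_bot_iff, Submodule.smul_le]
    intro r hr c _
    rw [Submodule.mem_bot]
    exact Module.mem_annihilator.1 (hK hr) c
  obtain ⟨B, hB⟩ := exists_bound C.isInternal
  refine ⟨B, fun l hl f hf => ?_⟩
  have h1 : ∀ c ∈ C.deg l, c = 0 := by
    rw [hB l hl]
    exact fun c hc => (Submodule.mem_bot k).1 hc
  obtain ⟨h, hh⟩ := (Submodule.Quotient.mk_eq_zero L).1 (h1 _ ((M.ihom Y).mkQ_mem_hom L hL l f hf))
  -- The lift found need not be homogeneous; its component of degree `l` also lifts `f`.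
  refine ⟨(M.ihom W).proj l h, (M.ihom W).proj_mem l h, ?_⟩
  have h2 := hom_proj (compRight_mem_hom (M := M) hq) l h
  exact h2.symm.trans ((congrArg ((M.ihom Y).proj l) hh).trans ((M.ihom Y).proj_of_mem hf))

variable {X : GrMod 𝒜}

/-- Hom is left exact, and the lifting hypothesis supplies exactness on the right. -/
theorem homDim_add_homDim {j : X.carrier →ₗ[R] W.carrier} {q : W.carrier →ₗ[R] Y.carrier}
    (hj : j ∈ hom X W) (hq : q ∈ hom W Y) (hinj : Function.Injective j) (hex : Function.Exact j q)
    (hlift : ∀ f ∈ hom M Y, ∃ h ∈ hom M W, q ∘ₗ h = f) :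
    M.homDim X + M.homDim Y = M.homDim W := by
  have := M.finite_hom hR0 W
  let F : hom M W →ₗ[k] hom M Y :=
    { toFun := fun h => ⟨q ∘ₗ h.1, fun n x hx => hq _ _ (h.2 n x hx)⟩
      map_add' := fun x y => Subtype.ext (LinearMap.comp_add _ _ _)
      map_smul' := fun c x => Subtype.ext (LinearMap.ext fun y => by
        change q (c • (x.1 y)) = c • q (x.1 y)
        exact (q.restrictScalars k).map_smul c (x.1 y)) }
  let G : hom M X →ₗ[k] LinearMap.ker F :=
    { toFun := fun h => ⟨⟨j ∘ₗ h.1, fun n x hx => hj _ _ (h.2 n x hx)⟩, by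
        rw [LinearMap.mem_ker]
        exact Subtype.ext (LinearMap.ext fun x => hex.apply_apply_eq_zero _)⟩
      map_add' := fun x y => Subtype.ext (Subtype.ext (LinearMap.comp_add _ _ _))
      map_smul' := fun c x => Subtype.ext (Subtype.ext (LinearMap.ext fun y => by
        change j (c • (x.1 y)) = c • j (x.1 y)
        exact (j.restrictScalars k).map_smul c (x.1 y))) }
  have hF : LinearMap.range F = ⊤ := by
    rw [LinearMap.range_eq_top]
    rintro ⟨f, hf⟩
    obtain ⟨h, hh, rfl⟩ := hlift f hf
    exact ⟨⟨h, hh⟩, rfl⟩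
  have hG : Function.Bijective G := by
    constructor
    · intro x y hxy
      refine Subtype.ext (LinearMap.ext fun m => hinj ?_)
      exact congrArg (fun z : LinearMap.ker F => z.1.1 m) hxy
    · rintro ⟨⟨h, hh⟩, hker⟩
      have h0 : ∀ m, q (h m) = 0 := fun m =>
        congrArg (fun z : hom M Y => z.1 m) (LinearMap.mem_ker.1 hker)
      have h1 : ∀ m, ∃ x, j x = h m := fun m => (hex (h m)).1 (h0 m)
      choose g hg using h1
      refine ⟨⟨{ toFun := g, map_add' := fun x y => hinj ?_, map_smul' := fun a x => hinj ?_ }, ?_⟩, ?_⟩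
      · rw [map_add, hg, hg, hg, map_add]
      · rw [RingHom.id_apply, map_smul, hg, hg, map_smul]
      · intro n m hm
        change g m ∈ X.deg n
        have h2 := hh n m hm
        rw [← hg] at h2
        have h3 : X.proj n (g m) = g m := hinj (by rw [← hom_proj hj, W.proj_of_mem h2])
        rw [← h3]; exact X.proj_mem _ _
      · exact Subtype.ext (Subtype.ext (LinearMap.ext hg))
  have h1 := LinearMap.finrank_range_add_finrank_ker F
  rw [hF, finrank_top, ← (LinearEquiv.ofBijective G hG).finrank_eq] at h1
  unfold homDim
  omega

/-- The asymptotic equality of hom dimensions follows from the lifting property up to powers. -/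
theorem exists_forall_homDim_eq (hR : IsGradedCM 𝒜 R) {M N : GrMod 𝒜} (hM : M.IsCM) (hN : N.IsCM)
    (hh : M.hilb = N.hilb) (hom : M.HomLE N) (X : GrMod 𝒜) (hX : X.IsCM)
    (H : ∀ (W Y : GrMod 𝒜) (j : X.carrier →ₗ[R] W.carrier) (q : W.carrier →ₗ[R] Y.carrier),
      j ∈ GrMod.hom X W → q ∈ GrMod.hom W Y → Function.Injective j → Function.Exact j q →
      Function.Surjective q → ∀ L : GrMod 𝒜, L.IsCM → ∀ e, ∀ f ∈ (L.ihom Y).deg e, ∀ i, 0 < i →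
      ∀ r ∈ 𝒜 i, ∃ (n : ℕ) (h : L.carrier →ₗ[R] W.carrier), q ∘ₗ h = r ^ n • f) :
    ∃ l₀ : ℤ, ∀ l : ℤ, l₀ ≤ |l| → M.homDim (X.shift l) = N.homDim (X.shift l) := by
  obtain ⟨W, Y, j, q, hj, hq, hinj, hex, hsurj, hY, hW⟩ :=
    exists_coinduced_embedding hR0 hR M N X hM hN hX hh
  obtain ⟨B₁, hB₁⟩ := exists_forall_lift hR0 hq (H W Y j q hj hq hinj hex hsurj M hM)
  obtain ⟨B₂, hB₂⟩ := exists_forall_lift hR0 hq (H W Y j q hj hq hinj hex hsurj N hN)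
  refine ⟨max B₁ B₂, fun l hl => ?_⟩
  have h1 := homDim_add_homDim hR0 (M := M) (X := X.shift l) (W := W.shift l) (Y := Y.shift l)
    (j := j) (q := q) (fun n x hx => hj _ x hx) (fun n x hx => hq _ x hx) hinj hex
    (hB₁ l ((le_max_left _ _).trans hl))
  have h2 := homDim_add_homDim hR0 (M := N) (X := X.shift l) (W := W.shift l) (Y := Y.shift l)
    (j := j) (q := q) (fun n x hx => hj _ x hx) (fun n x hx => hq _ x hx) hinj hex
    (hB₂ l ((le_max_right _ _).trans hl))
  -- Shifting leaves the underlying module, hence the Cohen–Macaulay property, unchanged. The two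
  -- inequalities have equal sums on both sides, so each is an equality.
  have h3 := hom (X.shift l) hX
  have h4 := hom (Y.shift l) hY
  have h5 := hW l
  omega

end GrMod

end InternalHom

end

/-! ### Lifting for isolated singularities -/

section IsolatedSingularity

variable {k : Type v} [Field k] {R : Type u} [CommRing R] [Algebra k R]
  {𝒜 : ℕ → Submodule k R} [GradedAlgebra 𝒜]

/-- The local ring at `p` is a further localization of the homogeneous one, at the extension of `p`.
-/
theorem isRegularLocalRing_atPrime_of_homogeneousCompl (p : Ideal R) [hp : p.IsPrime]
    (h : IsRegularRing (Localization (homogeneousCompl 𝒜 p))) :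
    IsRegularLocalRing (Localization.AtPrime p) := by
  let H := homogeneousCompl 𝒜 p
  have hdisj : Disjoint (H : Set R) p := Set.disjoint_left.2 fun x hx hxp => hx.2 hxp
  have hprime := IsLocalization.isPrime_of_isPrime_disjoint H (Localization H) p hp hdisj
  have hcomap : (p.map (algebraMap R (Localization H))).comap (algebraMap R (Localization H)) = p :=
    IsLocalization.under_map_of_isPrime_disjoint H (Localization H) hp hdisj
  have hloc := IsLocalization.isLocalization_atPrime_localization_atPrime H
    (p.map (algebraMap R (Localization H)))
  have hloc' : IsLocalization p.primeCompl
      (Localization.AtPrime (p.map (algebraMap R (Localization H)))) := by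
    convert hloc using 1
    ext x
    change x ∉ p ↔ x ∉ (p.map (algebraMap R (Localization H))).comap (algebraMap R (Localization H))
    rw [hcomap]
  have := h.isRegularLocalRing_localization (p.map (algebraMap R (Localization H)))
  exact IsRegularLocalRing.of_ringEquiv (IsLocalization.algEquiv p.primeCompl
    (Localization.AtPrime (p.map (algebraMap R (Localization H)))) (Localization.AtPrime p)).toRingEquiv

variable [IsNoetherianRing R]

namespace GrMod

variable (hR0 : Function.Bijective (algebraMap k (𝒜 0)))

include hR0

theorem exists_notMem_factor_of_isCM (hR : IsGradedCM 𝒜 R) (M : GrMod 𝒜) (hM : M.IsCM) (p : Ideal R)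
    [p.IsPrime] [IsRegularLocalRing (Localization.AtPrime p)] :
    ∃ s ∉ p, ∃ (m : ℕ) (j : M.carrier →ₗ[R] (Fin m → R)) (g : (Fin m → R) →ₗ[R] M.carrier),
      ∀ x, g (j x) = s • x := by
  obtain ⟨rs, hrs, hRr, hMr, hrad, -⟩ := exists_parameters hR0 hR M hM
  obtain ⟨ι, hι, ⟨b⟩⟩ := exists_basis_adjoin hR0 hrs hrad (GrMod.self 𝒜) hRr
  obtain ⟨ι', hι', ⟨b'⟩⟩ := exists_basis_adjoin hR0 hrs hrad M hMr
  let b₀ : Module.Basis ι (Algebra.adjoin k {x | x ∈ rs}) R := b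
  have : Module.Finite (Algebra.adjoin k {x | x ∈ rs}) R := Module.Finite.of_basis b₀
  have : Module.Projective (Algebra.adjoin k {x | x ∈ rs}) R := Module.Projective.of_basis b₀
  have : Module.Projective (Algebra.adjoin k {x | x ∈ rs}) M.carrier := Module.Projective.of_basis b'
  have : Algebra.IsIntegral (Algebra.adjoin k {x | x ∈ rs}) R := Algebra.IsIntegral.of_finite _ _
  have := free_localizedModule_of_isRegularLocalRing (S := Algebra.adjoin k {x | x ∈ rs}) p M.carrier
  exact exists_notMem_factor p M.carrier

omit hR0 [IsNoetherianRing R] in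
theorem proj_smul_of_mem (M : GrMod 𝒜) {e : ℤ} {x : M.carrier} (hx : x ∈ M.deg e) (r : R) (i : ℕ) :
    M.proj (e + i) (r • x) = (DirectSum.decompose 𝒜 r i : R) • x := by
  induction r using DirectSum.Decomposition.inductionOn 𝒜 with
  | zero => simp
  | @homogeneous j a =>
    have h1 := M.smul_mem j e a x a.2 hx
    by_cases h : j = i
    · subst h
      rw [M.proj_of_mem h1, DirectSum.decompose_of_mem_same 𝒜 a.2]
    · rw [M.proj_of_mem_ne (by omega) h1, DirectSum.decompose_of_mem_ne 𝒜 a.2 h, zero_smul]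
  | add a b ha hb =>
    rw [add_smul, map_add, ha, hb, DirectSum.decompose_add, ← add_smul]; rfl

/-- The elements `a` for which `a • f` lifts form a homogeneous ideal `J`. If `r` were outside its
radical, some graded prime other than `𝔪` would contain `J`. There `M` is free, so some `s` outside
that prime has `s • id` factoring through a free module. Maps from a free module lift, so `s ∈ J`, a
contradiction. -/
theorem exists_lift_pow_of_isolatedSingularity (hR : IsGradedCM 𝒜 R)
    (hiso : IsGradedIsolatedSingularity 𝒜) {M W Y : GrMod 𝒜} (hM : M.IsCM)
    {q : W.carrier →ₗ[R] Y.carrier} (hq : q ∈ hom W Y) (hsurj : Function.Surjective q) {e : ℤ}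
    {f : M.carrier →ₗ[R] Y.carrier} (hf : f ∈ (M.ihom Y).deg e) {i : ℕ} (hi : 0 < i) {r : R}
    (hr : r ∈ 𝒜 i) : ∃ (n : ℕ) (h : M.carrier →ₗ[R] W.carrier), q ∘ₗ h = r ^ n • f := by
  let L : Submodule R (M.ihom Y).carrier :=
    LinearMap.range (q.compRight R : (M.ihom W).carrier →ₗ[R] (M.ihom Y).carrier)
  have hL : (M.ihom Y).Homog L := homog_range (compRight_mem_hom hq)
  let F : (M.ihom Y).carrier := f
  let J : Ideal R := L.comap (LinearMap.toSpanSingleton R _ F)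
  have hmem : ∀ a, a ∈ J ↔ ∃ h : M.carrier →ₗ[R] W.carrier, q ∘ₗ h = a • f := fun a => Iff.rfl
  have hJ : J.IsHomogeneous 𝒜 := by
    intro j a ha
    change (DirectSum.decompose 𝒜 a j : R) • F ∈ L
    rw [← (M.ihom Y).proj_smul_of_mem hf]
    exact hL _ _ ha
  suffices h : r ∈ J.radical from h
  by_contra hrad
  rw [Ideal.radical_eq_sInf, Ideal.mem_sInf] at hrad
  push Not at hrad
  obtain ⟨p, ⟨hJp, hp⟩, hrp⟩ := hrad
  -- The prime found need not be graded. Its homogeneous core is a graded prime that still contains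
  -- the homogeneous ideal `J` and still omits `r`, so it is not `𝔪`.
  have hcore := Ideal.IsPrime.homogeneousCore (𝒜 := 𝒜) hp
  have hle := Ideal.toIdeal_homogeneousCore_le 𝒜 p
  have hJc : J ≤ (p.homogeneousCore 𝒜).toIdeal := by
    have := Ideal.homogeneousCore_mono 𝒜 hJp
    rw [← hJ.toIdeal_homogeneousCore_eq_self]
    exact this
  have hne : (p.homogeneousCore 𝒜).toIdeal ≠ grMaxIdeal 𝒜 := fun h =>
    hrp (hle (h.ge (mem_grMaxIdeal_of_mem 𝒜 hi hr)))
  have := isRegularLocalRing_atPrime_of_homogeneousCompl (p.homogeneousCore 𝒜).toIdeal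
    (hiso _ (p.homogeneousCore 𝒜).isHomogeneous hne)
  obtain ⟨s, hs, m, j, g, hgj⟩ := exists_notMem_factor_of_isCM hR0 hR M hM
    (p.homogeneousCore 𝒜).toIdeal
  obtain ⟨h, hh⟩ := Module.projective_lifting_property q (f ∘ₗ g) hsurj
  refine hs (hJc ((hmem s).2 ⟨h ∘ₗ j, LinearMap.ext fun x => ?_⟩))
  have h1 := LinearMap.congr_fun hh (j x)
  change q (h (j x)) = f (g (j x)) at h1
  change q (h (j x)) = s • f x
  rw [h1, hgj, map_smul]

end GrMod

end IsolatedSingularity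

/-! ### Extension by dimension count and splitting via truncations -/

section

open scoped Pointwise

section HomCount

variable {k : Type*} [Field k] {R : Type*} [CommRing R] [Algebra k R]

theorem finite_linearMap_of_finite (X T : Type*) [AddCommGroup X] [AddCommGroup T] [Module R X]
    [Module R T] [Module k T] [IsScalarTower k R T] [Module.Finite R X] [Module.Finite k T] :
    Module.Finite k (X →ₗ[R] T) := by
  obtain ⟨m, g, hg⟩ := Module.Finite.exists_fin' R X
  have := Module.Finite.equiv ((Pi.basisFun R (Fin m)).constr k (M' := T))
  exact Module.Finite.of_injective (LinearMap.lcomp k T g)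
    (fun x y h => LinearMap.ext fun z => by
      obtain ⟨z, rfl⟩ := hg z
      exact LinearMap.congr_fun h z)

/-- A numerical criterion for the extension of homomorphisms. -/
theorem exists_extension_of_finrank_eq {X P E T : Type*} [AddCommGroup X] [AddCommGroup P]
    [AddCommGroup E] [AddCommGroup T] [Module R X] [Module R P] [Module R E] [Module R T] [Module k T]
    [IsScalarTower k R T] [Module.Finite k (X →ₗ[R] T)] [Module.Finite k (P →ₗ[R] T)]
    {φ : X →ₗ[R] P} {ψ : P →ₗ[R] E} (hex : Function.Exact φ ψ) (hψ : Function.Surjective ψ)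
    (hdim : Module.finrank k (P →ₗ[R] T) = Module.finrank k (X →ₗ[R] T) + Module.finrank k (E →ₗ[R] T))
    (t : X →ₗ[R] T) : ∃ s : P →ₗ[R] T, s ∘ₗ φ = t := by
  let F : (P →ₗ[R] T) →ₗ[k] (X →ₗ[R] T) := LinearMap.lcomp k T φ
  let G : (E →ₗ[R] T) →ₗ[k] LinearMap.ker F := LinearMap.codRestrict _ (LinearMap.lcomp k T ψ) fun s => by
    rw [LinearMap.mem_ker]
    exact LinearMap.ext fun x => by
      change s (ψ (φ x)) = 0
      rw [hex.apply_apply_eq_zero, map_zero]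
  have hG : Function.Bijective G := by
    constructor
    · intro x y hxy
      refine LinearMap.ext fun z => ?_
      obtain ⟨z, rfl⟩ := hψ z
      exact congrArg (fun w : LinearMap.ker F => w.1 z) hxy
    · rintro ⟨s, hs⟩
      have hle : LinearMap.ker ψ ≤ LinearMap.ker s := by
        intro z hz
        obtain ⟨x, rfl⟩ := (hex z).1 hz
        exact LinearMap.congr_fun (LinearMap.mem_ker.1 hs) x
      refine ⟨(LinearMap.ker ψ).liftQ s hle ∘ₗ (ψ.quotKerEquivOfSurjective hψ).symm.toLinearMap,
        Subtype.ext (LinearMap.ext fun z => ?_)⟩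
      change (LinearMap.ker ψ).liftQ s hle ((ψ.quotKerEquivOfSurjective hψ).symm (ψ z)) = s z
      have : (ψ.quotKerEquivOfSurjective hψ).symm (ψ z) = Submodule.Quotient.mk z := by
        rw [LinearEquiv.symm_apply_eq]; rfl
      rw [this]; rfl
  -- The kernel of restriction along `φ` is `Hom(E, T)`, so the dimension hypothesis leaves the
  -- range with the full dimension of `Hom(X, T)`.
  have h1 := LinearMap.finrank_range_add_finrank_ker F
  rw [← (LinearEquiv.ofBijective G hG).finrank_eq, hdim] at h1
  have h2 : LinearMap.range F = ⊤ := Submodule.eq_top_of_finrank_eq (by omega)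
  exact LinearMap.range_eq_top.1 h2 t

end HomCount

section GradedLift

variable {k : Type v} [Field k] {R : Type u} [CommRing R] [Algebra k R]
  {𝒜 : ℕ → Submodule k R} [GradedAlgebra 𝒜]

namespace GrMod

theorem homog_grMaxIdeal_smul_top (M : GrMod 𝒜) :
    M.Homog (grMaxIdeal 𝒜 • (⊤ : Submodule R M.carrier)) := by
  intro n x hx
  induction hx using Submodule.smul_induction_on' with
  | smul a ha x _ =>
    obtain ⟨s, hs, h⟩ := exists_sum_of_mem_grMaxIdeal 𝒜 ha
    rw [h, Finset.sum_smul, map_sum]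
    refine Submodule.sum_mem _ fun i hi => ?_
    rw [M.proj_smul (SetLike.coe_mem _)]
    exact Submodule.smul_mem_smul (mem_grMaxIdeal_of_mem 𝒜 (hs i hi) (SetLike.coe_mem _)) trivial
  | add x _ y _ hx hy => rw [map_add]; exact Submodule.add_mem _ hx hy

/-- Above the degrees of the generators, every homogeneous element needs coefficients of positive
degree. -/
theorem exists_ge_le_smul_top (M : GrMod 𝒜) :
    ∃ B : ℤ, ∀ b, B ≤ b → M.ge b ≤ grMaxIdeal 𝒜 • (⊤ : Submodule R M.carrier) := by
  obtain ⟨s, B, hs, hB⟩ := M.exists_generators_bounded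
  have key : ∀ x : M.carrier, ∀ n : ℤ, B < n →
      M.proj n x ∈ grMaxIdeal 𝒜 • (⊤ : Submodule R M.carrier) := by
    intro x
    have hx : x ∈ Submodule.span R (s : Set M.carrier) := by rw [hs]; trivial
    induction hx using Submodule.span_induction with
    | mem x hx =>
      intro n hn
      obtain ⟨m, -, hm, h⟩ := hB x hx
      rw [M.proj_of_mem_ne (by omega) h]; exact Submodule.zero_mem _
    | zero => intro n _; rw [map_zero]; exact Submodule.zero_mem _
    | add x y _ _ hx hy =>
      intro n hn; rw [map_add]; exact Submodule.add_mem _ (hx n hn) (hy n hn)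
    | smul r x _ hx =>
      intro n hn
      induction r using DirectSum.Decomposition.inductionOn 𝒜 with
      | zero => rw [zero_smul, map_zero]; exact Submodule.zero_mem _
      | @homogeneous i a =>
        rw [M.proj_smul a.2]
        rcases Nat.eq_zero_or_pos i with rfl | hi
        · exact Submodule.smul_mem _ _ (hx _ (by simpa using hn))
        · exact Submodule.smul_mem_smul (mem_grMaxIdeal_of_mem 𝒜 hi a.2) trivial
      | add a b ha hb => rw [add_smul, map_add]; exact Submodule.add_mem _ ha hb
  refine ⟨B + 1, fun b hb x hx => ?_⟩
  obtain ⟨t, ht, -⟩ := M.exists_sum_proj x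
  rw [ht]
  refine Submodule.sum_mem _ fun n _ => ?_
  by_cases hn : n < b
  · rw [hx n hn]; exact Submodule.zero_mem _
  · exact key x n (by omega)

/-- Degree-preserving maps to a truncation lift if the truncation is far enough. -/
theorem exists_forall_lift_truncation [IsNoetherianRing R] (E : GrMod 𝒜) :
    ∃ B : ℤ, ∀ b, B ≤ b → ∀ (X : GrMod 𝒜) (v : E.carrier →ₗ[R] (X.ofQuot _ (X.homog_ge b)).carrier),
      v ∈ hom E (X.ofQuot _ (X.homog_ge b)) →
      ∃ v' : E.carrier →ₗ[R] X.carrier, (X.ge b).mkQ ∘ₗ v' = v := by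
  classical
  obtain ⟨s, hs, hd⟩ := E.exists_homogeneous_generators
  choose! d hd using hd
  let π : (s → R) →ₗ[R] E.carrier := Fintype.linearCombination R (fun a : s => (a : E.carrier))
  have hπ : Function.Surjective π := by
    rw [← LinearMap.range_eq_top, Fintype.range_linearCombination, ← hs]
    simp
  obtain ⟨t, ht⟩ := IsNoetherian.noetherian (LinearMap.ker π)
  have hdeg : ∀ r : R, ∃ N : ℕ, ∀ n, N < n → (DirectSum.decompose 𝒜 r n : R) = 0 := fun r =>
    ⟨(DirectSum.decompose 𝒜 r).support.sup id, fun n hn => by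
      by_contra h
      have : n ∈ (DirectSum.decompose 𝒜 r).support := by
        rw [DFinsupp.mem_support_iff]; exact fun h0 => h (by rw [h0]; rfl)
      exact absurd (Finset.le_sup (f := id) this) (not_le.2 hn)⟩
  choose N hN using hdeg
  -- A bound for the degrees of all terms `κ a • x a`, where `κ` runs over finitely many generators
  -- of the relations. For `b > D` the image `φ κ` has components only in degrees at most `D`, yet
  -- lies in degrees at least `b`; it is therefore zero, so relations are respected.
  let D : ℕ := t.sup fun κ => Finset.univ.sup fun a : s => (d a).natAbs + N (κ a)
  refine ⟨D + 1, fun b hb X v hv => ?_⟩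
  have hx : ∀ a : s, ∃ x ∈ X.deg (d a), (X.ge b).mkQ x = v a := fun a => hv _ _ (hd a a.2)
  choose x hx hxv using hx
  let φ : (s → R) →ₗ[R] X.carrier := Fintype.linearCombination R x
  have hφ : ∀ κ, (X.ge b).mkQ (φ κ) = v (π κ) := by
    intro κ
    have h1 : φ κ = ∑ a, κ a • x a := Fintype.linearCombination_apply R x κ
    have h2 : π κ = ∑ a, κ a • (a : E.carrier) := Fintype.linearCombination_apply R _ κ
    rw [h1, h2, map_sum, map_sum]
    refine Finset.sum_congr rfl fun a _ => ?_
    rw [map_smul, map_smul, hxv]; rfl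
  have hker : LinearMap.ker π ≤ LinearMap.ker φ := by
    rw [← ht, Submodule.span_le]
    intro κ hκ
    have hκ0 : π κ = 0 := by
      have : κ ∈ LinearMap.ker π := ht ▸ Submodule.subset_span hκ
      exact this
    have h1 : φ κ ∈ X.ge b := by
      have := hφ κ
      rw [hκ0, map_zero] at this
      exact (Submodule.Quotient.mk_eq_zero _).1 this
    refine LinearMap.mem_ker.2 (X.ext_proj fun n => ?_)
    rw [map_zero]
    by_cases hn : n < b
    · exact h1 n hn
    · have h2 : φ κ = ∑ a, κ a • x a := Fintype.linearCombination_apply R x κ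
      rw [h2, map_sum]
      refine Finset.sum_eq_zero fun a _ => ?_
      have h3 : (d a).natAbs + N (κ a) ≤ D :=
        (Finset.le_sup (f := fun a : s => (d a).natAbs + N (κ a)) (Finset.mem_univ a)).trans
          (Finset.le_sup (f := fun κ => Finset.univ.sup fun a : s => (d a).natAbs + N (κ a)) hκ)
      obtain ⟨i, hi⟩ : ∃ i : ℕ, n = d a + i := ⟨(n - d a).toNat, by omega⟩
      rw [hi, X.proj_smul_of_mem (hx a), hN _ _ (by omega), zero_smul]
  refine ⟨(LinearMap.ker π).liftQ φ hker ∘ₗ (π.quotKerEquivOfSurjective hπ).symm.toLinearMap,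
    LinearMap.ext fun y => ?_⟩
  obtain ⟨κ, rfl⟩ := hπ y
  have h1 : (π.quotKerEquivOfSurjective hπ).symm (π κ) = Submodule.Quotient.mk κ := by
    rw [LinearEquiv.symm_apply_eq]; rfl
  change (X.ge b).mkQ ((LinearMap.ker π).liftQ φ hker ((π.quotKerEquivOfSurjective hπ).symm (π κ))) = _
  rw [h1]
  exact hφ κ

variable [IsNoetherianRing R]

/-- The component of degree `l` of a homomorphism of graded modules. -/
noncomputable def projHom {M Y : GrMod 𝒜} (l : ℤ) (f : M.carrier →ₗ[R] Y.carrier) :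
    M.carrier →ₗ[R] Y.carrier := (M.ihom Y).proj l f

theorem projHom_mem {M Y : GrMod 𝒜} (l : ℤ) (f : M.carrier →ₗ[R] Y.carrier) :
    projHom l f ∈ (M.ihom Y).deg l := (M.ihom Y).proj_mem l f

theorem projHom_apply {M Y : GrMod 𝒜} (f : M.carrier →ₗ[R] Y.carrier) (l : ℤ) {n : ℤ}
    {x : M.carrier} (hx : x ∈ M.deg n) : projHom l f x = Y.proj (n + l) (f x) := by
  refine (M.ihom Y).homogeneous_induction (P := fun f : M.carrier →ₗ[R] Y.carrier =>
    projHom l f x = Y.proj (n + l) (f x)) ?_ ?_ ?_ f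
  · intro m f hf
    by_cases h : m = l
    · subst h
      have h1 : projHom m f = f := (M.ihom Y).proj_of_mem hf
      rw [h1]
      exact (Y.proj_of_mem (hf n x hx)).symm
    · have h1 : projHom l f = 0 := (M.ihom Y).proj_of_mem_ne h hf
      rw [h1]
      exact (Y.proj_of_mem_ne (by omega) (hf n x hx)).symm
  · have h1 : projHom l (0 : M.carrier →ₗ[R] Y.carrier) = 0 := map_zero ((M.ihom Y).proj l)
    refine (LinearMap.congr_fun h1 x).trans ?_
    exact (map_zero (Y.proj (n + l))).symm
  · intro (f : M.carrier →ₗ[R] Y.carrier) (g : M.carrier →ₗ[R] Y.carrier) hf hg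
    have h1 : projHom l (f + g : M.carrier →ₗ[R] Y.carrier) = projHom l f + projHom l g :=
      map_add ((M.ihom Y).proj l) f g
    refine (LinearMap.congr_fun h1 x).trans ?_
    exact (congrArg₂ (· + ·) hf hg).trans (map_add (Y.proj (n + l)) (f x) (g x)).symm

/-- A graded injection `i : X → E` splits if `1 - v i` maps into `𝔪 T` for the truncations `T`. -/
theorem exists_retraction_of_truncation {X E : GrMod 𝒜} {i : X.carrier →ₗ[R] E.carrier}
    (hi : i ∈ hom X E)
    (H : ∀ b, ∃ v : E.carrier →ₗ[R] X.carrier ⧸ X.ge b, ∀ x,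
      (X.ge b).mkQ x - v (i x) ∈ grMaxIdeal 𝒜 • (⊤ : Submodule R (X.carrier ⧸ X.ge b))) :
    ∃ ρ : E.carrier →ₗ[R] X.carrier, ρ ∘ₗ i = LinearMap.id := by
  obtain ⟨B₁, hB₁⟩ := E.exists_forall_lift_truncation
  obtain ⟨B₂, hB₂⟩ := X.exists_ge_le_smul_top
  -- Large enough both for maps from `E` to lift through the truncation and for the discarded part
  -- of `X` to lie in `𝔪X`.
  let b := max B₁ B₂
  let T := X.ofQuot _ (X.homog_ge b)
  let p : X.carrier →ₗ[R] T.carrier := (X.ge b).mkQ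
  have hp : p ∈ hom X T := X.mkQ_mem_hom _ (X.homog_ge b)
  obtain ⟨v, hv⟩ : ∃ v : E.carrier →ₗ[R] T.carrier, ∀ x, p x - v (i x) ∈
    grMaxIdeal 𝒜 • (⊤ : Submodule R T.carrier) := H b
  have hT : T.Homog (grMaxIdeal 𝒜 • ⊤) := T.homog_grMaxIdeal_smul_top
  -- Only degree-preserving maps lift, so `v` is replaced by its degree-zero part; the congruence
  -- survives because `𝔪T` is homogeneous.
  obtain ⟨v₀, hv₀, hv₀v⟩ : ∃ v₀ ∈ hom E T, ∀ n, ∀ x ∈ E.deg n, v₀ x = T.proj n (v x) := by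
    refine ⟨projHom 0 v, fun n x hx => ?_, fun n x hx => ?_⟩
    · have := projHom_mem 0 v n x hx
      rwa [add_zero] at this
    · have := projHom_apply v 0 hx
      rwa [add_zero] at this
  obtain ⟨v₁, hv₁⟩ : ∃ v₁ : E.carrier →ₗ[R] X.carrier, p ∘ₗ v₁ = v₀ :=
    hB₁ b (le_max_left _ _) X v₀ hv₀
  obtain ⟨v', hv', hv'v⟩ : ∃ v' ∈ hom E X, ∀ x, p (v' x) = v₀ x := by
    refine ⟨projHom 0 v₁, fun n x hx => ?_, fun x => ?_⟩
    · have := projHom_mem 0 v₁ n x hx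
      rwa [add_zero] at this
    · refine E.homogeneous_induction (P := fun x => p (projHom 0 v₁ x) = v₀ x) ?_ ?_ ?_ x
      · intro n x hx
        have h1 := projHom_apply v₁ 0 hx
        rw [add_zero] at h1
        rw [h1, ← hom_proj hp n (v₁ x), ← T.proj_of_mem (hv₀ n x hx)]
        exact congrArg (T.proj n) (LinearMap.congr_fun hv₁ x)
      · simp
      · intro x y hx hy; rw [map_add, map_add, hx, hy, map_add]
  have hmod : ∀ x, v' (i x) - x ∈ grMaxIdeal 𝒜 • (⊤ : Submodule R X.carrier) := by
    intro x
    have hx : p x - v₀ (i x) ∈ grMaxIdeal 𝒜 • (⊤ : Submodule R T.carrier) := by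
      refine X.homogeneous_induction (P := fun x => p x - v₀ (i x) ∈
        grMaxIdeal 𝒜 • (⊤ : Submodule R T.carrier)) ?_ ?_ ?_ x
      · intro n x hx
        have h1 := hT n _ (hv x)
        rwa [map_sub, T.proj_of_mem (hp n x hx), ← hv₀v n _ (hi n x hx)] at h1
      · rw [map_zero, map_zero, map_zero, sub_zero]
        exact Submodule.zero_mem _
      · intro x y hx hy
        rw [map_add, map_add, map_add, add_sub_add_comm]
        exact Submodule.add_mem _ hx hy
    rw [← hv'v, ← map_sub] at hx
    have h1 : p (x - v' (i x)) ∈ (grMaxIdeal 𝒜 • (⊤ : Submodule R X.carrier)).map (X.ge b).mkQ := by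
      rw [map_mkQ_smul_top]; exact hx
    obtain ⟨y, hy, hxy⟩ := h1
    have h2 : y - (x - v' (i x)) ∈ X.ge b := (Submodule.Quotient.eq _).1 hxy
    have h3 := Submodule.sub_mem _ (hB₂ b (le_max_right _ _) h2) hy
    rwa [sub_sub_cancel_left, neg_sub] at h3
  -- The endomorphism is the identity modulo `𝔪X`, so Nakayama makes it surjective, and a surjective
  -- endomorphism of a finite module is bijective.
  have hsurj : Function.Surjective (v' ∘ₗ i) := by
    rw [← LinearMap.range_eq_top]
    refine X.eq_top_of_sup_smul_eq_top _ (homog_range (M := X) (N := X) (f := v' ∘ₗ i)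
      fun n x hx => hv' n _ (hi n x hx)) (eq_top_iff.2 fun x _ => ?_)
    have h1 : x = (v' ∘ₗ i) x - (v' (i x) - x) := by simp
    rw [h1]
    exact Submodule.sub_mem _ (Submodule.mem_sup_left ⟨x, rfl⟩) (Submodule.mem_sup_right (hmod x))
  have hbij : Function.Bijective (v' ∘ₗ i) :=
    ⟨OrzechProperty.injective_of_surjective_endomorphism _ hsurj, hsurj⟩
  refine ⟨(LinearEquiv.ofBijective _ hbij).symm.toLinearMap ∘ₗ v', LinearMap.ext fun x => ?_⟩
  exact (LinearEquiv.ofBijective _ hbij).symm_apply_apply x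

end GrMod

end GradedLift

end

/-! ### Minimal number of generators -/

section GeneratorCount

variable {k : Type v} [Field k] {R : Type u} [CommRing R] [Algebra k R]
  (𝒜 : ℕ → Submodule k R) [GradedAlgebra 𝒜]

/-- The number of generators, as the dimension of `M / 𝔪 M`. -/
noncomputable def genCount (M : Type*) [AddCommGroup M] [Module k M] [Module R M]
    [IsScalarTower k R M] : ℕ :=
  Module.finrank k (M ⧸ grMaxIdeal 𝒜 • (⊤ : Submodule R M))

section

variable {X E M : Type*} [AddCommGroup X] [AddCommGroup E] [AddCommGroup M] [Module k X] [Module k E]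
  [Module k M] [Module R X] [Module R E] [Module R M] [IsScalarTower k R X] [IsScalarTower k R E]
  [IsScalarTower k R M]

/-- The map induced on `M / 𝔪 M`. -/
noncomputable def cotopMap (f : E →ₗ[R] M) : (E ⧸ grMaxIdeal 𝒜 • (⊤ : Submodule R E)) →ₗ[k]
    (M ⧸ grMaxIdeal 𝒜 • (⊤ : Submodule R M)) :=
  (Submodule.mapQ _ _ f (by
    rw [← Submodule.map_le_iff_le_comap, Submodule.map_smul'']
    exact smul_mono_right _ le_top)).restrictScalars k

theorem cotopMap_mk (f : E →ₗ[R] M) (x : E) :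
    cotopMap (k := k) 𝒜 f (Submodule.Quotient.mk x) = Submodule.Quotient.mk (f x) := rfl

theorem cotopMap_surjective {f : E →ₗ[R] M} (hf : Function.Surjective f) :
    Function.Surjective (cotopMap (k := k) 𝒜 f) := by
  intro y
  obtain ⟨y, rfl⟩ := Submodule.Quotient.mk_surjective _ y
  obtain ⟨x, rfl⟩ := hf y
  exact ⟨Submodule.Quotient.mk x, rfl⟩

variable [IsNoetherianRing R] (hR0 : Function.Bijective (algebraMap k (𝒜 0)))

include hR0

theorem finite_cotop (E : Type*) [AddCommGroup E] [Module k E] [Module R E] [IsScalarTower k R E]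
    [Module.Finite R E] : Module.Finite k (E ⧸ grMaxIdeal 𝒜 • (⊤ : Submodule R E)) := by
  refine finite_of_pow_smul_eq_bot 𝒜 hR0 1 _ ?_
  rw [pow_one, ← map_mkQ_smul_top, eq_bot_iff, Submodule.map_le_iff_le_comap, Submodule.comap_bot,
    Submodule.ker_mkQ]

/-- The class of `x` is a nonzero element of the kernel of the surjection `E / 𝔪E → M / 𝔪M`. -/
theorem genCount_lt [Module.Finite R E] {f : E →ₗ[R] M} (hf : Function.Surjective f) {x : E}
    (hx : x ∉ grMaxIdeal 𝒜 • (⊤ : Submodule R E)) (hfx : f x = 0) :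
    genCount 𝒜 M < genCount 𝒜 E := by
  have := finite_cotop 𝒜 hR0 E
  have h1 := LinearMap.finrank_range_add_finrank_ker (cotopMap (k := k) 𝒜 f)
  rw [LinearMap.range_eq_top.2 (cotopMap_surjective 𝒜 hf), finrank_top] at h1
  have h2 : 0 < Module.finrank k (LinearMap.ker (cotopMap (k := k) 𝒜 f)) := by
    rw [Module.finrank_pos_iff]
    refine ⟨⟨⟨Submodule.Quotient.mk x, ?_⟩, 0, fun h => hx ?_⟩⟩
    · rw [LinearMap.mem_ker, cotopMap_mk, hfx, Submodule.Quotient.mk_zero]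
    · exact (Submodule.Quotient.mk_eq_zero _).1 (congrArg Subtype.val h)
  unfold genCount
  omega

theorem genCount_le_add [Module.Finite R X] [Module.Finite R E] {i : X →ₗ[R] E} {p : E →ₗ[R] M}
    (hex : Function.Exact i p) (hp : Function.Surjective p) :
    genCount 𝒜 E ≤ genCount 𝒜 X + genCount 𝒜 M := by
  have := finite_cotop 𝒜 hR0 E
  have := finite_cotop 𝒜 hR0 X
  have h1 := LinearMap.finrank_range_add_finrank_ker (cotopMap (k := k) 𝒜 p)
  rw [LinearMap.range_eq_top.2 (cotopMap_surjective 𝒜 hp), finrank_top] at h1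
  have hle : LinearMap.ker (cotopMap (k := k) 𝒜 p) ≤ LinearMap.range (cotopMap (k := k) 𝒜 i) := by
    intro y hy
    obtain ⟨y, rfl⟩ := Submodule.Quotient.mk_surjective _ y
    have h2 : p y ∈ (grMaxIdeal 𝒜 • (⊤ : Submodule R E)).map p := by
      rw [Submodule.map_smul'', Submodule.map_top, LinearMap.range_eq_top.2 hp]
      exact (Submodule.Quotient.mk_eq_zero _).1 hy
    obtain ⟨z, hz, hzy⟩ := h2
    obtain ⟨x, hx⟩ := (hex (y - z)).1 (by rw [map_sub, hzy, sub_self])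
    refine ⟨Submodule.Quotient.mk x, ?_⟩
    rw [cotopMap_mk, hx]
    exact ((Submodule.Quotient.eq _).2 (by simpa using hz)).symm
  have h3 := Submodule.finrank_mono hle
  have h4 := LinearMap.finrank_range_le (cotopMap (k := k) 𝒜 i)
  unfold genCount
  omega

end

end GeneratorCount

/-! ### Finitely many modules with boundedly many generators -/

section FiniteType

variable {k : Type v} [Field k] {R : Type u} [CommRing R] [IsNoetherianRing R] [Algebra k R]
  {𝒜 : ℕ → Submodule k R} [GradedAlgebra 𝒜] (hR0 : Function.Bijective (algebraMap k (𝒜 0)))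

namespace GrMod

/-- If the summand `A` lay in `𝔪M`, projecting onto `A` would give `A = 𝔪A`, hence `A = 0`. -/
theorem exists_mem_notMem_smul_top (M : GrMod 𝒜) {A B : Submodule R M.carrier} (hA : M.Homog A)
    (hAB : IsCompl A B) (hne : A ≠ ⊥) :
    ∃ x ∈ A, x ∉ grMaxIdeal 𝒜 • (⊤ : Submodule R M.carrier) := by
  by_contra! h
  let π := A.projectionOnto B hAB
  have hπ : Function.Surjective π := LinearMap.range_eq_top.1 (Submodule.range_projectionOnto hAB)
  have htop : grMaxIdeal 𝒜 • (⊤ : Submodule R (M.ofSub A hA).carrier) = ⊤ := by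
    rw [eq_top_iff]
    intro x _
    obtain ⟨x, hx⟩ : A := x
    have h1 : π x ∈ (grMaxIdeal 𝒜 • (⊤ : Submodule R M.carrier)).map π := ⟨x, h x hx, rfl⟩
    rw [Submodule.map_smul'', Submodule.map_top, LinearMap.range_eq_top.2 hπ,
      Submodule.projectionOnto_apply_left hAB ⟨x, hx⟩] at h1
    exact h1
  have h2 := (M.ofSub A hA).eq_top_of_sup_smul_eq_top ⊥ (fun n x hx => by
    rw [(Submodule.mem_bot R).1 hx, map_zero]; exact Submodule.zero_mem _) (by rw [htop]; simp)
  refine hne (eq_bot_iff.2 fun x hx => ?_)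
  have h3 : (⟨x, hx⟩ : A) ∈ (⊥ : Submodule R A) := by
    change (⟨x, hx⟩ : A) ∈ (⊥ : Submodule R (M.ofSub A hA).carrier)
    rw [h2]; trivial
  exact congrArg Subtype.val ((Submodule.mem_bot R).1 h3)

include hR0

/-- Under finite representation type there are, up to ungraded isomorphism, only finitely many
graded Cohen-Macaulay modules with a bounded number of generators. -/
theorem exists_finite_representatives (hfin : IsGradedFiniteRepType 𝒜) (B : ℕ) :
    ∃ (T : Type) (_ : Finite T) (G : T → ModuleCat.{u} R), ∀ E : GrMod 𝒜, E.IsCM →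
      genCount 𝒜 E.carrier ≤ B → ∃ t, Nonempty (E.carrier ≃ₗ[R] G t) := by
  obtain ⟨r, Y, hY⟩ := hfin
  induction B with
  | zero =>
    refine ⟨Unit, inferInstance, fun _ => ModuleCat.of R PUnit, fun E _ hE => ⟨(), ?_⟩⟩
    have h1 := finite_cotop 𝒜 hR0 E.carrier
    have h2 : Subsingleton (E.carrier ⧸ grMaxIdeal 𝒜 • (⊤ : Submodule R E.carrier)) :=
      Module.finrank_zero_iff.1 (Nat.le_zero.1 hE)
    have h3 : grMaxIdeal 𝒜 • (⊤ : Submodule R E.carrier) = ⊤ := Submodule.Quotient.subsingleton_iff.1 h2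
    have h4 := E.eq_top_of_sup_smul_eq_top ⊥ (fun n x hx => by
      rw [(Submodule.mem_bot R).1 hx, map_zero]; exact Submodule.zero_mem _) (by rw [h3]; simp)
    have h5 : Subsingleton E.carrier :=
      (Submodule.subsingleton_iff R).1 (subsingleton_of_bot_eq_top h4)
    exact ⟨{ toFun := fun _ => PUnit.unit, map_add' := fun _ _ => rfl, map_smul' := fun _ _ => rfl,
             invFun := fun _ => 0, left_inv := fun _ => Subsingleton.elim _ _,
             right_inv := fun _ => rfl }⟩
  | succ B ih =>
    obtain ⟨T, hT, G, hG⟩ := ih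
    -- A module with at most `B + 1` generators either already occurs for `B`, or is a shifted `Y
    -- i`, or is a sum of two nonzero summands, each with strictly fewer generators. Shifts do not
    -- matter because the isomorphism is ungraded.
    refine ⟨T ⊕ Fin r ⊕ T × T, inferInstance, Sum.elim G (Sum.elim (fun i => ModuleCat.of R (Y i).carrier)
      fun t => ModuleCat.of R (G t.1 × G t.2)), fun E hE hEB => ?_⟩
    by_cases hsub : Nontrivial E.carrier
    swap
    · have h5 : Subsingleton E.carrier := not_nontrivial_iff_subsingleton.1 hsub
      have h6 : genCount 𝒜 E.carrier = 0 := by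
        have : Subsingleton (E.carrier ⧸ grMaxIdeal 𝒜 • (⊤ : Submodule R E.carrier)) :=
          (Submodule.Quotient.mk_surjective _).subsingleton
        exact Module.finrank_zero_of_subsingleton
      obtain ⟨t, ht⟩ := hG E hE (by omega)
      exact ⟨Sum.inl t, ht⟩
    by_cases hind : E.Indecomposable
    · obtain ⟨i, j, e, -⟩ := hY E hE hind
      exact ⟨Sum.inr (Sum.inl i), ⟨e⟩⟩
    · have h1 : ∃ A C : Submodule R E.carrier, E.IsGradedSubmodule A ∧ E.IsGradedSubmodule C ∧
          IsCompl A C ∧ A ≠ ⊥ ∧ C ≠ ⊥ := by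
        by_contra hcon
        refine hind ⟨hsub, fun A C hA hC hAC => ?_⟩
        by_contra hne
        push Not at hne
        exact hcon ⟨A, C, hA, hC, hAC, hne.1, hne.2⟩
      obtain ⟨A, C, hA, hC, hAC, hA0, hC0⟩ := h1
      have part : ∀ A C : Submodule R E.carrier, E.Homog A → E.Homog C → IsCompl A C → C ≠ ⊥ →
          ∃ t, Nonempty (A ≃ₗ[R] G t) := by
        intro A C hA hC hAC hC0
        refine hG (E.ofSub A hA) ?_ ?_
        · exact isGradedCM_of_retract A.subtype (A.projectionOnto C hAC)
            (Submodule.projectionOnto_apply_left hAC) hE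
        · obtain ⟨x, hx, hxm⟩ := E.exists_mem_notMem_smul_top hC hAC.symm hC0
          have h2 := genCount_lt 𝒜 hR0 (f := A.projectionOnto C hAC)
            (LinearMap.range_eq_top.1 (Submodule.range_projectionOnto hAC)) hxm
            ((Submodule.projectionOnto_apply_eq_zero_iff hAC).2 hx)
          have h3 : genCount 𝒜 (E.ofSub A hA).carrier < genCount 𝒜 E.carrier := h2
          omega
      have hA' := homog_of_isGradedSubmodule hA
      have hC' := homog_of_isGradedSubmodule hC
      obtain ⟨t, ⟨e⟩⟩ := part A C hA' hC' hAC hC0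
      obtain ⟨t', ⟨e'⟩⟩ := part C A hC' hA' hAC.symm hA0
      exact ⟨Sum.inr (Sum.inr (t, t')),
        ⟨(Submodule.prodEquivOfIsCompl A C hAC).symm.trans (e.prodCongr e')⟩⟩

end GrMod

end FiniteType

/-! ### Pullbacks of extensions -/

section Pullback

variable {R : Type*} [CommRing R] {M X W Y : Type*} [AddCommGroup M] [AddCommGroup X]
  [AddCommGroup W] [AddCommGroup Y] [Module R M] [Module R X] [Module R W] [Module R Y]

/-- The pullback of two linear maps. -/
def pullback (g : M →ₗ[R] Y) (q : W →ₗ[R] Y) : Submodule R (M × W) :=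
  LinearMap.ker (g ∘ₗ LinearMap.fst R M W - q ∘ₗ LinearMap.snd R M W)

variable {g : M →ₗ[R] Y} {q : W →ₗ[R] Y} {j : X →ₗ[R] W}

theorem mem_pullback {z : M × W} : z ∈ pullback g q ↔ g z.1 = q z.2 := by
  rw [pullback, LinearMap.mem_ker, LinearMap.sub_apply, sub_eq_zero]; rfl

/-- The inclusion of the kernel into the pullback. -/
def pullbackInl (g : M →ₗ[R] Y) (hex : Function.Exact j q) : X →ₗ[R] pullback g q :=
  LinearMap.codRestrict _ (LinearMap.inr R M W ∘ₗ j) fun x => by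
    rw [mem_pullback]
    change g 0 = q (j x)
    rw [map_zero, hex.apply_apply_eq_zero]

/-- The projection of the pullback. -/
def pullbackFst (g : M →ₗ[R] Y) (q : W →ₗ[R] Y) : pullback g q →ₗ[R] M :=
  LinearMap.fst R M W ∘ₗ (pullback g q).subtype

theorem pullbackInl_injective (hex : Function.Exact j q) (hj : Function.Injective j) :
    Function.Injective (pullbackInl g hex) := fun _ _ h =>
  hj (congrArg (fun z : pullback g q => z.1.2) h)

theorem pullbackFst_surjective (hq : Function.Surjective q) :
    Function.Surjective (pullbackFst g q) := by
  intro m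
  obtain ⟨w, hw⟩ := hq (g m)
  exact ⟨⟨(m, w), mem_pullback.2 hw.symm⟩, rfl⟩

theorem pullback_exact (hex : Function.Exact j q) :
    Function.Exact (pullbackInl g hex) (pullbackFst g q) := by
  rintro ⟨⟨m, w⟩, hz⟩
  rw [mem_pullback] at hz
  constructor
  · intro h
    change m = 0 at h
    subst h
    change g 0 = q w at hz
    rw [map_zero] at hz
    obtain ⟨x, hx⟩ := (hex w).1 hz.symm
    exact ⟨x, Subtype.ext (Prod.ext rfl hx)⟩
  · rintro ⟨x, hx⟩
    exact (congrArg (fun z : pullback g q => z.1.1) hx).symm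

/-- A splitting of the pullback gives a lift. -/
theorem exists_lift_of_retraction (hex : Function.Exact j q) (hj : Function.Injective j)
    (hq : Function.Surjective q) (ρ : pullback g q →ₗ[R] X)
    (hρ : ρ ∘ₗ pullbackInl g hex = LinearMap.id) : ∃ h : M →ₗ[R] W, q ∘ₗ h = g := by
  obtain ⟨σ, hσ⟩ : ∃ σ, pullbackFst g q ∘ₗ σ = LinearMap.id :=
    ((Function.Exact.split_tfae (pullback_exact (g := g) hex)
      (pullbackInl_injective hex hj) (pullbackFst_surjective hq)).out 1 0 rfl rfl).1 ⟨ρ, hρ⟩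
  refine ⟨LinearMap.snd R M W ∘ₗ (pullback g q).subtype ∘ₗ σ, LinearMap.ext fun m => ?_⟩
  have h1 := mem_pullback.1 (σ m).2
  have h2 : (σ m).1.1 = m := LinearMap.congr_fun hσ m
  rw [h2] at h1
  exact h1.symm

/-- The comparison of the pullbacks of `g` and of a multiple of `g`. -/
def pullbackSmul (g : M →ₗ[R] Y) (hex : Function.Exact j q) (a : R) :
    X × pullback g q →ₗ[R] pullback (a • g) q :=
  LinearMap.codRestrict _
    (LinearMap.prod (LinearMap.fst R M W ∘ₗ (pullback g q).subtype ∘ₗ LinearMap.snd R X _)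
      (a • (LinearMap.snd R M W ∘ₗ (pullback g q).subtype ∘ₗ LinearMap.snd R X _) -
        j ∘ₗ LinearMap.fst R X _)) fun z => by
    rw [mem_pullback]
    change a • g z.2.1.1 = q (a • z.2.1.2 - j z.1)
    rw [map_sub, map_smul, hex.apply_apply_eq_zero, sub_zero, mem_pullback.1 z.2.2]

theorem pullbackSmul_surjective (hex : Function.Exact j q) (hq : Function.Surjective q) (a : R) :
    Function.Surjective (pullbackSmul g hex a) := by
  rintro ⟨⟨m, w⟩, hz⟩
  have hz' : a • g m = q w := mem_pullback.1 hz
  obtain ⟨w', hw'⟩ := hq (g m)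
  obtain ⟨x, hx⟩ := (hex (a • w' - w)).1 (by rw [map_sub, map_smul, hw', hz', sub_self])
  refine ⟨(x, ⟨(m, w'), mem_pullback.2 hw'.symm⟩), Subtype.ext (Prod.ext rfl ?_)⟩
  change a • w' - j x = w
  rw [hx, sub_sub_cancel]

/-- This is the sequence `X → X ⊕ E_g → E_(a•g)`: up to sign it presents the pullback along `a • g`
as the pushout of the extension `E_g` along multiplication by `a` on `X`. -/
theorem pullbackSmul_exact (hex : Function.Exact j q) (hj : Function.Injective j) (a : R) :
    Function.Exact (LinearMap.prod (a • LinearMap.id) (pullbackInl g hex)) (pullbackSmul g hex a) := by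
  rintro ⟨x, ⟨⟨m, w⟩, hz⟩⟩
  have hz' : g m = q w := mem_pullback.1 hz
  constructor
  · intro h
    have h1 : m = 0 := congrArg (fun z : pullback (a • g) q => z.1.1) h
    have h2 : a • w - j x = 0 := congrArg (fun z : pullback (a • g) q => z.1.2) h
    subst h1
    rw [map_zero] at hz'
    obtain ⟨y, rfl⟩ := (hex w).1 hz'.symm
    rw [← map_smul, sub_eq_zero] at h2
    exact ⟨y, Prod.ext (hj h2) rfl⟩
  · rintro ⟨y, hy⟩
    have h1 : a • y = x := congrArg Prod.fst hy
    have h2 : (0, j y) = (m, w) := congrArg (fun z : X × pullback g q => z.2.1) hy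
    obtain ⟨rfl, rfl⟩ := Prod.mk.inj h2
    refine Subtype.ext (Prod.ext rfl ?_)
    change a • j y - j x = 0
    rw [← h1, map_smul, sub_self]

end Pullback

/-! ### Lifting for finite representation type -/

section FiniteRepType

variable {k : Type v} [Field k] {R : Type u} [CommRing R] [IsNoetherianRing R] [Algebra k R]
  {𝒜 : ℕ → Submodule k R} [GradedAlgebra 𝒜]

namespace GrMod

variable {M X W Y : GrMod 𝒜}

/-- The pullback as a graded module. -/
noncomputable def grPullback {c : ℤ} {g : M.carrier →ₗ[R] Y.carrier} (hg : g ∈ (M.ihom Y).deg c)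
    {q : W.carrier →ₗ[R] Y.carrier} (hq : q ∈ hom W Y) : GrMod 𝒜 :=
  (M.prod (W.shift c)).ofSub (pullback g q) (homog_ker (M := M.prod (W.shift c)) (N := Y.shift c)
    fun n x hx => (Y.deg (n + c)).sub_mem (hg n x.1 hx.1) (hq (n + c) x.2 hx.2))

variable (hR0 : Function.Bijective (algebraMap k (𝒜 0)))

include hR0

/-- If the pullbacks along `g` and along `a • g` are isomorphic as modules, then `g` lifts. -/
theorem exists_lift_of_pullback_equiv {j : X.carrier →ₗ[R] W.carrier}
    {q : W.carrier →ₗ[R] Y.carrier} (hj : j ∈ hom X W) (hq : q ∈ hom W Y) (hinj : Function.Injective j)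
    (hex : Function.Exact j q) (hsurj : Function.Surjective q) {c : ℤ}
    {g : M.carrier →ₗ[R] Y.carrier} (hg : g ∈ (M.ihom Y).deg c) {a : R} (ha : a ∈ grMaxIdeal 𝒜)
    (e : pullback g q ≃ₗ[R] pullback (a • g) q) :
    ∃ h : M.carrier →ₗ[R] W.carrier, q ∘ₗ h = g := by
  let E := grPullback hg hq
  obtain ⟨ρ, hρ⟩ := exists_retraction_of_truncation (X := X.shift c) (E := E)
    (i := pullbackInl g hex) (fun n x hx => ⟨M.deg n |>.zero_mem, hj _ x hx⟩) (by
      intro b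
      let T := X.carrier ⧸ (X.shift c).ge b
      have hT : Module.Finite k T := (X.shift c).finite_quot_ge hR0 b
      have hfE : Module.Finite R (pullback g q) := E.finite
      have h1 := finite_linearMap_of_finite (k := k) (R := R) X.carrier T
      have h2 := finite_linearMap_of_finite (k := k) (R := R) (pullback g q) T
      have h3 := finite_linearMap_of_finite (k := k) (R := R) (X.carrier × pullback g q) T
      -- The isomorphism `e` makes `Hom` from the two pullbacks equidimensional, which is the
      -- numerical criterion for extending maps `X → T` along `x ↦ (a • x, i x)`.
      have hdim : Module.finrank k (X.carrier × pullback g q →ₗ[R] T) =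
          Module.finrank k (X.carrier →ₗ[R] T) + Module.finrank k (pullback (a • g) q →ₗ[R] T) := by
        rw [← (LinearMap.coprodEquiv k (R := R) (M := X.carrier) (M₂ := pullback g q)
          (M₃ := T)).finrank_eq, Module.finrank_prod,
          (LinearEquiv.congrLeft T k e).finrank_eq]
      obtain ⟨s, hs⟩ := exists_extension_of_finrank_eq (pullbackSmul_exact hex hinj a)
        (pullbackSmul_surjective hex hsurj a) hdim ((X.shift c).ge b).mkQ
      refine ⟨s ∘ₗ LinearMap.inr R X.carrier (pullback g q), fun x => ?_⟩
      -- The extension `s` of the quotient map satisfies `s (a • x, i x) = x` modulo the truncation,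
      -- so its restriction to the pullback is a retraction up to the error `a • s (x, 0)`, which
      -- lies in `𝔪T`.
      have h4 : ((X.shift c).ge b).mkQ x = s (a • x, pullbackInl g hex x) :=
        (LinearMap.congr_fun hs x).symm
      have h5 : s (a • x, pullbackInl g hex x) - s (0, pullbackInl g hex x) = a • s (x, 0) := by
        rw [← map_sub, ← map_smul]
        congr 1
        exact Prod.ext (sub_zero _) ((sub_self _).trans (smul_zero a).symm)
      rw [h4]
      change s (a • x, pullbackInl g hex x) - s (0, pullbackInl g hex x) ∈ _
      rw [h5]
      exact Submodule.smul_mem_smul ha trivial)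
  exact exists_lift_of_retraction hex hinj hsurj ρ hρ

/-- The pullbacks along all `r ^ n • f` are extensions of `M` by `X`, with a number of generators
bounded independently of `n`. Two of them are isomorphic by the pigeonhole principle; the later one
is the pullback along a multiple by a power of `r` in `𝔪`, so the earlier extension splits. -/
theorem exists_lift_pow_of_finiteRepType (hfin : IsGradedFiniteRepType 𝒜) (hM : M.IsCM) (hX : X.IsCM)
    {j : X.carrier →ₗ[R] W.carrier} {q : W.carrier →ₗ[R] Y.carrier} (hj : j ∈ hom X W)
    (hq : q ∈ hom W Y) (hinj : Function.Injective j) (hex : Function.Exact j q)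
    (hsurj : Function.Surjective q) {e : ℤ} {f : M.carrier →ₗ[R] Y.carrier}
    (hf : f ∈ (M.ihom Y).deg e) {i : ℕ} (hi : 0 < i) {r : R} (hr : r ∈ 𝒜 i) :
    ∃ (n : ℕ) (h : M.carrier →ₗ[R] W.carrier), q ∘ₗ h = r ^ n • f := by
  have hdeg : ∀ n : ℕ, r ^ n • f ∈ (M.ihom Y).deg (e + (n * i : ℕ)) := by
    intro n
    have h1 : r ^ n ∈ 𝒜 (n * i) := by
      have := SetLike.pow_mem_graded n hr; rwa [smul_eq_mul] at this
    exact (M.ihom Y).smul_mem _ _ _ f h1 hf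
  obtain ⟨T, hT, G, hG⟩ := exists_finite_representatives hR0 hfin
    (genCount 𝒜 X.carrier + genCount 𝒜 M.carrier)
  have hrep : ∀ n : ℕ, ∃ t, Nonempty (pullback (r ^ n • f) q ≃ₗ[R] G t) := fun n =>
    hG (grPullback (hdeg n) hq)
      (isGradedCM_of_exact (pullbackInl (r ^ n • f) hex) (pullbackFst (r ^ n • f) q)
        (pullbackInl_injective hex hinj) (pullback_exact hex) (pullbackFst_surjective hsurj) hX hM)
      (genCount_le_add 𝒜 hR0 (E := (grPullback (hdeg n) hq).carrier) (i := pullbackInl (r ^ n • f) hex)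
        (p := pullbackFst (r ^ n • f) q) (pullback_exact hex) (pullbackFst_surjective hsurj))
  choose t ht using hrep
  obtain ⟨n, m, hnm, htt⟩ : ∃ n m : ℕ, n < m ∧ t n = t m := by
    obtain ⟨n, m, hne, h⟩ := Finite.exists_ne_map_eq_of_infinite t
    rcases lt_or_gt_of_ne hne with hlt | hlt
    · exact ⟨n, m, hlt, h⟩
    · exact ⟨m, n, hlt, h.symm⟩
  obtain ⟨e₁⟩ := ht n
  obtain ⟨e₂⟩ := ht m
  rw [← htt] at e₂
  have hpow : r ^ m • f = r ^ (m - n) • r ^ n • f := by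
    rw [smul_smul, ← pow_add, Nat.sub_add_cancel hnm.le]
  rw [hpow] at e₂
  obtain ⟨h, hh⟩ := exists_lift_of_pullback_equiv hR0 hj hq hinj hex hsurj (hdeg n)
    (Ideal.pow_mem_of_mem _ (mem_grMaxIdeal_of_mem 𝒜 hi hr) (m - n) (by omega)) (e₁.trans e₂.symm)
  exact ⟨n, h, hh⟩

end GrMod

end FiniteRepType

/-! ### Invariance under isomorphism and the main theorem -/

section HomDim

variable {k : Type v} [Field k] {R : Type u} [CommRing R] [Algebra k R]
  {𝒜 : ℕ → Submodule k R}

namespace GrMod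

theorem homDim_congr {X X' : GrMod 𝒜} (M : GrMod 𝒜) (h : X.Iso X') : M.homDim X = M.homDim X' := by
  obtain ⟨e, he⟩ := h
  let E : hom M X ≃ₗ[k] hom M X' :=
    { toFun := fun f => ⟨e.toLinearMap ∘ₗ f.1, fun n m hm => (he n _).1 (f.2 n m hm)⟩
      map_add' := fun f g => Subtype.ext (LinearMap.comp_add _ _ _)
      map_smul' := fun c f => Subtype.ext (LinearMap.ext fun m =>
        (e.toLinearMap.restrictScalars k).map_smul c (f.1 m))
      invFun := fun f => ⟨e.symm.toLinearMap ∘ₗ f.1, fun n m hm => (he n _).2 (by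
        simpa using f.2 n m hm)⟩
      left_inv := fun f => Subtype.ext (LinearMap.ext fun m => e.symm_apply_apply _)
      right_inv := fun f => Subtype.ext (LinearMap.ext fun m => e.apply_symm_apply _) }
  exact E.finrank_eq

end GrMod

end HomDim

/-- `R` is a Noetherian `ℕ`-graded Cohen-Macaulay ring with `R_0 = k` a field of characteristic
zero; `M` and `N` are graded Cohen-Macaulay modules with `h(M) = h(N)` and `M ≤_hom N`. -/
theorem lemma3p5 {k : Type v} [Field k] [CharZero k]
    {R : Type u} [CommRing R] [IsNoetherianRing R] [Algebra k R]
    (𝒜 : ℕ → Submodule k R) [GradedAlgebra 𝒜]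
    (hR0 : Function.Bijective (algebraMap k (𝒜 0)))
    (hR : IsGradedCM 𝒜 R)
    (M N : GrMod 𝒜) (hM : M.IsCM) (hN : N.IsCM)
    (hh : M.hilb = N.hilb) (hom : M.HomLE N) :
    (IsGradedIsolatedSingularity 𝒜 →
      ∀ X : GrMod 𝒜, X.IsCM → ∃ l₀ : ℤ, ∀ l : ℤ, l₀ ≤ l →
        M.homDim (X.shift l) = N.homDim (X.shift l) ∧
        M.homDim (X.shift (-l)) = N.homDim (X.shift (-l))) ∧
    (IsGradedFiniteRepType 𝒜 →
      ∃ (r : ℕ) (Y : Fin r → GrMod 𝒜), ∀ X : GrMod 𝒜, X.IsCM → X.Indecomposable →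
        0 < (N.homDim X : ℤ) - (M.homDim X : ℤ) → ∃ i : Fin r, X.Iso (Y i)) := by
  refine ⟨fun hiso X hX => ?_, fun hfin => ?_⟩
  · obtain ⟨l₀, hl₀⟩ := GrMod.exists_forall_homDim_eq hR0 hR hM hN hh hom X hX
      (fun W Y j q _ hq _ _ hsurj L hL e f hf i hi r hr =>
        GrMod.exists_lift_pow_of_isolatedSingularity hR0 hR hiso hL hq hsurj hf hi hr)
    exact ⟨l₀, fun l hl => ⟨hl₀ l (hl.trans (le_abs_self l)),
      hl₀ (-l) (by rw [abs_neg]; exact hl.trans (le_abs_self l))⟩⟩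
  · obtain ⟨r, Y, hY⟩ := id hfin
    -- The listed representatives are not assumed Cohen–Macaulay, so the bound is conditional; `0`
    -- is a dummy value otherwise.
    have hbound : ∀ i : Fin r, ∃ B : ℕ, (Y i).IsCM → ∀ l : ℤ, (B : ℤ) ≤ |l| →
        M.homDim ((Y i).shift l) = N.homDim ((Y i).shift l) := by
      intro i
      by_cases hCM : (Y i).IsCM
      · obtain ⟨l₀, hl₀⟩ := GrMod.exists_forall_homDim_eq hR0 hR hM hN hh hom (Y i) hCM
          (fun W Z j q hj hq hinj hex hsurj L hL e f hf n hn a ha =>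
            GrMod.exists_lift_pow_of_finiteRepType hR0 hfin hL hCM hj hq hinj hex hsurj hf hn ha)
        exact ⟨l₀.toNat, fun _ l hl => hl₀ l (by omega)⟩
      · exact ⟨0, fun h => absurd h hCM⟩
    choose B hB using hbound
    let D := Finset.univ.sup B
    have hD : ∀ i, B i ≤ D := fun i => Finset.le_sup (f := B) (Finset.mem_univ i)
    let e := (finProdFinEquiv : Fin r × Fin (2 * D + 1) ≃ Fin (r * (2 * D + 1)))
    -- The finite list consists of the shifts of each `Y i` by `-D, …, D`; the second index is
    -- recentred by `D`.
    refine ⟨r * (2 * D + 1), fun a => (Y (e.symm a).1).shift ((e.symm a).2 - D : ℤ),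
      fun X hX hind hpos => ?_⟩
    obtain ⟨i, l, hiso⟩ := hY X hX hind
    -- `Y i` and its shift have the same underlying module, and the latter is isomorphic to `X`.
    have hCM : (Y i).IsCM := by
      obtain ⟨φ, -⟩ := id hiso
      exact isGradedCM_of_retract (M := (Y i).carrier) φ.symm.toLinearMap φ.toLinearMap
        φ.apply_symm_apply hX
    have hl : |l| < D := by
      by_contra hle
      have h1 := hB i hCM l (by have := hD i; omega)
      rw [GrMod.homDim_congr M hiso, GrMod.homDim_congr N hiso, h1, sub_self] at hpos
      exact lt_irrefl _ hpos
    have hl' := abs_lt.1 hl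
    refine ⟨e (i, ⟨(l + D).toNat, by omega⟩), ?_⟩
    have h2 : (((l + D).toNat : ℕ) : ℤ) - D = l := by omega
    simp only [Equiv.symm_apply_apply, h2]
    exact hiso
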